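/- Let $K$ be a simplicial complex of bounded geometry: $K$ is connected and star-bounded (there is a constant $C$ such that every vertex lies on at most $C$ edges), and every simplex of $K$ carries the metric of the standard Euclidean simplex, so that all edges have the same length. Let $1\le p\le\infty$. A piecewise smooth (Lipschitz–Sullivan) $k$-form $\omega$ on $K$ is a family $(\omega_\sigma)_{\sigma\in K}$, where $\omega_\sigma$ is a $k$-form on the closed simplex $\sigma$ that is $C^\infty$ up to the boundary, such that $\omega_\sigma$ restricts (by pullback) to $\omega_\tau$ for every face $\tau$ of $\sigma$; the differential is $(d\omega)_\sigma=d\omega_\sigma$. Put $$\|\omega\|_{\Omega_{\infty,\infty}(\sigma)}=\max\Big\{\sup_{\sigma}|\omega_\sigma|,\ \sup_{\sigma}|d\omega_\sigma|\Big\},$$ and let $S\mathscr L^k_p(K)$ be the space of those $\omega$ for which the family $\big(\|\omega\|_{\Omega_{\infty,\infty}(\sigma)}\big)_{\sigma\in K}$ belongs to $\ell_p$, i.e. $\sum_{\sigma\in K}\|\omega\|^p_{\Omega_{\infty,\infty}(\sigma)}<\infty$ (for $p=\infty$: the family is bounded). Let $C^k_p(K)$ be the space of real oriented (alternating) simplicial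 $k$-cochains $c$ whose values form an $\ell_p$ family, i.e. $\sum_{\sigma}|c(\sigma)|^p<\infty$, the sum running over the $k$-simplices (for $p=\infty$: $c$ is bounded), with the simplicial coboundary. Then $S\mathscr L^*_p(K)$ and $C^*_p(K)$ are cochain complexes of real vector spaces, integration over simplices $\mathscr I(\omega)(\sigma)=\int_\sigma\omega$ defines a morphism of cochain complexes $\mathscr I\colon S\mathscr L^*_p(K)\to C^*_p(K)$, and for every $k\ge 0$ it induces an isomorphism of real vector spaces $$H^k(C^*_p(K))\;\cong\;H^k(S\mathscr L^*_p(K)).$$ -/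

import Mathlib

open scoped ENNReal

universe u

noncomputable section

namespace LpDeRham

/-! ### Simplicial complexes of bounded geometry -/

/-- The graph underlying the `1`-skeleton of a simplicial complex: two distinct vertices are
adjacent when they lie in a common simplex. -/
def skeletonGraph {V : Type u} (K : AbstractSimplicialComplex V) : SimpleGraph V where
  Adj v w := v ≠ w ∧ ∃ s ∈ K, v ∈ s ∧ w ∈ s
  symm := ⟨fun _ _ h => ⟨h.1.symm, h.2.imp fun _ hs => ⟨hs.1, hs.2.2, hs.2.1⟩⟩⟩
  loopless := ⟨fun _ h => h.1 rfl⟩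

/-- Bounded geometry: `K` is connected and star-bounded. Simplices are realised below as
standard Euclidean simplices, so all edges have the same length and no further metric condition
is needed. -/
structure BoundedGeometry {V : Type u} (K : AbstractSimplicialComplex V) : Prop where
  connected : (skeletonGraph K).Connected
  starBounded : ∃ C : ℕ, ∀ v : V, ((skeletonGraph K).neighborSet v).encard ≤ C

/-- The `m`-simplices of `K` together with an enumeration `0, …, m` of their vertices. -/
def Simplex {V : Type u} (K : AbstractSimplicialComplex V) (m : ℕ) : Type u :=
  {ρ : Fin (m + 1) ↪ V // Finset.univ.map ρ ∈ K}

/-- The face of `ρ` with vertices `ρ (f 0), …, ρ (f k)`. For `k = m` this is a renumbering of the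
vertices of `ρ`. -/
def Simplex.face {V : Type u} {K : AbstractSimplicialComplex V} {k m : ℕ} (ρ : Simplex K m)
    (f : Fin (k + 1) ↪ Fin (m + 1)) : Simplex K k :=
  ⟨f.trans ρ.1, by
    refine (K.isRelLowerSet_faces ρ.2).2 (fun v hv => ?_) (by simp)
    simp only [Finset.mem_map, Finset.mem_univ, true_and, Function.Embedding.trans_apply] at hv ⊢
    obtain ⟨i, rfl⟩ := hv
    exact ⟨f i, rfl⟩⟩

theorem Simplex.face_face {V : Type u} {K : AbstractSimplicialComplex V} {l k m : ℕ}
    (ρ : Simplex K m) (f : Fin (k + 1) ↪ Fin (m + 1)) (g : Fin (l + 1) ↪ Fin (k + 1)) :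
    (ρ.face f).face g = ρ.face (g.trans f) := rfl

/-! ### The standard Euclidean simplex -/

/-- The vectors of `ℝ^(m+1)` with coordinate sum `0`. -/
def sumZero (m : ℕ) : Submodule ℝ (EuclideanSpace ℝ (Fin (m + 1))) where
  carrier := {v | ∑ i, v i = 0}
  zero_mem' := by simp
  add_mem' {v w} hv hw := by
    simp only [Set.mem_ofPred_eq] at hv hw ⊢
    simp [Finset.sum_add_distrib, hv, hw]
  smul_mem' c v hv := by
    simp only [Set.mem_ofPred_eq] at hv ⊢
    simp [← Finset.mul_sum, hv]

/-- The tangent space of the standard `m`-simplex: vectors of `ℝ^(m+1)` with coordinate sum `0`,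
with the Euclidean inner product. -/
def Tangent (m : ℕ) : Type := sumZero m

instance (m : ℕ) : NormedAddCommGroup (Tangent m) := inferInstanceAs (NormedAddCommGroup (sumZero m))

instance (m : ℕ) : InnerProductSpace ℝ (Tangent m) :=
  inferInstanceAs (InnerProductSpace ℝ (sumZero m))

instance (m : ℕ) : FiniteDimensional ℝ (Tangent m) :=
  inferInstanceAs (FiniteDimensional ℝ (sumZero m))

/-- The `i`-th coordinate of a tangent vector. -/
def coord {m : ℕ} (x : Tangent m) (i : Fin (m + 1)) : ℝ := x.1 i

/-- The tangent vector with given coordinates. -/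
def ofCoord {m : ℕ} (t : Fin (m + 1) → ℝ) (ht : ∑ i, t i = 0) : Tangent m :=
  ⟨WithLp.toLp 2 t, ht⟩

theorem coord_ofCoord {m : ℕ} (t : Fin (m + 1) → ℝ) (ht : ∑ i, t i = 0) (i : Fin (m + 1)) :
    coord (ofCoord t ht) i = t i := rfl

theorem tangent_ext {m : ℕ} {x y : Tangent m} (h : ∀ i, coord x i = coord y i) : x = y :=
  Subtype.ext (PiLp.ext h)

theorem coord_add {m : ℕ} (x y : Tangent m) (i : Fin (m + 1)) :
    coord (x + y) i = coord x i + coord y i := rfl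

theorem coord_smul {m : ℕ} (c : ℝ) (x : Tangent m) (i : Fin (m + 1)) :
    coord (c • x) i = c * coord x i := rfl

theorem coord_zero {m : ℕ} (i : Fin (m + 1)) : coord (0 : Tangent m) i = 0 := rfl

theorem sum_coord {m : ℕ} (x : Tangent m) : ∑ i, coord x i = 0 := x.2

theorem continuous_coord {m : ℕ} (i : Fin (m + 1)) :
    Continuous fun x : Tangent m => coord x i :=
  (EuclideanSpace.proj (𝕜 := ℝ) i).continuous.comp (sumZero m).subtypeL.continuous

/-- The affine hyperplane `t_0 + ⋯ + t_m = 1` is identified with `Tangent m`, the barycentre being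
the origin; `baryCoord x` is the tuple of barycentric coordinates `t_i` of the point `x`. -/
def baryCoord {m : ℕ} (x : Tangent m) : Fin (m + 1) → ℝ :=
  fun i => coord x i + 1 / ((m : ℝ) + 1)

/-- The closed standard `m`-simplex `{t_i ≥ 0, t_0 + ⋯ + t_m = 1}`. -/
def simplexSet (m : ℕ) : Set (Tangent m) :=
  {x | baryCoord x ∈ stdSimplex ℝ (Fin (m + 1))}

theorem sum_baryCoord {m : ℕ} (x : Tangent m) : ∑ i, baryCoord x i = 1 := by
  have h' : (m : ℝ) + 1 ≠ 0 := by positivity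
  simp only [baryCoord, Finset.sum_add_distrib, sum_coord]
  simp [h']

/-- The point of the hyperplane with barycentric coordinates `t`. -/
def ofBary {m : ℕ} (t : Fin (m + 1) → ℝ) (ht : ∑ i, t i = 1) : Tangent m :=
  ofCoord (fun i => t i - 1 / ((m : ℝ) + 1)) (by
    have h' : (m : ℝ) + 1 ≠ 0 := by positivity
    rw [Finset.sum_sub_distrib, ht]
    simp [h'])

theorem baryCoord_ofBary {m : ℕ} (t : Fin (m + 1) → ℝ) (ht : ∑ i, t i = 1) :
    baryCoord (ofBary t ht) = t := by
  funext i
  simp [baryCoord, ofBary, coord_ofCoord]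

/-- Transport of coordinates along an injection of vertices, by zero outside the image. -/
def pushCoord {k m : ℕ} (f : Fin (k + 1) ↪ Fin (m + 1)) (t : Fin (k + 1) → ℝ) :
    Fin (m + 1) → ℝ :=
  fun j => ∑ i, if f i = j then t i else 0

theorem sum_pushCoord {k m : ℕ} (f : Fin (k + 1) ↪ Fin (m + 1)) (t : Fin (k + 1) → ℝ) :
    ∑ j, pushCoord f t j = ∑ i, t i := by
  simp only [pushCoord]
  rw [Finset.sum_comm]
  simp

/-- The affine inclusion of a face: the `i`-th barycentric coordinate becomes the `f i`-th one, and
the other ones vanish. -/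
def faceMap {k m : ℕ} (f : Fin (k + 1) ↪ Fin (m + 1)) (x : Tangent k) : Tangent m :=
  ofBary (pushCoord f (baryCoord x)) (by rw [sum_pushCoord, sum_baryCoord])

/-- The linear part of `faceMap f`. -/
def faceLin {k m : ℕ} (f : Fin (k + 1) ↪ Fin (m + 1)) : Tangent k →L[ℝ] Tangent m :=
  LinearMap.toContinuousLinearMap
    { toFun := fun v => ofCoord (pushCoord f (coord v)) (by rw [sum_pushCoord, sum_coord])
      map_add' := fun v w => tangent_ext fun j => by
        simp only [coord_ofCoord, coord_add, pushCoord, ← Finset.sum_add_distrib]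
        exact Finset.sum_congr rfl fun i _ => by split_ifs <;> simp
      map_smul' := fun c v => tangent_ext fun j => by
        simp only [coord_ofCoord, coord_smul, pushCoord, Finset.mul_sum, RingHom.id_apply]
        exact Finset.sum_congr rfl fun i _ => by split_ifs <;> simp }

theorem faceMap_eq {k m : ℕ} (f : Fin (k + 1) ↪ Fin (m + 1)) (x : Tangent k) :
    faceMap f x = faceLin f x + faceMap f 0 := by
  refine tangent_ext fun j => ?_
  change (∑ i, if f i = j then coord x i + 1 / ((k : ℝ) + 1) else 0) - 1 / ((m : ℝ) + 1) =
    (∑ i, if f i = j then coord x i else 0) +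
      ((∑ i, if f i = j then (0 : ℝ) + 1 / ((k : ℝ) + 1) else 0) - 1 / ((m : ℝ) + 1))
  rw [add_sub_assoc', ← Finset.sum_add_distrib]
  congr 1
  refine Finset.sum_congr rfl fun i _ => ?_
  split_ifs <;> simp

theorem hasFDerivAt_faceMap {k m : ℕ} (f : Fin (k + 1) ↪ Fin (m + 1)) (x : Tangent k) :
    HasFDerivAt (faceMap f) (faceLin f) x := by
  have h : faceMap f = fun x => faceLin f x + faceMap f 0 := funext (faceMap_eq f)
  rw [h]
  exact (faceLin f).hasFDerivAt.add_const _

theorem contDiff_faceMap {k m : ℕ} (f : Fin (k + 1) ↪ Fin (m + 1)) {n : WithTop ℕ∞} :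
    ContDiff ℝ n (faceMap f) := by
  have h : faceMap f = fun x => faceLin f x + faceMap f 0 := funext (faceMap_eq f)
  rw [h]
  exact (faceLin f).contDiff.add contDiff_const

theorem mapsTo_faceMap {k m : ℕ} (f : Fin (k + 1) ↪ Fin (m + 1)) :
    Set.MapsTo (faceMap f) (simplexSet k) (simplexSet m) := by
  intro x hx
  refine ⟨fun j => ?_, sum_baryCoord _⟩
  simp only [faceMap, baryCoord_ofBary]
  refine Finset.sum_nonneg fun i _ => ?_
  split_ifs
  · exact hx.1 i
  · exact le_rfl

theorem mem_simplexSet {m : ℕ} {x : Tangent m} : x ∈ simplexSet m ↔ ∀ i, 0 ≤ baryCoord x i :=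
  ⟨fun h => h.1, fun h => ⟨h, sum_baryCoord x⟩⟩

theorem continuous_baryCoord {m : ℕ} : Continuous (baryCoord : Tangent m → Fin (m + 1) → ℝ) :=
  continuous_pi fun i => (continuous_coord i).add continuous_const

theorem convex_simplexSet (m : ℕ) : Convex ℝ (simplexSet m) := by
  intro x hx y hy a b ha hb hab
  rw [mem_simplexSet] at hx hy ⊢
  intro i
  have h : baryCoord (a • x + b • y) i = a * baryCoord x i + b * baryCoord y i := by
    simp only [baryCoord, coord_add, coord_smul]
    linear_combination (-(1 / ((m : ℝ) + 1))) * hab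
  rw [h]
  exact add_nonneg (mul_nonneg ha (hx i)) (mul_nonneg hb (hy i))

theorem isCompact_simplexSet (m : ℕ) : IsCompact (simplexSet m) := by
  have h : simplexSet m =
      (fun t : stdSimplex ℝ (Fin (m + 1)) => ofBary t.1 t.2.2) '' Set.univ := by
    ext x
    constructor
    · intro hx
      refine ⟨⟨baryCoord x, hx⟩, trivial, tangent_ext fun i => ?_⟩
      simp [ofBary, coord_ofCoord, baryCoord]
    · rintro ⟨t, -, rfl⟩
      change baryCoord (ofBary t.1 t.2.2) ∈ stdSimplex ℝ (Fin (m + 1))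
      rw [baryCoord_ofBary]
      exact t.2
  rw [h]
  have : CompactSpace (stdSimplex ℝ (Fin (m + 1))) :=
    isCompact_iff_compactSpace.mp (isCompact_stdSimplex ℝ (Fin (m + 1)))
  refine isCompact_univ.image (Continuous.subtype_mk (p := fun v => v ∈ sumZero m) ?_ _)
  refine (PiLp.continuous_toLp 2 _).comp (continuous_pi fun i => ?_)
  exact ((continuous_apply i).comp continuous_subtype_val).sub continuous_const

theorem interior_simplexSet_nonempty (m : ℕ) : (interior (simplexSet m)).Nonempty := by
  refine ⟨0, mem_interior.mpr ⟨{x | ∀ i, 0 < baryCoord x i}, ?_, ?_, ?_⟩⟩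
  · exact fun x hx => mem_simplexSet.mpr fun i => (hx i).le
  · have : {x : Tangent m | ∀ i, 0 < baryCoord x i} = ⋂ i, {x | 0 < baryCoord x i} := by
      ext x; simp
    rw [this]
    exact isOpen_iInter_of_finite fun i =>
      isOpen_lt continuous_const ((continuous_apply i).comp continuous_baryCoord)
  · intro i
    simp only [baryCoord, coord_zero, zero_add]
    positivity

theorem uniqueDiffOn_simplexSet (m : ℕ) : UniqueDiffOn ℝ (simplexSet m) :=
  uniqueDiffOn_convex (convex_simplexSet m) (interior_simplexSet_nonempty m)

theorem mem_closure_interior_simplexSet {m : ℕ} {x : Tangent m} (hx : x ∈ simplexSet m) :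
    x ∈ closure (interior (simplexSet m)) := by
  rw [(convex_simplexSet m).closure_interior_eq_closure_of_nonempty_interior
    (interior_simplexSet_nonempty m)]
  exact subset_closure hx

/-! ### Piecewise smooth forms -/

theorem minSmoothness_two_le : minSmoothness ℝ 2 ≤ ((⊤ : ℕ∞) : WithTop ℕ∞) := by
  rw [minSmoothness_of_isRCLikeNormedField]
  exact WithTop.coe_le_coe.mpr (le_top : (2 : ℕ∞) ≤ ⊤)

/-- A family of (arbitrary) `k`-forms, one on the tangent hyperplane of each simplex. -/
abbrev FormFamily {V : Type u} (K : AbstractSimplicialComplex V) (k : ℕ) : Type u :=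
  ∀ m : ℕ, Simplex K m → Tangent m → Tangent m [⋀^Fin k]→L[ℝ] ℝ

/-- The exterior derivative, simplex by simplex; the value outside the closed simplex is `0`. -/
def extD {V : Type u} {K : AbstractSimplicialComplex V} {k : ℕ} (ω : FormFamily K k) :
    FormFamily K (k + 1) :=
  fun m ρ => (simplexSet m).indicator (extDerivWithin (ω m ρ) (simplexSet m))

/-- Piecewise smooth `k`-forms on the geometric realisation of `K`: a smooth form on every closed
simplex (`C^∞` up to the boundary), such that the pullback to any face is the form given on that
face. Only the values on the closed simplices matter; outside they are normalised to `0`. -/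
structure IsPiecewiseSmooth {V : Type u} {K : AbstractSimplicialComplex V} {k : ℕ}
    (ω : FormFamily K k) : Prop where
  smooth : ∀ (m : ℕ) (ρ : Simplex K m), ContDiffOn ℝ ((⊤ : ℕ∞) : WithTop ℕ∞) (ω m ρ) (simplexSet m)
  zero_outside : ∀ (m : ℕ) (ρ : Simplex K m), ∀ x ∉ simplexSet m, ω m ρ x = 0
  restrict : ∀ (l m : ℕ) (ρ : Simplex K m) (f : Fin (l + 1) ↪ Fin (m + 1)), ∀ x ∈ simplexSet l,
    ω l (ρ.face f) x = (ω m ρ (faceMap f x)).compContinuousLinearMap (faceLin f)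

/-- The supremum over the closed simplex of the pointwise norm of a form. -/
def supNorm {m k : ℕ} (α : Tangent m → Tangent m [⋀^Fin k]→L[ℝ] ℝ) : ℝ :=
  ⨆ x : simplexSet m, ‖α x‖

/-- The norm `max (‖ω‖_∞, ‖dω‖_∞)` of the restriction of `ω` to the simplex `s`. -/
def graphNorm {V : Type u} {K : AbstractSimplicialComplex V} {k : ℕ} (ω : FormFamily K k)
    (s : Σ m : ℕ, Simplex K m) : ℝ :=
  max (supNorm (ω s.1 s.2)) (supNorm (extD ω s.1 s.2))

namespace IsPiecewiseSmooth

variable {V : Type u} {K : AbstractSimplicialComplex V} {k : ℕ} {ω η : FormFamily K k}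

theorem differentiable (hω : IsPiecewiseSmooth ω) {m : ℕ} (ρ : Simplex K m) {x : Tangent m}
    (hx : x ∈ simplexSet m) : DifferentiableWithinAt ℝ (ω m ρ) (simplexSet m) x :=
  (hω.smooth m ρ).differentiableOn (by simp) x hx

theorem bddAbove (hω : IsPiecewiseSmooth ω) {m : ℕ} (ρ : Simplex K m) :
    BddAbove (Set.range fun x : simplexSet m => ‖ω m ρ x‖) := by
  have h := (isCompact_simplexSet m).bddAbove_image 
    (hω.smooth m ρ).continuousOn.norm
  rwa [Set.image_eq_range] at h

theorem zero : IsPiecewiseSmooth (0 : FormFamily K k) where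
  smooth _ _ := contDiffOn_const
  zero_outside _ _ _ _ := rfl
  restrict _ _ _ _ _ _ := by ext; simp

theorem add (hω : IsPiecewiseSmooth ω) (hη : IsPiecewiseSmooth η) : IsPiecewiseSmooth (ω + η) where
  smooth m ρ := (hω.smooth m ρ).add (hη.smooth m ρ)
  zero_outside m ρ x hx := by
    simp [hω.zero_outside m ρ x hx, hη.zero_outside m ρ x hx]
  restrict l m ρ f x hx := by
    ext v
    simp [hω.restrict l m ρ f x hx, hη.restrict l m ρ f x hx]

theorem smul (c : ℝ) (hω : IsPiecewiseSmooth ω) : IsPiecewiseSmooth (c • ω) where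
  smooth m ρ := (hω.smooth m ρ).const_smul c
  zero_outside m ρ x hx := by simp [hω.zero_outside m ρ x hx]
  restrict l m ρ f x hx := by
    ext v
    simp [hω.restrict l m ρ f x hx]

theorem extD_add (hω : IsPiecewiseSmooth ω) (hη : IsPiecewiseSmooth η) :
    extD (ω + η) = extD ω + extD η := by
  funext m ρ x
  by_cases hx : x ∈ simplexSet m
  · simp only [extD, Pi.add_apply, Set.indicator_of_mem hx]
    exact extDerivWithin_add (uniqueDiffOn_simplexSet m x hx) (hω.differentiable ρ hx)
      (hη.differentiable ρ hx)
  · simp [extD, Set.indicator_of_notMem hx]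

theorem extD_smul (c : ℝ) : extD (c • ω) = c • extD ω := by
  funext m ρ x
  by_cases hx : x ∈ simplexSet m
  · simp only [extD, Pi.smul_apply, Set.indicator_of_mem hx]
    exact extDerivWithin_smul c _ (uniqueDiffOn_simplexSet m x hx)
  · simp [extD, Set.indicator_of_notMem hx]

theorem extD_extD (hω : IsPiecewiseSmooth ω) : extD (extD ω) = 0 := by
  funext m ρ x
  by_cases hx : x ∈ simplexSet m
  · simp only [extD, Pi.zero_apply, Set.indicator_of_mem hx]
    rw [extDerivWithin_congr' (fun y hy => Set.indicator_of_mem hy _) hx]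
    exact extDerivWithin_extDerivWithin_apply ((hω.smooth m ρ) x hx) minSmoothness_two_le
      (uniqueDiffOn_simplexSet m) (mem_closure_interior_simplexSet hx) hx
  · simp [extD, Set.indicator_of_notMem hx]

theorem extD_isPiecewiseSmooth (hω : IsPiecewiseSmooth ω) : IsPiecewiseSmooth (extD ω) where
  smooth m ρ := by
    have h : ContDiffOn ℝ ((⊤ : ℕ∞) : WithTop ℕ∞) (extDerivWithin (ω m ρ) (simplexSet m)) (simplexSet m) :=
      (ContinuousAlternatingMap.alternatizeUncurryFinCLM ℝ (Tangent m) ℝ).contDiff.comp_contDiffOn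
        ((hω.smooth m ρ).fderivWithin (uniqueDiffOn_simplexSet m) le_rfl)
    exact h.congr fun x hx => Set.indicator_of_mem hx _
  zero_outside m ρ x hx := Set.indicator_of_notMem hx _
  restrict l m ρ f x hx := by
    simp only [extD, Set.indicator_of_mem hx, Set.indicator_of_mem (mapsTo_faceMap f hx)]
    have hd : ∀ y ∈ simplexSet l, fderivWithin ℝ (faceMap f) (simplexSet l) y = faceLin f :=
      fun y hy => (hasFDerivAt_faceMap f y).hasFDerivWithinAt.fderivWithin
        (uniqueDiffOn_simplexSet l y hy)
    have h := extDerivWithin_pullback (hω.differentiable ρ (mapsTo_faceMap f hx))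
      (contDiff_faceMap f (n := ((⊤ : ℕ∞) : WithTop ℕ∞))).contDiffWithinAt minSmoothness_two_le (uniqueDiffOn_simplexSet l)
      (mem_closure_interior_simplexSet hx) hx (mapsTo_faceMap f)
    rw [hd x hx] at h
    rw [← h]
    refine extDerivWithin_congr' (fun y hy => ?_) hx
    rw [hd y hy]
    exact hω.restrict l m ρ f y hy

end IsPiecewiseSmooth

theorem supNorm_nonneg {m k : ℕ} (α : Tangent m → Tangent m [⋀^Fin k]→L[ℝ] ℝ) : 0 ≤ supNorm α :=
  Real.iSup_nonneg fun x => norm_nonneg (α x)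

theorem graphNorm_nonneg {V : Type u} {K : AbstractSimplicialComplex V} {k : ℕ}
    (ω : FormFamily K k) (s : Σ m : ℕ, Simplex K m) : 0 ≤ graphNorm ω s :=
  le_max_of_le_left (supNorm_nonneg _)

theorem supNorm_smul {m k : ℕ} (c : ℝ) (α : Tangent m → Tangent m [⋀^Fin k]→L[ℝ] ℝ) :
    supNorm (c • α) = |c| * supNorm α := by
  have h : ∀ x : simplexSet m, ‖(c • α) x‖ = |c| * ‖α x‖ := fun x => norm_smul c (α x)
  unfold supNorm
  rw [iSup_congr h]
  exact (Real.mul_iSup_of_nonneg (abs_nonneg c) _).symm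

theorem IsPiecewiseSmooth.supNorm_add_le {V : Type u} {K : AbstractSimplicialComplex V} {k : ℕ}
    {ω η : FormFamily K k} (hω : IsPiecewiseSmooth ω) (hη : IsPiecewiseSmooth η) {m : ℕ}
    (ρ : Simplex K m) : supNorm (ω m ρ + η m ρ) ≤ supNorm (ω m ρ) + supNorm (η m ρ) := by
  refine Real.iSup_le (fun x => ?_) (add_nonneg (supNorm_nonneg _) (supNorm_nonneg _))
  exact (norm_add_le (ω m ρ x) (η m ρ x)).trans
    (_root_.add_le_add (le_ciSup (hω.bddAbove ρ) x) (le_ciSup (hη.bddAbove ρ) x))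

theorem IsPiecewiseSmooth.graphNorm_add_le {V : Type u} {K : AbstractSimplicialComplex V} {k : ℕ}
    {ω η : FormFamily K k} (hω : IsPiecewiseSmooth ω) (hη : IsPiecewiseSmooth η)
    (s : Σ m : ℕ, Simplex K m) : graphNorm (ω + η) s ≤ graphNorm ω s + graphNorm η s := by
  refine max_le ?_ ?_
  · exact (hω.supNorm_add_le hη s.2).trans (add_le_add (le_max_left _ _) (le_max_left _ _))
  · rw [hω.extD_add hη]
    exact (hω.extD_isPiecewiseSmooth.supNorm_add_le hη.extD_isPiecewiseSmooth s.2).trans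
      (add_le_add (le_max_right _ _) (le_max_right _ _))

theorem graphNorm_smul {V : Type u} {K : AbstractSimplicialComplex V} {k : ℕ} (c : ℝ)
    (ω : FormFamily K k) (s : Σ m : ℕ, Simplex K m) :
    graphNorm (c • ω) s = |c| * graphNorm ω s := by
  unfold graphNorm
  rw [IsPiecewiseSmooth.extD_smul]
  simp only [Pi.smul_apply]
  rw [supNorm_smul, supNorm_smul, mul_max_of_nonneg _ _ (abs_nonneg c)]

theorem graphNorm_zero {V : Type u} {K : AbstractSimplicialComplex V} {k : ℕ} :
    graphNorm (0 : FormFamily K k) = 0 := by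
  funext s
  have h := graphNorm_smul (0 : ℝ) (0 : FormFamily K k) s
  simpa using h

theorem IsPiecewiseSmooth.graphNorm_extD_le {V : Type u} {K : AbstractSimplicialComplex V} {k : ℕ}
    {ω : FormFamily K k} (hω : IsPiecewiseSmooth ω) (s : Σ m : ℕ, Simplex K m) :
    graphNorm (extD ω) s ≤ graphNorm ω s := by
  refine max_le (le_max_right _ _) ?_
  rw [hω.extD_extD]
  refine le_trans (le_of_eq ?_) (graphNorm_nonneg ω s)
  have h := supNorm_smul (0 : ℝ) (0 : Tangent s.1 → Tangent s.1 [⋀^Fin (k + 1 + 1)]→L[ℝ] ℝ)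
  rwa [zero_smul, abs_zero, zero_mul] at h

/-- The space of `L_p` piecewise smooth `k`-forms: those for which the norms of the restrictions
to the simplices form an `ℓ_p` family. -/
def formSpace {V : Type u} (K : AbstractSimplicialComplex V) (p : ℝ≥0∞) (k : ℕ) :
    Submodule ℝ (FormFamily K k) where
  carrier := {ω | IsPiecewiseSmooth ω ∧ Memℓp (graphNorm ω) p}
  zero_mem' := ⟨.zero, by rw [graphNorm_zero]; exact zero_memℓp⟩
  add_mem' {ω η} hω hη := ⟨hω.1.add hη.1, (hω.2.add hη.2).mono fun s => by
    rw [Real.norm_of_nonneg (graphNorm_nonneg _ _)]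
    exact hω.1.graphNorm_add_le hη.1 s⟩
  smul_mem' c ω hω := ⟨hω.1.smul c, (hω.2.const_mul |c|).mono fun s => by
    rw [Real.norm_of_nonneg (graphNorm_nonneg _ _), graphNorm_smul]⟩

/-- The exterior derivative on `L_p` piecewise smooth forms. -/
def formD {V : Type u} (K : AbstractSimplicialComplex V) (p : ℝ≥0∞) (k : ℕ) :
    formSpace K p k →ₗ[ℝ] formSpace K p (k + 1) where
  toFun ω := ⟨extD ω.1, ω.2.1.extD_isPiecewiseSmooth, ω.2.2.mono fun s => by
    rw [Real.norm_of_nonneg (graphNorm_nonneg _ _)]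
    exact ω.2.1.graphNorm_extD_le s⟩
  map_add' ω η := Subtype.ext (ω.2.1.extD_add η.2.1)
  map_smul' c _ := Subtype.ext (IsPiecewiseSmooth.extD_smul c)

/-- The cochain complex of `L_p` piecewise smooth forms. -/
def formComplex {V : Type u} (K : AbstractSimplicialComplex V) (p : ℝ≥0∞) :
    CochainComplex (ModuleCat.{u} ℝ) ℕ :=
  CochainComplex.of (fun k => ModuleCat.of ℝ (formSpace K p k))
    (fun k => ModuleCat.ofHom (formD K p k))
    (fun k => by
      refine ModuleCat.hom_ext (LinearMap.ext fun ω => Subtype.ext ?_)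
      exact IsPiecewiseSmooth.extD_extD ω.2.1)

/-! ### Simplicial `L_p` cochains -/

/-- A cochain, given on simplices with enumerated vertices, is alternating if renumbering the
vertices multiplies its value by the sign of the permutation. -/
def IsAlternating {V : Type u} {K : AbstractSimplicialComplex V} {k : ℕ}
    (c : Simplex K k → ℝ) : Prop :=
  ∀ (ρ : Simplex K k) (π : Equiv.Perm (Fin (k + 1))),
    c (ρ.face π.toEmbedding) = ((Equiv.Perm.sign π : ℤ) : ℝ) * c ρ

/-- The simplicial coboundary `(δc)(v_0, …, v_{k+1}) = ∑ (-1)^i c(v_0, …, v̂_i, …, v_{k+1})`. -/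
def coboundary {V : Type u} {K : AbstractSimplicialComplex V} {k : ℕ} (c : Simplex K k → ℝ) :
    Simplex K (k + 1) → ℝ :=
  fun ρ => ∑ i : Fin (k + 2), (-1) ^ (i : ℕ) * c (ρ.face (Fin.succAboveEmb i))

theorem perm_succAbove {n : ℕ} (π : Equiv.Perm (Fin (n + 1))) (i : Fin (n + 1)) :
    ∃ e : Equiv.Perm (Fin n), (∀ j, π (i.succAbove j) = (π i).succAbove (e j)) ∧
      (Equiv.Perm.sign e : ℤ) = (-1) ^ (i : ℕ) * (-1) ^ (π i : ℕ) * Equiv.Perm.sign π := by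
  set τ : Equiv.Perm (Fin (n + 1)) := (π i).cycleRange * π * i.cycleRange⁻¹ with hτ
  have h0 : τ 0 = 0 := by
    simp [hτ, Equiv.Perm.mul_apply, Equiv.Perm.inv_def, Fin.cycleRange_symm_zero]
  obtain ⟨⟨q, e⟩, hqe⟩ := Equiv.Perm.decomposeFin.symm.surjective τ
  have hq : q = 0 := by
    rw [← hqe, Equiv.Perm.decomposeFin_symm_apply_zero] at h0
    exact h0
  subst hq
  have hsucc : ∀ j, τ j.succ = (e j).succ := fun j => by
    rw [← hqe, Equiv.Perm.decomposeFin_symm_apply_succ, Equiv.swap_self]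
    rfl
  refine ⟨e, fun j => ?_, ?_⟩
  · have h := hsucc j
    simp only [hτ, Equiv.Perm.mul_apply, Equiv.Perm.inv_def, Fin.cycleRange_symm_succ] at h
    rw [← Fin.cycleRange_symm_succ (π i), ← h, Equiv.symm_apply_apply]
  · have h1 : Equiv.Perm.sign τ = Equiv.Perm.sign e := by
      rw [← hqe, Equiv.Perm.decomposeFin.symm_sign]
      simp
    rw [← h1, hτ]
    simp only [Equiv.Perm.sign_mul, Equiv.Perm.sign_inv, Fin.sign_cycleRange]
    push_cast
    ring

theorem IsAlternating.coboundary {V : Type u} {K : AbstractSimplicialComplex V} {k : ℕ}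
    {c : Simplex K k → ℝ} (hc : IsAlternating c) : IsAlternating (coboundary c) := by
  intro ρ π
  simp only [LpDeRham.coboundary]
  rw [← Equiv.sum_comp π (fun i => (-1) ^ (i : ℕ) * c (ρ.face (Fin.succAboveEmb i))),
    Finset.mul_sum]
  refine Finset.sum_congr rfl fun i _ => ?_
  obtain ⟨e, he, hs⟩ := perm_succAbove π i
  have hf : (ρ.face π.toEmbedding).face (Fin.succAboveEmb i) =
      (ρ.face (Fin.succAboveEmb (π i))).face e.toEmbedding := by
    rw [Simplex.face_face, Simplex.face_face]
    congr 1
    ext j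
    simp [he j]
  have h1 : ((-1 : ℝ) ^ (i : ℕ)) * (-1) ^ (i : ℕ) = 1 := by
    rw [← mul_pow]; simp
  rw [hf, hc, hs]
  push_cast
  linear_combination ((-1 : ℝ) ^ (π i : ℕ) * ((Equiv.Perm.sign π : ℤ) : ℝ) *
    c (ρ.face (Fin.succAboveEmb (π i)))) * h1

theorem coboundary_coboundary {V : Type u} {K : AbstractSimplicialComplex V} {k : ℕ}
    (c : Simplex K k → ℝ) : coboundary (coboundary c) = 0 := by
  funext ρ
  simp only [coboundary, Finset.mul_sum, Pi.zero_apply, Simplex.face_face]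
  rw [← Finset.sum_product']
  refine Finset.sum_involution
    (fun a _ => (a.1.succAbove a.2, a.2.predAbove a.1)) ?_ ?_ (by simp) ?_
  · rintro ⟨i, j⟩ -
    have hf : (Fin.succAboveEmb (j.predAbove i)).trans (Fin.succAboveEmb (i.succAbove j)) =
        (Fin.succAboveEmb j).trans (Fin.succAboveEmb i) := by
      ext l
      simp [Fin.succAbove_succAbove_succAbove_predAbove]
    have hs := Fin.neg_one_pow_succAbove_add_predAbove (R := ℝ) i j
    simp only [hf, ← mul_assoc, ← pow_add, hs]
    ring
  · rintro ⟨i, j⟩ - - h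
    exact Fin.succAbove_ne i j (congrArg Prod.fst h)
  · rintro ⟨i, j⟩ -
    simp [Fin.succAbove_succAbove_predAbove, Fin.predAbove_predAbove_succAbove]

theorem memℓp_comp_of_fibers {A B : Type u} {p : ℝ≥0∞} {c : B → ℝ} (hc : Memℓp c p) (g : A → B)
    (C : ℕ) (hg : ∀ b, (g ⁻¹' {b}).encard ≤ C) : Memℓp (c ∘ g) p := by
  classical
  have hfin : ∀ b, (g ⁻¹' {b}).Finite := fun b =>
    Set.finite_of_encard_le_coe (hg b)
  obtain (rfl | rfl | hp) := p.trichotomy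
  · rw [memℓp_zero_iff] at hc ⊢
    have h : {a | (c ∘ g) a ≠ 0} = g ⁻¹' {b | c b ≠ 0} := rfl
    rw [h]
    exact hc.preimage' fun b _ => hfin b
  · rw [memℓp_infty_iff] at hc ⊢
    obtain ⟨M, hM⟩ := hc
    refine ⟨M, ?_⟩
    rintro _ ⟨a, rfl⟩
    exact hM ⟨g a, rfl⟩
  · have hsum := (memℓp_gen_iff hp).1 hc
    refine memℓp_gen' (C := C * ∑' b, ‖c b‖ ^ p.toReal) fun s => ?_
    calc ∑ a ∈ s, ‖(c ∘ g) a‖ ^ p.toReal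
        = ∑ b ∈ s.image g, ∑ a ∈ s with g a = b, ‖(c ∘ g) a‖ ^ p.toReal :=
          (Finset.sum_fiberwise_of_maps_to (fun a ha => Finset.mem_image_of_mem g ha) _).symm
      _ ≤ ∑ b ∈ s.image g, C * ‖c b‖ ^ p.toReal := by
          refine Finset.sum_le_sum fun b _ => ?_
          have h1 : ∑ a ∈ s with g a = b, ‖(c ∘ g) a‖ ^ p.toReal =
              ((s.filter fun a => g a = b).card : ℝ) * ‖c b‖ ^ p.toReal := by
            rw [← nsmul_eq_mul, ← Finset.sum_const]
            refine Finset.sum_congr rfl fun a ha => ?_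
            rw [Function.comp_apply, (Finset.mem_filter.1 ha).2]
          rw [h1]
          refine mul_le_mul_of_nonneg_right ?_ (by positivity)
          have h2 : ((s.filter fun a => g a = b : Finset A) : Set A).encard ≤ C :=
            (Set.encard_le_encard fun a ha => by simpa using (Finset.mem_filter.1 ha).2).trans
              (hg b)
          rw [Set.encard_coe_eq_coe_finsetCard] at h2
          exact_mod_cast h2
      _ = C * ∑ b ∈ s.image g, ‖c b‖ ^ p.toReal := (Finset.mul_sum _ _ _).symm
      _ ≤ C * ∑' b, ‖c b‖ ^ p.toReal :=
          mul_le_mul_of_nonneg_left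
            (hsum.sum_le_tsum _ fun _ _ => by positivity) (by positivity)

theorem BoundedGeometry.exists_fiber_bound {V : Type u} {K : AbstractSimplicialComplex V}
    (hK : BoundedGeometry K) : ∃ C : ℕ, ∀ (k : ℕ) (i : Fin (k + 2)) (τ : Simplex K k),
      ((fun ρ : Simplex K (k + 1) => ρ.face (Fin.succAboveEmb i)) ⁻¹' {τ}).encard ≤ C := by
  obtain ⟨C, hC⟩ := hK.starBounded
  refine ⟨C, fun k i τ => le_trans ?_ (hC (τ.1 0))⟩
  refine Set.encard_le_encard_of_injOn (f := fun ρ : Simplex K (k + 1) => ρ.1 i) ?_ ?_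
  · intro ρ hρ
    have h0 : ρ.1 (i.succAbove 0) = τ.1 0 := by
      rw [← Set.mem_singleton_iff.1 hρ]; rfl
    refine ⟨?_, Finset.univ.map ρ.1, ρ.2, ?_, ?_⟩
    · rw [← h0]
      exact fun h => Fin.succAbove_ne i 0 (ρ.1.injective h)
    · rw [← h0]; simp
    · simp
  · intro ρ hρ ρ' hρ' h
    have hρρ' : ρ.face (Fin.succAboveEmb i) = ρ'.face (Fin.succAboveEmb i) :=
      (Set.mem_singleton_iff.1 hρ).trans (Set.mem_singleton_iff.1 hρ').symm
    refine Subtype.ext (DFunLike.ext _ _ fun j => ?_)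
    rcases Fin.eq_self_or_eq_succAbove i j with rfl | ⟨l, rfl⟩
    · exact h
    · exact DFunLike.congr_fun (congrArg Subtype.val hρρ') l

theorem BoundedGeometry.memℓp_coboundary {V : Type u} {K : AbstractSimplicialComplex V}
    (hK : BoundedGeometry K) {p : ℝ≥0∞} {k : ℕ} {c : Simplex K k → ℝ} (hc : Memℓp c p) :
    Memℓp (coboundary c) p := by
  obtain ⟨C, hC⟩ := hK.exists_fiber_bound
  exact Memℓp.finsetSum Finset.univ fun i _ =>
    (memℓp_comp_of_fibers hc _ C (hC k i)).const_mul ((-1) ^ (i : ℕ))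

/-- The space `C^k_p(K)` of simplicial `k`-cochains whose values form an `ℓ_p` family. -/
def cochainSpace {V : Type u} (K : AbstractSimplicialComplex V) (p : ℝ≥0∞) (k : ℕ) :
    Submodule ℝ (Simplex K k → ℝ) where
  carrier := {c | IsAlternating c ∧ Memℓp c p}
  zero_mem' := ⟨fun _ _ => by simp, zero_memℓp⟩
  add_mem' {c c'} hc hc' := ⟨fun ρ π => by
    simp only [Pi.add_apply, hc.1 ρ π, hc'.1 ρ π, mul_add], hc.2.add hc'.2⟩
  smul_mem' a c hc := ⟨fun ρ π => by
    simp only [Pi.smul_apply, hc.1 ρ π, smul_eq_mul]; ring, hc.2.const_smul a⟩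

/-- The coboundary on `L_p` cochains of a complex of bounded geometry. -/
def cochainD {V : Type u} (K : AbstractSimplicialComplex V) (hK : BoundedGeometry K) (p : ℝ≥0∞)
    (k : ℕ) : cochainSpace K p k →ₗ[ℝ] cochainSpace K p (k + 1) where
  toFun c := ⟨coboundary c.1, c.2.1.coboundary, hK.memℓp_coboundary c.2.2⟩
  map_add' c c' := Subtype.ext <| funext fun ρ => by
    simp [coboundary, mul_add, Finset.sum_add_distrib]
  map_smul' a c := Subtype.ext <| funext fun ρ => by
    simp [coboundary, Finset.mul_sum, mul_left_comm]

/-- The cochain complex `C^*_p(K)`. -/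
def cochainComplex {V : Type u} (K : AbstractSimplicialComplex V) (hK : BoundedGeometry K)
    (p : ℝ≥0∞) : CochainComplex (ModuleCat.{u} ℝ) ℕ :=
  CochainComplex.of (fun k => ModuleCat.of ℝ (cochainSpace K p k))
    (fun k => ModuleCat.ofHom (cochainD K hK p k))
    (fun k => by
      refine ModuleCat.hom_ext (LinearMap.ext fun c => Subtype.ext ?_)
      exact coboundary_coboundary c.1)

/-! ### Integration -/

/-- The parameter domain `{y_i ≥ 0, y_1 + ⋯ + y_k ≤ 1}` of the standard `k`-simplex. -/
def cornerSimplex (k : ℕ) : Set (Fin k → ℝ) :=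
  {y | (∀ i, 0 ≤ y i) ∧ ∑ i, y i ≤ 1}

/-- The point with barycentric coordinates `(1 - ∑ y_i, y_1, …, y_k)`. -/
def cornerMap {k : ℕ} (y : Fin k → ℝ) : Tangent k :=
  ofBary (Fin.cons (1 - ∑ i, y i) y) (by simp [Fin.sum_univ_succ])

/-- The `i`-th partial derivative of `cornerMap`: the edge vector from vertex `0` to vertex
`i + 1`. -/
def edgeVector {k : ℕ} (i : Fin k) : Tangent k :=
  ofCoord (Pi.single i.succ 1 - Pi.single 0 1) (by simp [Finset.sum_sub_distrib])

/-- The integral of a `k`-form over the standard `k`-simplex, oriented by the order of its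
vertices. -/
def integral {k : ℕ} (α : Tangent k → Tangent k [⋀^Fin k]→L[ℝ] ℝ) : ℝ :=
  ∫ y in cornerSimplex k, α (cornerMap y) edgeVector

end LpDeRham

end

/-! Integration has an explicit homotopy inverse: the Whitney map, which sends a cochain to an
elementary form. The homotopy is Dupont's. It is built on each standard simplex from operators that
commute with restriction to faces, so the local constructions glue.

On one simplex let `d` be the exterior derivative, `T_i` multiplication by the barycentric
coordinate `t_i`, `e_i = d T_i - T_i d` the operator `dt_i ∧`, `h_i` the cone operator at vertex `i`
and `ε_i` evaluation at that vertex. The Poincaré lemma for a cone is `d h_i + h_i d = 1 - ε_i`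
(`dOp_coneOp_add`). Moreover `∑ T_i = 1`, `∑ e_i = 0`, `d e_i = -e_i d` and `h_i ε_j = 0`. Put `X_0
= 1`, `X_{n+1} = -∑ e_i X_n h_i` and `s = ∑_{n<N} ∑_i T_i X_n h_i`. The relations alone give `d s +
s d = 1 - X_N - P` (`anticommute_sum`). The output of `X_N` has no component in degree below `N`, so
`X_N = 0` once `N` exceeds the dimension. Finally `P ω` is the combination of the forms `t_{f 0}
dt_{f 1} ∧ ⋯ ∧ dt_{f k}` with coefficients the periods `ε_{f k} h_{f (k-1)} ⋯ h_{f 0} ω`.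

Periods are integrals: conical coordinates turn an integral over a simplex into an iterated cone
operator (`integral_eq_period`). The cone relation yields Stokes (`period_dOp`) and the alternating
property (`period_perm`). Hence `P = E I`, where `I` is integration and `E` the Whitney map.

For the `ℓ_p` conditions, all operators are bounded in the supremum norm by constants that depend on
the dimension but not on the simplex, and the homotopy formula itself bounds `d s ω`.
Star-boundedness bounds the dimension and the number of simplices over a given face. The equality `I
E = 1` is checked on one simplex (`period_whitney_of_pure`), and `d E = E δ` then follows formally.
-/

noncomputable section

namespace LpDeRham

/-! ### Weighted integrals along the rays of a star-shaped set -/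

section RayIntegral

variable {E F : Type u} [NormedAddCommGroup E] [NormedSpace ℝ E] [NormedAddCommGroup F]
  [NormedSpace ℝ F]

/-- The weighted integral of a function along the segment from `e` to `x`. -/
def rayIntegral (e : E) (a : ℕ) (φ : E → F) (x : E) : F :=
  ∫ t in (0 : ℝ)..1, t ^ a • φ (e + t • (x - e))

theorem ray_mem {s : Set E} (hs : Convex ℝ s) {e x : E} (he : e ∈ s) (hx : x ∈ s) {t : ℝ}
    (ht : t ∈ Set.Icc (0 : ℝ) 1) : e + t • (x - e) ∈ s :=
  hs.add_smul_sub_mem he hx ht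

theorem continuousOn_ray {s : Set E} (hs : Convex ℝ s) {e x : E} (he : e ∈ s) (hx : x ∈ s) (a : ℕ)
    {φ : E → F} (hφ : ContinuousOn φ s) :
    ContinuousOn (fun t : ℝ => t ^ a • φ (e + t • (x - e))) (Set.Icc 0 1) := by
  refine (continuous_pow a).continuousOn.smul (hφ.comp ?_ fun t ht => ray_mem hs he hx ht)
  fun_prop

theorem intervalIntegrable_ray {s : Set E} (hs : Convex ℝ s) {e x : E} (he : e ∈ s) (hx : x ∈ s)
    (a : ℕ) {φ : E → F} (hφ : ContinuousOn φ s) :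
    IntervalIntegrable (fun t : ℝ => t ^ a • φ (e + t • (x - e))) MeasureTheory.volume 0 1 :=
  (continuousOn_ray hs he hx a hφ).intervalIntegrable_of_Icc zero_le_one

theorem norm_rayIntegral_le {s : Set E} (hs : Convex ℝ s) {e x : E} (he : e ∈ s) (hx : x ∈ s)
    (a : ℕ) {φ : E → F} {M : ℝ} (hM : ∀ y ∈ s, ‖φ y‖ ≤ M) : ‖rayIntegral e a φ x‖ ≤ M := by
  have h : ‖rayIntegral e a φ x‖ ≤ M * |(1 : ℝ) - 0| := by
    refine intervalIntegral.norm_integral_le_of_norm_le_const fun t ht => ?_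
    rw [Set.uIoc_of_le zero_le_one] at ht
    have ht' : t ∈ Set.Icc (0 : ℝ) 1 := ⟨ht.1.le, ht.2⟩
    have h1 := hM _ (ray_mem hs he hx ht')
    rw [norm_smul, norm_pow, Real.norm_of_nonneg ht'.1]
    calc t ^ a * ‖φ (e + t • (x - e))‖ ≤ 1 * ‖φ (e + t • (x - e))‖ :=
          mul_le_mul_of_nonneg_right (pow_le_one₀ ht'.1 ht'.2) (norm_nonneg _)
      _ ≤ M := by rwa [one_mul]
  simpa using h

/-- Differentiation under the integral sign on a closed set, where only derivatives within `s` are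
available. By compactness the derivative of `φ` is uniformly continuous, so the mean value
inequality makes the first-order error small uniformly in `t`. The chain rule contributes a factor
`t`, whence the weight `a + 1`. -/
theorem hasFDerivWithinAt_rayIntegral {s : Set E} (hs : Convex ℝ s) (hc : IsCompact s)
    (hu : UniqueDiffOn ℝ s) {e x : E} (he : e ∈ s) (hx : x ∈ s) (a : ℕ) {φ : E → F}
    (hφ : ContDiffOn ℝ 1 φ s) :
    HasFDerivWithinAt (rayIntegral e a φ) (rayIntegral e (a + 1) (fderivWithin ℝ φ s) x) s x := by
  have hD : ContinuousOn (fderivWithin ℝ φ s) s := hφ.continuousOn_fderivWithin hu le_rfl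
  have hdiff := hφ.differentiableOn one_ne_zero
  rw [hasFDerivWithinAt_iff_isLittleO, Asymptotics.isLittleO_iff]
  intro ε hε
  obtain ⟨δ, hδ, hδ'⟩ := Metric.uniformContinuousOn_iff.1 (hc.uniformContinuousOn_of_continuous hD)
    ε hε
  filter_upwards [self_mem_nhdsWithin, mem_nhdsWithin_of_mem_nhds (Metric.ball_mem_nhds x hδ)]
    with y hy hyx
  have happ : (rayIntegral e (a + 1) (fderivWithin ℝ φ s) x) (y - x) =
      ∫ t in (0 : ℝ)..1, (t ^ (a + 1) • fderivWithin ℝ φ s (e + t • (x - e))) (y - x) :=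
    ContinuousLinearMap.intervalIntegral_apply (intervalIntegrable_ray hs he hx (a + 1) hD) _
  have hint : IntervalIntegrable (fun t : ℝ =>
      (t ^ (a + 1) • fderivWithin ℝ φ s (e + t • (x - e))) (y - x)) MeasureTheory.volume 0 1 := by
    refine ContinuousOn.intervalIntegrable_of_Icc zero_le_one ?_
    exact (continuousOn_ray hs he hx (a + 1) hD).clm_apply continuousOn_const
  rw [happ, rayIntegral, rayIntegral,
    ← intervalIntegral.integral_sub (intervalIntegrable_ray hs he hy a hφ.continuousOn)
      (intervalIntegrable_ray hs he hx a hφ.continuousOn),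
    ← intervalIntegral.integral_sub ((intervalIntegrable_ray hs he hy a hφ.continuousOn).sub
      (intervalIntegrable_ray hs he hx a hφ.continuousOn)) hint]
  refine (intervalIntegral.norm_integral_le_of_norm_le_const (C := ε * ‖y - x‖)
    fun t ht => ?_).trans (by simp)
  rw [Set.uIoc_of_le zero_le_one] at ht
  have ht' : t ∈ Set.Icc (0 : ℝ) 1 := ⟨ht.1.le, ht.2⟩
  have hsub : (e + t • (y - e)) - (e + t • (x - e)) = t • (y - x) := by
    simp only [smul_sub]; abel
  have hdist : dist (e + t • (y - e)) (e + t • (x - e)) < δ := by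
    rw [dist_eq_norm, hsub, norm_smul, Real.norm_of_nonneg ht'.1]
    calc t * ‖y - x‖ ≤ 1 * ‖y - x‖ := mul_le_mul_of_nonneg_right ht'.2 (norm_nonneg _)
      _ < δ := by rw [one_mul, ← dist_eq_norm]; exact hyx
  have hmv : ‖φ (e + t • (y - e)) - φ (e + t • (x - e)) -
      fderivWithin ℝ φ s (e + t • (x - e)) ((e + t • (y - e)) - (e + t • (x - e)))‖ ≤
      ε * ‖(e + t • (y - e)) - (e + t • (x - e))‖ := by
    -- Cutting `s` down to a `δ`-ball keeps it convex and makes the derivative there differ by at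
    -- most `ε` from its value at the centre.
    refine Convex.norm_image_sub_le_of_norm_hasFDerivWithin_le' (𝕜 := ℝ)
      (s := s ∩ Metric.ball (e + t • (x - e)) δ) (f' := fderivWithin ℝ φ s) ?_ ?_
      (hs.inter (convex_ball _ _)) ⟨ray_mem hs he hx ht', Metric.mem_ball_self hδ⟩
      ⟨ray_mem hs he hy ht', hdist⟩
    · exact fun z hz => ((hdiff z hz.1).hasFDerivWithinAt).mono Set.inter_subset_left
    · intro z hz
      rw [← dist_eq_norm]
      exact (hδ' z hz.1 _ (ray_mem hs he hx ht') hz.2).le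
  rw [hsub] at hmv
  have hfac : t ^ a • φ (e + t • (y - e)) - t ^ a • φ (e + t • (x - e)) -
      (t ^ (a + 1) • fderivWithin ℝ φ s (e + t • (x - e))) (y - x) =
      t ^ a • (φ (e + t • (y - e)) - φ (e + t • (x - e)) -
        fderivWithin ℝ φ s (e + t • (x - e)) (t • (y - x))) := by
    rw [smul_apply, map_smul, pow_succ, mul_smul, smul_sub (t ^ a), smul_sub (t ^ a)]
  rw [hfac, norm_smul, norm_pow, Real.norm_of_nonneg ht'.1]
  rw [norm_smul, Real.norm_of_nonneg ht'.1] at hmv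
  calc _ ≤ 1 * (ε * (t * ‖y - x‖)) :=
        mul_le_mul (pow_le_one₀ ht'.1 ht'.2) hmv (norm_nonneg _) zero_le_one
    _ ≤ ε * (1 * ‖y - x‖) := by
        rw [one_mul]
        exact mul_le_mul_of_nonneg_left (mul_le_mul_of_nonneg_right ht'.2 (norm_nonneg _)) hε.le
    _ = ε * ‖y - x‖ := by rw [one_mul]

end RayIntegral

/-- The derivative of a ray integral is a ray integral of weight `a + 1` with values in `E →L[ℝ] F`,
so the induction must quantify over `F` and `a`. The base case gets continuity from
differentiability; this costs one derivative, which is harmless for `C^∞` functions. -/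
theorem contDiffOn_rayIntegral_nat {E : Type u} [NormedAddCommGroup E] [NormedSpace ℝ E] {s : Set E}
    (hs : Convex ℝ s) (hc : IsCompact s) (hu : UniqueDiffOn ℝ s) {e : E} (he : e ∈ s) (n : ℕ) :
    ∀ {F : Type u} [NormedAddCommGroup F] [NormedSpace ℝ F] (a : ℕ) {φ : E → F},
      ContDiffOn ℝ (n + 1 : ℕ) φ s → ContDiffOn ℝ n (rayIntegral e a φ) s := by
  induction n with
  | zero =>
    intro F _ _ a φ hφ
    rw [Nat.cast_zero, contDiffOn_zero]
    exact fun x hx => (hasFDerivWithinAt_rayIntegral hs hc hu he hx a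
      (by simpa using hφ)).continuousWithinAt
  | succ n ih =>
    intro F _ _ a φ hφ
    have h1 : ContDiffOn ℝ 1 φ s := hφ.of_le (by exact_mod_cast Nat.le_add_left 1 (n + 1))
    have hd := fun x hx => hasFDerivWithinAt_rayIntegral hs hc hu he (x := x) hx a h1
    rw [Nat.cast_succ, contDiffOn_succ_iff_fderivWithin hu]
    refine ⟨fun x hx => (hd x hx).differentiableWithinAt, by simp, ?_⟩
    refine (ih (a + 1) (φ := fderivWithin ℝ φ s) ?_).congr
      fun x hx => (hd x hx).fderivWithin (hu x hx)
    exact hφ.fderivWithin hu (by norm_cast)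

theorem contDiffOn_rayIntegral {E F : Type u} [NormedAddCommGroup E] [NormedSpace ℝ E]
    [NormedAddCommGroup F] [NormedSpace ℝ F] {s : Set E} (hs : Convex ℝ s) (hc : IsCompact s)
    (hu : UniqueDiffOn ℝ s) {e : E} (he : e ∈ s) (a : ℕ) {φ : E → F}
    (hφ : ContDiffOn ℝ ((⊤ : ℕ∞) : WithTop ℕ∞) φ s) :
    ContDiffOn ℝ ((⊤ : ℕ∞) : WithTop ℕ∞) (rayIntegral e a φ) s := by
  rw [contDiffOn_infty]
  exact fun n => contDiffOn_rayIntegral_nat hs hc hu he n a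
    (hφ.of_le (WithTop.coe_le_coe.mpr le_top))

/-! ### Smooth forms on a standard simplex -/

/-- A smooth form on the closed simplex, extended by zero. -/
structure IsSmoothForm {m k : ℕ} (α : Tangent m → Tangent m [⋀^Fin k]→L[ℝ] ℝ) : Prop where
  smooth : ContDiffOn ℝ ((⊤ : ℕ∞) : WithTop ℕ∞) α (simplexSet m)
  zero_outside : ∀ x ∉ simplexSet m, α x = 0

namespace IsSmoothForm

variable {m k : ℕ} {α β : Tangent m → Tangent m [⋀^Fin k]→L[ℝ] ℝ}

theorem zero : IsSmoothForm (0 : Tangent m → Tangent m [⋀^Fin k]→L[ℝ] ℝ) :=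
  ⟨contDiffOn_const, fun _ _ => rfl⟩

theorem add (hα : IsSmoothForm α) (hβ : IsSmoothForm β) : IsSmoothForm (α + β) :=
  ⟨hα.smooth.add hβ.smooth, fun x hx => by
    simp [hα.zero_outside x hx, hβ.zero_outside x hx]⟩

theorem smul (c : ℝ) (hα : IsSmoothForm α) : IsSmoothForm (c • α) :=
  ⟨hα.smooth.const_smul c, fun x hx => by simp [hα.zero_outside x hx]⟩

theorem indicator (hα : ContDiffOn ℝ ((⊤ : ℕ∞) : WithTop ℕ∞) α (simplexSet m)) :
    IsSmoothForm ((simplexSet m).indicator α) :=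
  ⟨hα.congr fun _ hx => Set.indicator_of_mem hx _, fun _ hx => Set.indicator_of_notMem hx _⟩

theorem differentiableWithinAt (hα : IsSmoothForm α) {x : Tangent m} (hx : x ∈ simplexSet m) :
    DifferentiableWithinAt ℝ α (simplexSet m) x :=
  hα.smooth.differentiableOn (by simp) x hx

theorem extDerivWithin (hα : IsSmoothForm α) :
    ContDiffOn ℝ ((⊤ : ℕ∞) : WithTop ℕ∞) (extDerivWithin α (simplexSet m)) (simplexSet m) :=
  (ContinuousAlternatingMap.alternatizeUncurryFinCLM ℝ (Tangent m) ℝ).contDiff.comp_contDiffOn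
    (hα.smooth.fderivWithin (uniqueDiffOn_simplexSet m) le_rfl)

end IsSmoothForm

/-- Smooth forms of all degrees on the closed standard `m`-simplex. -/
def smoothFormSubmodule (m : ℕ) :
    Submodule ℝ (∀ k : ℕ, Tangent m → Tangent m [⋀^Fin k]→L[ℝ] ℝ) where
  carrier := {ω | ∀ k, IsSmoothForm (ω k)}
  zero_mem' _ := .zero
  add_mem' hω hη k := (hω k).add (hη k)
  smul_mem' c _ hω k := (hω k).smul c

/-- The space of smooth forms of all degrees on the closed standard `m`-simplex. -/
def SmoothForms (m : ℕ) : Type := smoothFormSubmodule m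

instance (m : ℕ) : AddCommGroup (SmoothForms m) :=
  inferInstanceAs (AddCommGroup (smoothFormSubmodule m))

instance (m : ℕ) : Module ℝ (SmoothForms m) :=
  inferInstanceAs (Module ℝ (smoothFormSubmodule m))

namespace SmoothForms

variable {m : ℕ}

/-- The element of `SmoothForms m` with given components. -/
def mk (α : ∀ k : ℕ, Tangent m → Tangent m [⋀^Fin k]→L[ℝ] ℝ) (hα : ∀ k, IsSmoothForm (α k)) :
    SmoothForms m :=
  ⟨α, hα⟩

theorem mk_val (α : ∀ k : ℕ, Tangent m → Tangent m [⋀^Fin k]→L[ℝ] ℝ)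
    (hα : ∀ k, IsSmoothForm (α k)) (k : ℕ) (x : Tangent m) : (mk α hα).1 k x = α k x := rfl

theorem ext_on {ω η : SmoothForms m} (h : ∀ k, ∀ x ∈ simplexSet m, ω.1 k x = η.1 k x) : ω = η := by
  refine Subtype.ext (funext fun k => funext fun x => ?_)
  by_cases hx : x ∈ simplexSet m
  · exact h k x hx
  · rw [(ω.2 k).zero_outside x hx, (η.2 k).zero_outside x hx]

theorem add_val (ω η : SmoothForms m) (k : ℕ) (x : Tangent m) :
    (ω + η).1 k x = ω.1 k x + η.1 k x := rfl

theorem smul_val (c : ℝ) (ω : SmoothForms m) (k : ℕ) (x : Tangent m) :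
    (c • ω).1 k x = c • ω.1 k x := rfl

theorem sub_val (ω η : SmoothForms m) (k : ℕ) (x : Tangent m) :
    (ω - η).1 k x = ω.1 k x - η.1 k x := rfl

theorem neg_val (ω : SmoothForms m) (k : ℕ) (x : Tangent m) :
    (-ω).1 k x = -ω.1 k x := rfl

theorem zero_val (k : ℕ) (x : Tangent m) : (0 : SmoothForms m).1 k x = 0 := rfl

theorem sum_val {ι : Type*} (s : Finset ι) (ω : ι → SmoothForms m) (k : ℕ) (x : Tangent m) :
    (∑ i ∈ s, ω i).1 k x = ∑ i ∈ s, (ω i).1 k x := by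
  classical
  induction s using Finset.induction_on with
  | empty => rfl
  | insert a s ha ih => rw [Finset.sum_insert ha, Finset.sum_insert ha, add_val, ih]

end SmoothForms

/-- The degree `k` part of the exterior derivative. -/
def dFun {m : ℕ} (ω : SmoothForms m) : ∀ k : ℕ, Tangent m → Tangent m [⋀^Fin k]→L[ℝ] ℝ
  | 0 => 0
  | k + 1 => (simplexSet m).indicator (extDerivWithin (ω.1 k) (simplexSet m))

/-- The exterior derivative. -/
def dOp (m : ℕ) : Module.End ℝ (SmoothForms m) where
  toFun ω := .mk (dFun ω) fun k => match k with
    | 0 => .zero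
    | k + 1 => .indicator (ω.2 k).extDerivWithin
  map_add' ω η := SmoothForms.ext_on fun k x hx => match k with
    | 0 => (add_zero (0 : Tangent m [⋀^Fin 0]→L[ℝ] ℝ)).symm
    | k + 1 => by
      simp only [SmoothForms.mk_val, dFun, SmoothForms.add_val, Set.indicator_of_mem hx]
      exact extDerivWithin_add (uniqueDiffOn_simplexSet m x hx) ((ω.2 k).differentiableWithinAt hx)
        ((η.2 k).differentiableWithinAt hx)
  map_smul' c ω := SmoothForms.ext_on fun k x hx => match k with
    | 0 => (smul_zero c).symm
    | k + 1 => by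
      simp only [SmoothForms.mk_val, dFun, RingHom.id_apply, SmoothForms.smul_val, Set.indicator_of_mem hx]
      exact extDerivWithin_smul c _ (uniqueDiffOn_simplexSet m x hx)

theorem dOp_zero_val {m : ℕ} (ω : SmoothForms m) (x : Tangent m) : (dOp m ω).1 0 x = 0 := rfl

theorem dOp_succ_val {m : ℕ} (ω : SmoothForms m) (k : ℕ) {x : Tangent m} (hx : x ∈ simplexSet m) :
    (dOp m ω).1 (k + 1) x = extDerivWithin (ω.1 k) (simplexSet m) x :=
  Set.indicator_of_mem hx _

theorem dOp_mul_dOp (m : ℕ) : dOp m * dOp m = 0 := by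
  refine LinearMap.ext fun ω => SmoothForms.ext_on fun k x hx => ?_
  change (dOp m (dOp m ω)).1 k x = 0
  rcases k with _ | _ | k
  · rfl
  · rw [dOp_succ_val _ _ hx]
    have : (dOp m ω).1 0 = fun _ => 0 := rfl
    rw [this, extDerivWithin, fderivWithin_fun_const]
    exact map_zero (ContinuousAlternatingMap.alternatizeUncurryFinCLM ℝ (Tangent m) ℝ)
  · rw [dOp_succ_val _ _ hx, extDerivWithin_congr' (fun y hy => dOp_succ_val ω k hy) hx]
    exact extDerivWithin_extDerivWithin_apply ((ω.2 k).smooth x hx) minSmoothness_two_le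
      (uniqueDiffOn_simplexSet m) (mem_closure_interior_simplexSet hx) hx

/-- The `i`-th coordinate as a continuous linear functional. -/
def coordCLM {m : ℕ} (i : Fin (m + 1)) : Tangent m →L[ℝ] ℝ where
  toFun x := coord x i
  map_add' x y := coord_add x y i
  map_smul' c x := coord_smul c x i
  cont := continuous_coord i

/-! ### Multiplication by barycentric coordinates and by their differentials. -/

theorem hasFDerivAt_baryCoord {m : ℕ} (i : Fin (m + 1)) (x : Tangent m) :
    HasFDerivAt (fun x : Tangent m => baryCoord x i) (coordCLM i) x :=
  (coordCLM i).hasFDerivAt.add_const _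

theorem contDiff_baryCoord {m : ℕ} (i : Fin (m + 1)) {n : WithTop ℕ∞} :
    ContDiff ℝ n (fun x : Tangent m => baryCoord x i) :=
  (coordCLM i).contDiff.add contDiff_const

/-- Multiplication by the `i`-th barycentric coordinate. -/
def mulOp {m : ℕ} (i : Fin (m + 1)) : Module.End ℝ (SmoothForms m) where
  toFun ω := .mk (fun k x => baryCoord x i • ω.1 k x) fun k =>
    ⟨(contDiff_baryCoord i).contDiffOn.smul (ω.2 k).smooth, fun x hx => by
      simp [(ω.2 k).zero_outside x hx]⟩
  map_add' ω η := SmoothForms.ext_on fun k x _ => by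
    simp only [SmoothForms.mk_val, SmoothForms.add_val, smul_add]
  map_smul' c ω := SmoothForms.ext_on fun k x _ => by
    simp only [SmoothForms.mk_val, SmoothForms.smul_val, RingHom.id_apply, smul_comm c]

theorem mulOp_val {m : ℕ} (i : Fin (m + 1)) (ω : SmoothForms m) (k : ℕ) (x : Tangent m) :
    (mulOp i ω).1 k x = baryCoord x i • ω.1 k x := rfl

theorem sum_mulOp (m : ℕ) : ∑ i : Fin (m + 1), mulOp i = (1 : Module.End ℝ (SmoothForms m)) := by
  refine LinearMap.ext fun ω => SmoothForms.ext_on fun k x _ => ?_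
  rw [LinearMap.sum_apply, SmoothForms.sum_val]
  simp only [mulOp_val]
  rw [← Finset.sum_smul, sum_baryCoord, one_smul]
  rfl

/-- Exterior multiplication by the differential of the `i`-th barycentric coordinate. -/
def wedgeOp {m : ℕ} (i : Fin (m + 1)) : Module.End ℝ (SmoothForms m) :=
  dOp m * mulOp i - mulOp i * dOp m

theorem wedgeOp_zero_val {m : ℕ} (i : Fin (m + 1)) (ω : SmoothForms m) (x : Tangent m) :
    (wedgeOp i ω).1 0 x = 0 := by
  change (dOp m (mulOp i ω) - mulOp i (dOp m ω)).1 0 x = 0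
  rw [SmoothForms.sub_val, dOp_zero_val, mulOp_val, dOp_zero_val, smul_zero, sub_zero]

/-- By the Leibniz rule the derivatives of the form cancel in the commutator. What remains is
pointwise linear algebra, and this is why the operator is bounded in the supremum norm although
`dOp` is not. -/
theorem wedgeOp_succ_val {m : ℕ} (i : Fin (m + 1)) (ω : SmoothForms m) (k : ℕ) {x : Tangent m}
    (hx : x ∈ simplexSet m) :
    (wedgeOp i ω).1 (k + 1) x =
      ContinuousAlternatingMap.alternatizeUncurryFin ((coordCLM i).smulRight (ω.1 k x)) := by
  change (dOp m (mulOp i ω) - mulOp i (dOp m ω)).1 (k + 1) x = _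
  rw [SmoothForms.sub_val, dOp_succ_val _ _ hx, mulOp_val, dOp_succ_val _ _ hx]
  have h : HasFDerivWithinAt ((mulOp i ω).1 k) (baryCoord x i • fderivWithin ℝ (ω.1 k)
      (simplexSet m) x + (coordCLM i).smulRight (ω.1 k x)) (simplexSet m) x :=
    (hasFDerivAt_baryCoord i x).hasFDerivWithinAt.smul
      ((ω.2 k).differentiableWithinAt hx).hasFDerivWithinAt
  rw [extDerivWithin, extDerivWithin, h.fderivWithin (uniqueDiffOn_simplexSet m x hx),
    ContinuousAlternatingMap.alternatizeUncurryFin_add,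
    ContinuousAlternatingMap.alternatizeUncurryFin_smul, add_sub_cancel_left]

theorem sum_wedgeOp (m : ℕ) : ∑ i : Fin (m + 1), wedgeOp i = (0 : Module.End ℝ (SmoothForms m)) := by
  simp only [wedgeOp]
  rw [Finset.sum_sub_distrib, ← Finset.mul_sum, ← Finset.sum_mul, sum_mulOp, mul_one, one_mul,
    sub_self]

theorem dOp_mul_wedgeOp {m : ℕ} (i : Fin (m + 1)) :
    dOp m * wedgeOp i = -(wedgeOp i * dOp m) := by
  rw [wedgeOp, mul_sub, sub_mul, ← mul_assoc, dOp_mul_dOp, mul_assoc (mulOp i), dOp_mul_dOp]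
  noncomm_ring

/-- The `i`-th vertex of the standard simplex. -/
def vertex {m : ℕ} (i : Fin (m + 1)) : Tangent m :=
  ofBary (Pi.single i 1) (by simp)

theorem baryCoord_vertex {m : ℕ} (i j : Fin (m + 1)) :
    baryCoord (vertex i) j = if j = i then 1 else 0 := by
  rw [vertex, baryCoord_ofBary, Pi.single_apply]

theorem vertex_mem {m : ℕ} (i : Fin (m + 1)) : vertex i ∈ simplexSet m :=
  mem_simplexSet.2 fun j => by rw [baryCoord_vertex]; split_ifs <;> norm_num

theorem bary_ext {m : ℕ} {x y : Tangent m} (h : ∀ i, baryCoord x i = baryCoord y i) : x = y :=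
  tangent_ext fun i => add_right_cancel (h i)

/-! ### Cone operators and evaluation at the vertices. -/

theorem contDiffOn_ray_form {m k : ℕ} (i : Fin (m + 1)) (a : ℕ)
    {α : Tangent m → Tangent m [⋀^Fin k]→L[ℝ] ℝ} (hα : IsSmoothForm α) :
    ContDiffOn ℝ ((⊤ : ℕ∞) : WithTop ℕ∞) (rayIntegral (vertex i) a α) (simplexSet m) :=
  contDiffOn_rayIntegral (convex_simplexSet m) (isCompact_simplexSet m) (uniqueDiffOn_simplexSet m)
    (vertex_mem i) a hα.smooth

theorem intervalIntegrable_ray_form {m k : ℕ} (i : Fin (m + 1)) (a : ℕ)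
    {α : Tangent m → Tangent m [⋀^Fin k]→L[ℝ] ℝ} (hα : IsSmoothForm α) {x : Tangent m}
    (hx : x ∈ simplexSet m) :
    IntervalIntegrable (fun t : ℝ => t ^ a • α (vertex i + t • (x - vertex i)))
      MeasureTheory.volume 0 1 :=
  intervalIntegrable_ray (convex_simplexSet m) (vertex_mem i) hx a hα.smooth.continuousOn

/-- Currying of the first variable of an alternating form. -/
def curryLeftCLM (m k : ℕ) : (Tangent m [⋀^Fin (k + 1)]→L[ℝ] ℝ) →L[ℝ]
    (Tangent m →L[ℝ] Tangent m [⋀^Fin k]→L[ℝ] ℝ) :=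
  (ContinuousAlternatingMap.curryLeftLI (𝕜 := ℝ) (E := Tangent m) (F := ℝ)
    (n := k)).toContinuousLinearMap

theorem contDiff_curryLeft (m k : ℕ) {n : WithTop ℕ∞} :
    ContDiff ℝ n fun α : Tangent m [⋀^Fin (k + 1)]→L[ℝ] ℝ => α.curryLeft :=
  ContinuousLinearMap.contDiff (𝕜 := ℝ) (E := Tangent m [⋀^Fin (k + 1)]→L[ℝ] ℝ)
    (F := Tangent m →L[ℝ] Tangent m [⋀^Fin k]→L[ℝ] ℝ) (curryLeftCLM m k)

/-- The homotopy operator of the cone contraction onto the `i`-th vertex. -/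
def coneOp {m : ℕ} (i : Fin (m + 1)) : Module.End ℝ (SmoothForms m) where
  toFun ω := .mk (fun k => (simplexSet m).indicator fun x =>
      (rayIntegral (vertex i) k (ω.1 (k + 1)) x).curryLeft (x - vertex i)) fun k => .indicator <| by
    refine ContDiffOn.clm_apply (f := fun x : Tangent m => 
      (rayIntegral (vertex i) k (ω.1 (k + 1)) x).curryLeft) ?_ (contDiff_id.sub contDiff_const).contDiffOn
    exact ((contDiff_curryLeft m k).comp_contDiffOn
      (contDiffOn_ray_form i k (ω.2 (k + 1))) :)
  map_add' ω η := SmoothForms.ext_on fun k x hx => by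
    simp only [SmoothForms.mk_val, SmoothForms.add_val, Set.indicator_of_mem hx]
    rw [← add_apply, ← ContinuousAlternatingMap.curryLeft_add]
    congr 2
    rw [rayIntegral, rayIntegral, rayIntegral, ← intervalIntegral.integral_add
      (intervalIntegrable_ray_form i k (ω.2 _) hx) (intervalIntegrable_ray_form i k (η.2 _) hx)]
    simp only [SmoothForms.add_val, smul_add]
  map_smul' c ω := SmoothForms.ext_on fun k x hx => by
    simp only [SmoothForms.mk_val, SmoothForms.smul_val, RingHom.id_apply,
      Set.indicator_of_mem hx]
    rw [← smul_apply, ← ContinuousAlternatingMap.curryLeft_smul]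
    congr 2
    rw [rayIntegral, rayIntegral, ← intervalIntegral.integral_smul]
    simp only [SmoothForms.smul_val, smul_comm c]

theorem coneOp_val {m : ℕ} (i : Fin (m + 1)) (ω : SmoothForms m) (k : ℕ) {x : Tangent m}
    (hx : x ∈ simplexSet m) :
    (coneOp i ω).1 k x =
      (rayIntegral (vertex i) k (ω.1 (k + 1)) x).curryLeft (x - vertex i) := by
  rw [coneOp, LinearMap.coe_mk, AddHom.coe_mk, SmoothForms.mk_val, Set.indicator_of_mem hx]

/-- The degree `k` part of `evalOp`. -/
def evalFun {m : ℕ} (i : Fin (m + 1)) (ω : SmoothForms m) :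
    ∀ k : ℕ, Tangent m → Tangent m [⋀^Fin k]→L[ℝ] ℝ
  | 0 => (simplexSet m).indicator fun _ => ω.1 0 (vertex i)
  | _ + 1 => 0

/-- The constant function whose value is that of the degree `0` part at the `i`-th vertex. -/
def evalOp {m : ℕ} (i : Fin (m + 1)) : Module.End ℝ (SmoothForms m) where
  toFun ω := .mk (evalFun i ω) fun k => match k with
    | 0 => .indicator contDiffOn_const
    | _ + 1 => .zero
  map_add' ω η := SmoothForms.ext_on fun k x hx => match k with
    | 0 => by simp only [SmoothForms.mk_val, evalFun, SmoothForms.add_val, Set.indicator_of_mem hx]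
    | k + 1 => (add_zero (0 : Tangent m [⋀^Fin (k + 1)]→L[ℝ] ℝ)).symm
  map_smul' c ω := SmoothForms.ext_on fun k x hx => match k with
    | 0 => by simp only [SmoothForms.mk_val, evalFun, RingHom.id_apply, SmoothForms.smul_val, Set.indicator_of_mem hx]
    | k + 1 => (smul_zero c).symm

theorem evalOp_zero_val {m : ℕ} (i : Fin (m + 1)) (ω : SmoothForms m) {x : Tangent m}
    (hx : x ∈ simplexSet m) : (evalOp i ω).1 0 x = ω.1 0 (vertex i) := by
  rw [evalOp, LinearMap.coe_mk, AddHom.coe_mk, SmoothForms.mk_val, evalFun,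
    Set.indicator_of_mem hx]

theorem evalOp_succ_val {m : ℕ} (i : Fin (m + 1)) (ω : SmoothForms m) (k : ℕ) (x : Tangent m) :
    (evalOp i ω).1 (k + 1) x = 0 := rfl

/-- A cone operator only sees components of positive degree, and an evaluation has none. -/
theorem coneOp_mul_evalOp {m : ℕ} (i j : Fin (m + 1)) : coneOp i * evalOp j = 0 := by
  refine LinearMap.ext fun ω => SmoothForms.ext_on fun k x hx => ?_
  change (coneOp i (evalOp j ω)).1 k x = 0
  rw [coneOp_val _ _ _ hx]
  have h : rayIntegral (vertex i) k ((evalOp j ω).1 (k + 1)) x = 0 := by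
    rw [rayIntegral]
    simp [evalOp_succ_val]
  rw [h, ContinuousAlternatingMap.curryLeft_zero, zero_apply]

/-! ### The homotopy formula for the cone contraction -/

section RayIntegral

variable {E F : Type u} [NormedAddCommGroup E] [NormedSpace ℝ E] [NormedAddCommGroup F]
  [NormedSpace ℝ F]

theorem hasDerivWithinAt_ray {s : Set E} (hs : Convex ℝ s) {e x : E} (he : e ∈ s) (hx : x ∈ s)
    {φ : E → F} (hφ : DifferentiableOn ℝ φ s) {t : ℝ} (ht : t ∈ Set.Ioo (0 : ℝ) 1) :
    HasDerivWithinAt (fun t : ℝ => φ (e + t • (x - e)))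
      (fderivWithin ℝ φ s (e + t • (x - e)) (x - e)) (Set.Ioi t) t := by
  have hl : HasDerivWithinAt (fun t : ℝ => e + t • (x - e)) (x - e) (Set.Icc 0 1) t := by
    simpa using (((hasDerivAt_id t).smul_const (x - e)).const_add e).hasDerivWithinAt
  have hp := ray_mem hs he hx (t := t) ⟨ht.1.le, ht.2.le⟩
  have h := (hφ _ hp).hasFDerivWithinAt.comp_hasDerivWithinAt t hl
    (fun r hr => ray_mem hs he hx hr)
  exact (h.hasDerivAt (Icc_mem_nhds ht.1 ht.2)).hasDerivWithinAt

theorem rayIntegral_zero_fderivWithin [CompleteSpace F] {s : Set E} (hs : Convex ℝ s) (hu : UniqueDiffOn ℝ s)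
    {e x : E} (he : e ∈ s) (hx : x ∈ s) {φ : E → F} (hφ : ContDiffOn ℝ 1 φ s) :
    rayIntegral e 0 (fderivWithin ℝ φ s) x (x - e) = φ x - φ e := by
  have hD : ContinuousOn (fderivWithin ℝ φ s) s := hφ.continuousOn_fderivWithin hu le_rfl
  rw [rayIntegral, ContinuousLinearMap.intervalIntegral_apply
    (intervalIntegrable_ray hs he hx 0 hD)]
  simp only [pow_zero, one_smul]
  rw [intervalIntegral.integral_eq_sub_of_hasDeriv_right_of_le zero_le_one
    (f := fun t : ℝ => φ (e + t • (x - e)))]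
  · simp
  · simpa using continuousOn_ray hs he hx 0 hφ.continuousOn
  · exact fun t ht => hasDerivWithinAt_ray hs he hx (hφ.differentiableOn one_ne_zero) ht
  · refine ContinuousOn.intervalIntegrable_of_Icc zero_le_one ?_
    have h := (continuousOn_ray hs he hx 0 hD).clm_apply (continuousOn_const (c := x - e))
    simpa only [pow_zero, one_smul] using h

/-- The fundamental theorem of calculus for `t ^ (a + 1) • φ (e + t • (x - e))` on `[0, 1]`. With
`φ` the component of degree `a + 1`, this is the analytic content of the Poincaré lemma in positive
degree. -/
theorem rayIntegral_succ_fderivWithin [CompleteSpace F] {s : Set E} (hs : Convex ℝ s) (hu : UniqueDiffOn ℝ s)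
    {e x : E} (he : e ∈ s) (hx : x ∈ s) (a : ℕ) {φ : E → F} (hφ : ContDiffOn ℝ 1 φ s) :
    ((a : ℝ) + 1) • rayIntegral e a φ x + rayIntegral e (a + 1) (fderivWithin ℝ φ s) x (x - e) =
      φ x := by
  have hD : ContinuousOn (fderivWithin ℝ φ s) s := hφ.continuousOn_fderivWithin hu le_rfl
  have h1 : IntervalIntegrable (fun t : ℝ => ((a : ℝ) + 1) • t ^ a • φ (e + t • (x - e)))
      MeasureTheory.volume 0 1 :=
    ((continuousOn_ray hs he hx a hφ.continuousOn).const_smul _).intervalIntegrable_of_Icc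
      zero_le_one
  have h2 : IntervalIntegrable (fun t : ℝ =>
      (t ^ (a + 1) • fderivWithin ℝ φ s (e + t • (x - e))) (x - e)) MeasureTheory.volume 0 1 := by
    refine ContinuousOn.intervalIntegrable_of_Icc zero_le_one ?_
    exact (continuousOn_ray hs he hx (a + 1) hD).clm_apply continuousOn_const
  rw [rayIntegral, rayIntegral, ContinuousLinearMap.intervalIntegral_apply
    (intervalIntegrable_ray hs he hx (a + 1) hD), ← intervalIntegral.integral_smul,
    ← intervalIntegral.integral_add h1 h2]
  rw [intervalIntegral.integral_eq_sub_of_hasDeriv_right_of_le zero_le_one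
    (f := fun t : ℝ => t ^ (a + 1) • φ (e + t • (x - e)))]
  · simp
  · exact continuousOn_ray hs he hx (a + 1) hφ.continuousOn
  · intro t ht
    have h := (hasDerivAt_pow (a + 1) t).hasDerivWithinAt.smul
      (hasDerivWithinAt_ray hs he hx (hφ.differentiableOn one_ne_zero) ht)
    convert h using 1
    · rfl
    rw [smul_apply, add_comm, smul_smul]
    simp
  · exact h1.add h2

end RayIntegral

namespace IsSmoothForm

variable {m k : ℕ} {α : Tangent m → Tangent m [⋀^Fin k]→L[ℝ] ℝ}

theorem contDiffOn_one (hα : IsSmoothForm α) : ContDiffOn ℝ 1 α (simplexSet m) :=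
  hα.smooth.of_le (WithTop.coe_le_coe.mpr le_top)

theorem continuousOn_fderivWithin (hα : IsSmoothForm α) :
    ContinuousOn (fderivWithin ℝ α (simplexSet m)) (simplexSet m) :=
  hα.contDiffOn_one.continuousOn_fderivWithin (uniqueDiffOn_simplexSet m) le_rfl

theorem rayIntegral_extDerivWithin (hα : IsSmoothForm α) (i : Fin (m + 1)) (a : ℕ) {x : Tangent m}
    (hx : x ∈ simplexSet m) :
    rayIntegral (vertex i) a (_root_.extDerivWithin α (simplexSet m)) x =
      ContinuousAlternatingMap.alternatizeUncurryFin
        (rayIntegral (vertex i) a (fderivWithin ℝ α (simplexSet m)) x) := by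
  have h := ContinuousLinearMap.intervalIntegral_comp_comm (𝕜 := ℝ)
    (E := Tangent m →L[ℝ] Tangent m [⋀^Fin k]→L[ℝ] ℝ) (F := Tangent m [⋀^Fin (k + 1)]→L[ℝ] ℝ)
    (ContinuousAlternatingMap.alternatizeUncurryFinCLM (n := k) ℝ (Tangent m) ℝ)
    (intervalIntegrable_ray (F := Tangent m →L[ℝ] Tangent m [⋀^Fin k]→L[ℝ] ℝ)
      (convex_simplexSet m) (vertex_mem i) hx a hα.continuousOn_fderivWithin)
  rw [rayIntegral, rayIntegral, ← ContinuousAlternatingMap.alternatizeUncurryFinCLM_apply, ← h]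
  simp only [map_smul]
  rfl

end IsSmoothForm

theorem rayIntegral_congr {m k : ℕ} (i : Fin (m + 1)) (a : ℕ)
    {α β : Tangent m → Tangent m [⋀^Fin k]→L[ℝ] ℝ} (h : Set.EqOn α β (simplexSet m)) {x : Tangent m}
    (hx : x ∈ simplexSet m) : rayIntegral (vertex i) a α x = rayIntegral (vertex i) a β x := by
  refine intervalIntegral.integral_congr fun t ht => ?_
  rw [Set.uIcc_of_le zero_le_one] at ht
  simp only [h (ray_mem (convex_simplexSet m) (vertex_mem i) hx ht)]

theorem coneOp_dOp_val {m : ℕ} (i : Fin (m + 1)) (ω : SmoothForms m) (k : ℕ) {x : Tangent m}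
    (hx : x ∈ simplexSet m) :
    (coneOp i (dOp m ω)).1 k x = (ContinuousAlternatingMap.alternatizeUncurryFin
      (rayIntegral (vertex i) k (fderivWithin ℝ (ω.1 k) (simplexSet m)) x)).curryLeft
        (x - vertex i) := by
  rw [coneOp_val _ _ _ hx, rayIntegral_congr i k (fun y hy => dOp_succ_val ω k hy) hx,
    (ω.2 k).rayIntegral_extDerivWithin i k hx]

theorem alternatizeUncurryFin_curryLeft_real {m k : ℕ} (β : Tangent m [⋀^Fin (k + 1)]→L[ℝ] ℝ) :
    ContinuousAlternatingMap.alternatizeUncurryFin β.curryLeft = ((k : ℝ) + 1) • β := by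
  rw [ContinuousAlternatingMap.alternatizeUncurryFin_curryLeft, ← Nat.cast_succ,
    Nat.cast_smul_eq_nsmul]

/-- The product rule for a varying form contracted with the varying vector `x - vertex i`.
Differentiating the form raises the weight; differentiating the vector gives the last term, because
alternatizing a curried form multiplies it by its degree `k + 1`. -/
theorem dOp_coneOp_val {m : ℕ} (i : Fin (m + 1)) (ω : SmoothForms m) (k : ℕ) {x : Tangent m}
    (hx : x ∈ simplexSet m) :
    (dOp m (coneOp i ω)).1 (k + 1) x = ContinuousAlternatingMap.alternatizeUncurryFin
        ((((curryLeftCLM m k).comp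
          (rayIntegral (vertex i) (k + 1) (fderivWithin ℝ (ω.1 (k + 1)) (simplexSet m)) x)).flip
            (x - vertex i))) +
      ((k : ℝ) + 1) • rayIntegral (vertex i) k (ω.1 (k + 1)) x := by
  rw [dOp_succ_val _ _ hx, extDerivWithin_congr' (fun y hy => coneOp_val i ω k hy) hx,
    extDerivWithin]
  have h1 := hasFDerivWithinAt_rayIntegral (convex_simplexSet m) (isCompact_simplexSet m)
    (uniqueDiffOn_simplexSet m) (vertex_mem i) hx k (ω.2 (k + 1)).contDiffOn_one
  have h2 := HasFDerivWithinAt.clm_apply (G := Tangent m) (H := Tangent m [⋀^Fin k]→L[ℝ] ℝ)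
    (HasFDerivAt.comp_hasFDerivWithinAt (G := Tangent m →L[ℝ] Tangent m [⋀^Fin k]→L[ℝ] ℝ) x
      (ContinuousLinearMap.hasFDerivAt (curryLeftCLM m k)) h1)
    ((hasFDerivWithinAt_id x (simplexSet m)).sub_const (vertex i))
  have h3 := h2.fderivWithin (uniqueDiffOn_simplexSet m x hx)
  have h4 : (fun y => (rayIntegral (vertex i) k (ω.1 (k + 1)) y).curryLeft (y - vertex i)) =
    fun y => ((curryLeftCLM m k ∘ rayIntegral (vertex i) k (ω.1 (k + 1))) y)
      (id y - vertex i) := rfl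
  rw [h4, h3, ContinuousAlternatingMap.alternatizeUncurryFin_add]
  refine (add_comm _ _).trans (congrArg₂ _ rfl ?_)
  exact alternatizeUncurryFin_curryLeft_real _

theorem alternatizeUncurryFin_curryLeft_zero {m : ℕ}
    (A : Tangent m →L[ℝ] Tangent m [⋀^Fin 0]→L[ℝ] ℝ) (u : Tangent m) :
    (ContinuousAlternatingMap.alternatizeUncurryFin A).curryLeft u = A u := by
  ext v
  rw [ContinuousAlternatingMap.curryLeft_apply_apply,
    ContinuousAlternatingMap.alternatizeUncurryFin_apply]
  simp [Subsingleton.elim v (fun i => Fin.elim0 i), Subsingleton.elim (Fin.removeNth 0 _) (fun i => Fin.elim0 i)]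

/-- The linear algebra of Cartan's formula: in the alternating sum the index `0` removes `u` and
gives `A u`, while every other index leaves `u` in the first slot of the form and carries the
opposite sign. -/
theorem alternatizeUncurryFin_curryLeft_succ {m k : ℕ}
    (A : Tangent m →L[ℝ] Tangent m [⋀^Fin (k + 1)]→L[ℝ] ℝ) (u : Tangent m) :
    (ContinuousAlternatingMap.alternatizeUncurryFin A).curryLeft u =
      A u - ContinuousAlternatingMap.alternatizeUncurryFin (((curryLeftCLM m k).comp A).flip u) := by
  ext v
  rw [ContinuousAlternatingMap.curryLeft_apply_apply, ContinuousAlternatingMap.sub_apply,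
    ContinuousAlternatingMap.alternatizeUncurryFin_apply,
    ContinuousAlternatingMap.alternatizeUncurryFin_apply, Fin.sum_univ_succ, sub_eq_add_neg,
    ← Finset.sum_neg_distrib]
  congr 1
  · simp
  · refine Finset.sum_congr rfl fun i _ => ?_
    have h : (i.succ.removeNth (Matrix.vecCons u v) : Fin (k + 1) → Tangent m) =
        Matrix.vecCons u (i.removeNth v) := by
      funext j
      refine Fin.cases ?_ (fun j => ?_) j <;> simp [Fin.removeNth, Fin.succ_succAbove_succ]
    rw [h, Fin.val_succ, pow_succ, mul_neg_one, neg_smul]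
    rfl

/-- The cone contraction onto a vertex is a homotopy between the identity and the evaluation. -/
theorem dOp_coneOp_add {m : ℕ} (i : Fin (m + 1)) :
    dOp m * coneOp i + coneOp i * dOp m = 1 - evalOp i := by
  refine LinearMap.ext fun ω => SmoothForms.ext_on fun k x hx => ?_
  change (dOp m (coneOp i ω) + coneOp i (dOp m ω)).1 k x = (ω - evalOp i ω).1 k x
  rw [SmoothForms.add_val, SmoothForms.sub_val, coneOp_dOp_val i ω k hx]
  rcases k with _ | k
  · rw [dOp_zero_val, zero_add, evalOp_zero_val _ _ hx, alternatizeUncurryFin_curryLeft_zero]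
    exact rayIntegral_zero_fderivWithin (convex_simplexSet m) (uniqueDiffOn_simplexSet m)
      (vertex_mem i) hx (ω.2 0).contDiffOn_one
  -- The alternatized contractions in `d h` and `h d` cancel, and the remaining two terms are those
  -- of `rayIntegral_succ_fderivWithin`.
  · rw [evalOp_succ_val, sub_zero, dOp_coneOp_val i ω k hx, alternatizeUncurryFin_curryLeft_succ]
    have h := rayIntegral_succ_fderivWithin (convex_simplexSet m) (uniqueDiffOn_simplexSet m)
      (vertex_mem i) hx k (ω.2 (k + 1)).contDiffOn_one
    rw [← h]
    abel

/-! ### Pullback along affine maps between standard simplices -/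

/-- The linear part of the affine map sending the `i`-th vertex to the `f i`-th one. -/
def vertexLin {l m : ℕ} (f : Fin (l + 1) → Fin (m + 1)) : Tangent l →L[ℝ] Tangent m :=
  LinearMap.toContinuousLinearMap
    { toFun := fun v => ofCoord (fun j => ∑ i, if f i = j then coord v i else 0) (by
        rw [Finset.sum_comm]
        simp [sum_coord])
      map_add' := fun v w => tangent_ext fun j => by
        simp only [coord_ofCoord, coord_add, ← Finset.sum_add_distrib]
        exact Finset.sum_congr rfl fun i _ => by split_ifs <;> simp
      map_smul' := fun c v => tangent_ext fun j => by
        simp only [coord_ofCoord, coord_smul, Finset.mul_sum, RingHom.id_apply]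
        exact Finset.sum_congr rfl fun i _ => by split_ifs <;> simp }

/-- The affine map sending the `i`-th vertex to the `f i`-th one. -/
def vertexMap {l m : ℕ} (f : Fin (l + 1) → Fin (m + 1)) (x : Tangent l) : Tangent m :=
  ofBary (fun j => ∑ i, if f i = j then baryCoord x i else 0) (by
    rw [Finset.sum_comm]
    simp [sum_baryCoord])

theorem vertexMap_embedding {l m : ℕ} (f : Fin (l + 1) ↪ Fin (m + 1)) :
    vertexMap f = faceMap f := rfl

theorem vertexLin_embedding {l m : ℕ} (f : Fin (l + 1) ↪ Fin (m + 1)) :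
    vertexLin f = faceLin f := rfl

theorem coord_vertexLin {l m : ℕ} (f : Fin (l + 1) → Fin (m + 1)) (v : Tangent l)
    (j : Fin (m + 1)) : coord (vertexLin f v) j = ∑ i, if f i = j then coord v i else 0 := rfl

theorem baryCoord_vertexMap {l m : ℕ} (f : Fin (l + 1) → Fin (m + 1)) (x : Tangent l)
    (j : Fin (m + 1)) :
    baryCoord (vertexMap f x) j = ∑ i, if f i = j then baryCoord x i else 0 := by
  rw [vertexMap, baryCoord_ofBary]

theorem coord_sub {m : ℕ} (x y : Tangent m) (i : Fin (m + 1)) :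
    coord (x - y) i = baryCoord x i - baryCoord y i := by
  have h : coord (x - y) i = coord x i - coord y i := rfl
  rw [h, baryCoord, baryCoord, add_sub_add_right_eq_sub]

theorem vertexMap_sub {l m : ℕ} (f : Fin (l + 1) → Fin (m + 1)) (x y : Tangent l) :
    vertexMap f x - vertexMap f y = vertexLin f (x - y) := by
  refine tangent_ext fun j => ?_
  rw [coord_sub, coord_vertexLin, baryCoord_vertexMap, baryCoord_vertexMap,
    ← Finset.sum_sub_distrib]
  refine Finset.sum_congr rfl fun i _ => ?_
  rw [coord_sub]
  split_ifs <;> simp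

theorem vertexMap_eq {l m : ℕ} (f : Fin (l + 1) → Fin (m + 1)) (x : Tangent l) :
    vertexMap f x = vertexLin f x + vertexMap f 0 := by
  rw [← sub_eq_iff_eq_add, vertexMap_sub, sub_zero]

theorem hasFDerivAt_vertexMap {l m : ℕ} (f : Fin (l + 1) → Fin (m + 1)) (x : Tangent l) :
    HasFDerivAt (vertexMap f) (vertexLin f) x := by
  rw [funext (vertexMap_eq f)]
  exact (vertexLin f).hasFDerivAt.add_const _

theorem contDiff_vertexMap {l m : ℕ} (f : Fin (l + 1) → Fin (m + 1)) {n : WithTop ℕ∞} :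
    ContDiff ℝ n (vertexMap f) := by
  rw [funext (vertexMap_eq f)]
  exact (vertexLin f).contDiff.add contDiff_const

theorem mapsTo_vertexMap {l m : ℕ} (f : Fin (l + 1) → Fin (m + 1)) :
    Set.MapsTo (vertexMap f) (simplexSet l) (simplexSet m) := by
  intro x hx
  rw [mem_simplexSet] at hx ⊢
  intro j
  rw [baryCoord_vertexMap]
  exact Finset.sum_nonneg fun i _ => by split_ifs; exacts [hx i, le_rfl]

theorem vertexMap_vertex {l m : ℕ} (f : Fin (l + 1) → Fin (m + 1)) (i : Fin (l + 1)) :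
    vertexMap f (vertex i) = vertex (f i) := by
  refine bary_ext fun j => ?_
  simp only [baryCoord_vertexMap, baryCoord_vertex]
  rw [Finset.sum_eq_single i (fun b _ hb => by simp [hb]) (by simp)]
  simp [eq_comm]

theorem vertexMap_ray {l m : ℕ} (f : Fin (l + 1) → Fin (m + 1)) (x y : Tangent l) (t : ℝ) :
    vertexMap f (y + t • (x - y)) = vertexMap f y + t • (vertexMap f x - vertexMap f y) := by
  rw [vertexMap_sub, ← map_smul, ← sub_eq_iff_eq_add', vertexMap_sub, add_sub_cancel_left]

/-- The pointwise pullback of alternating forms. -/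
def compCLM {l m : ℕ} (f : Fin (l + 1) → Fin (m + 1)) (k : ℕ) :
    (Tangent m [⋀^Fin k]→L[ℝ] ℝ) →L[ℝ] (Tangent l [⋀^Fin k]→L[ℝ] ℝ) :=
  ContinuousAlternatingMap.compContinuousLinearMapCLM (vertexLin f)

theorem contDiff_compCLM {l m : ℕ} (f : Fin (l + 1) → Fin (m + 1)) (k : ℕ) {n : WithTop ℕ∞} :
    ContDiff ℝ n fun α : Tangent m [⋀^Fin k]→L[ℝ] ℝ => α.compContinuousLinearMap (vertexLin f) :=
  ContinuousLinearMap.contDiff (𝕜 := ℝ) (E := Tangent m [⋀^Fin k]→L[ℝ] ℝ)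
    (F := Tangent l [⋀^Fin k]→L[ℝ] ℝ) (compCLM f k)

/-- Pullback of smooth forms along the affine map induced by a map of vertices. -/
def pullOp {l m : ℕ} (f : Fin (l + 1) → Fin (m + 1)) : SmoothForms m →ₗ[ℝ] SmoothForms l where
  toFun ω := .mk (fun k => (simplexSet l).indicator fun x =>
      (ω.1 k (vertexMap f x)).compContinuousLinearMap (vertexLin f)) fun k => .indicator <|
    (contDiff_compCLM f k).comp_contDiffOn
      ((ω.2 k).smooth.comp (contDiff_vertexMap f).contDiffOn (mapsTo_vertexMap f))
  map_add' ω η := SmoothForms.ext_on fun k x hx => by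
    simp only [SmoothForms.mk_val, SmoothForms.add_val, Set.indicator_of_mem hx]
    rfl
  map_smul' c ω := SmoothForms.ext_on fun k x hx => by
    simp only [SmoothForms.mk_val, SmoothForms.smul_val, RingHom.id_apply,
      Set.indicator_of_mem hx]
    rfl

theorem pullOp_val {l m : ℕ} (f : Fin (l + 1) → Fin (m + 1)) (ω : SmoothForms m) (k : ℕ)
    {x : Tangent l} (hx : x ∈ simplexSet l) :
    (pullOp f ω).1 k x = (ω.1 k (vertexMap f x)).compContinuousLinearMap (vertexLin f) := by
  rw [pullOp, LinearMap.coe_mk, AddHom.coe_mk, SmoothForms.mk_val, Set.indicator_of_mem hx]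

theorem pullOp_dOp {l m : ℕ} (f : Fin (l + 1) → Fin (m + 1)) (ω : SmoothForms m) :
    pullOp f (dOp m ω) = dOp l (pullOp f ω) := by
  refine SmoothForms.ext_on fun k x hx => ?_
  rw [pullOp_val _ _ _ hx]
  rcases k with _ | k
  · rfl
  · rw [dOp_succ_val _ _ hx, dOp_succ_val _ _ (mapsTo_vertexMap f hx)]
    have hd : ∀ y ∈ simplexSet l, fderivWithin ℝ (vertexMap f) (simplexSet l) y = vertexLin f :=
      fun y hy => (hasFDerivAt_vertexMap f y).hasFDerivWithinAt.fderivWithin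
        (uniqueDiffOn_simplexSet l y hy)
    have h := extDerivWithin_pullback ((ω.2 k).differentiableWithinAt (mapsTo_vertexMap f hx))
      (contDiff_vertexMap f (n := ((⊤ : ℕ∞) : WithTop ℕ∞))).contDiffWithinAt minSmoothness_two_le
      (uniqueDiffOn_simplexSet l) (mem_closure_interior_simplexSet hx) hx (mapsTo_vertexMap f)
    rw [hd x hx] at h
    rw [← h]
    refine extDerivWithin_congr' (fun y hy => ?_) hx
    rw [hd y hy, pullOp_val _ _ _ hy]

/-- The pullback of `t_j` is the sum of the `t_i` with `f i = j`, so a single multiplication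
operator is not natural, but the sum over all vertices is. Every sandwich in the homotopy is such a
sum. -/
theorem pullOp_sum_mulOp {l m : ℕ} (f : Fin (l + 1) → Fin (m + 1))
    (η : Fin (m + 1) → SmoothForms m) :
    pullOp f (∑ j, mulOp j (η j)) = ∑ i, mulOp i (pullOp f (η (f i))) := by
  refine SmoothForms.ext_on fun k x hx => ?_
  ext v
  rw [pullOp_val _ _ _ hx, SmoothForms.sum_val, SmoothForms.sum_val]
  simp only [mulOp_val, pullOp_val _ _ _ hx, ContinuousAlternatingMap.compContinuousLinearMap_apply,
    ContinuousAlternatingMap.sum_apply, ContinuousAlternatingMap.smul_apply, baryCoord_vertexMap,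
    smul_eq_mul, Finset.sum_mul]
  rw [Finset.sum_comm]
  refine Finset.sum_congr rfl fun i _ => ?_
  rw [Finset.sum_eq_single (f i) (fun b _ hb => by rw [if_neg (Ne.symm hb), zero_mul]) (by simp),
    if_pos rfl]

/-- Wedging is a commutator with `dOp`, so naturality is inherited from multiplication and from the
exterior derivative. -/
theorem pullOp_sum_wedgeOp {l m : ℕ} (f : Fin (l + 1) → Fin (m + 1))
    (η : Fin (m + 1) → SmoothForms m) :
    pullOp f (∑ j, wedgeOp j (η j)) = ∑ i, wedgeOp i (pullOp f (η (f i))) := by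
  have h : ∀ (n : ℕ) (ξ : Fin (n + 1) → SmoothForms n), ∑ j, wedgeOp j (ξ j) =
      dOp n (∑ j, mulOp j (ξ j)) - ∑ j, mulOp j (dOp n (ξ j)) := fun n ξ => by
    rw [map_sum, ← Finset.sum_sub_distrib]
    rfl
  rw [h, map_sub, pullOp_dOp, pullOp_sum_mulOp, pullOp_sum_mulOp, h]
  simp only [pullOp_dOp]

/-- An affine map carries the rays issuing from vertex `i` to those issuing from vertex `f i`, with
the same parameter. -/
theorem pullOp_coneOp {l m : ℕ} (f : Fin (l + 1) → Fin (m + 1)) (i : Fin (l + 1))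
    (ω : SmoothForms m) : pullOp f (coneOp (f i) ω) = coneOp i (pullOp f ω) := by
  refine SmoothForms.ext_on fun k x hx => ?_
  rw [pullOp_val _ _ _ hx, coneOp_val _ _ _ hx, coneOp_val _ _ _ (mapsTo_vertexMap f hx)]
  have h1 : rayIntegral (vertex i) k ((pullOp f ω).1 (k + 1)) x =
      (rayIntegral (vertex (f i)) k (ω.1 (k + 1)) (vertexMap f x)).compContinuousLinearMap
        (vertexLin f) := by
    have h2 := ContinuousLinearMap.intervalIntegral_comp_comm (𝕜 := ℝ)
      (E := Tangent m [⋀^Fin (k + 1)]→L[ℝ] ℝ) (F := Tangent l [⋀^Fin (k + 1)]→L[ℝ] ℝ)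
      (compCLM f (k + 1))
      (intervalIntegrable_ray_form (f i) k (ω.2 (k + 1)) (mapsTo_vertexMap f hx))
    refine Eq.trans ?_ h2
    refine intervalIntegral.integral_congr fun t ht => ?_
    rw [Set.uIcc_of_le zero_le_one] at ht
    simp only [map_smul]
    rw [pullOp_val _ _ _ (ray_mem (convex_simplexSet l) (vertex_mem i) hx ht), vertexMap_ray,
      vertexMap_vertex]
    rfl
  rw [h1, ContinuousAlternatingMap.curryLeft_compContinuousLinearMap, ← vertexMap_vertex,
    vertexMap_sub]

/-! ### An algebraic homotopy -/

section Algebra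

variable {R ι : Type*} [Ring R] [Fintype ι]

/-- The sum of the two-sided multiplications `X ↦ a i * X * h i`. -/
def sandwich (a h : ι → R) (X : R) : R := ∑ i, a i * X * h i

/-- The iterates of `X ↦ -∑ e i * X * h i`, starting with `1`. -/
def iterHomotopy (e h : ι → R) : ℕ → R
  | 0 => 1
  | n + 1 => -sandwich e h (iterHomotopy e h n)

/-- The iterates of `X ↦ ∑ e i * X * h i`, starting with `∑ e i * ε i`. -/
def iterEval (e h ε : ι → R) : ℕ → R
  | 0 => ∑ i, e i * ε i
  | n + 1 => sandwich e h (iterEval e h ε n)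

/-- The terms of the projection onto elementary forms. -/
def projTerm (T e h ε : ι → R) : ℕ → R
  | 0 => ∑ i, T i * ε i
  | n + 1 => sandwich T h (iterEval e h ε n)

variable {d : R} {T e h ε : ι → R}

theorem iterHomotopy_succ_mul (hhε : ∀ i j, h i * ε j = 0) (n : ℕ) (j : ι) :
    iterHomotopy e h (n + 1) * ε j = 0 := by
  simp [iterHomotopy, sandwich, Finset.sum_mul, mul_assoc, hhε]

/-- Passing `d` through `e i` gives a sign and passing it through `h i` leaves `1 - ε i`. The
contribution of the `1` is `(∑ e i) * X`, which vanishes. -/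
theorem commute_sandwich (hhd : ∀ i, d * h i + h i * d = 1 - ε i)
    (hde : ∀ i, d * e i = -(e i * d)) (he0 : ∑ i, e i = 0) (X : R) :
    d * sandwich e h X - sandwich e h X * d =
      -sandwich e h (d * X - X * d) + ∑ i, e i * X * ε i := by
  have h1 : ∀ i, d * (e i * X * h i) - e i * X * h i * d =
      -(e i * (d * X - X * d) * h i) + e i * X * ε i - e i * X := fun i => by
    have h2 : h i * d = 1 - ε i - d * h i := eq_sub_of_add_eq' (hhd i)
    have h3 : d * (e i * X * h i) = -(e i * (d * X * h i)) := by
      rw [← mul_assoc, ← mul_assoc, hde]; noncomm_ring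
    rw [h3, mul_assoc (e i * X), h2]
    noncomm_ring
  simp only [sandwich, Finset.mul_sum, Finset.sum_mul]
  rw [← Finset.sum_sub_distrib, Finset.sum_congr rfl fun i _ => h1 i, Finset.sum_sub_distrib,
    Finset.sum_add_distrib, Finset.sum_neg_distrib, ← Finset.sum_mul, he0, zero_mul, sub_zero]

/-- Passing `d` through `T i` leaves `e i`, and passing it through `h i` leaves `1 - ε i`. Here the
contribution of the `1` is `(∑ T i) * X = X`, and for `X = X_n` the first term is `-X_{n+1}`: this
is the telescoping difference. -/
theorem anticommute_sandwich (hhd : ∀ i, d * h i + h i * d = 1 - ε i)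
    (hdT : ∀ i, e i = d * T i - T i * d) (hT : ∑ i, T i = 1) (X : R) :
    d * sandwich T h X + sandwich T h X * d =
      sandwich e h X + sandwich T h (d * X - X * d) + X - ∑ i, T i * X * ε i := by
  have h1 : ∀ i, d * (T i * X * h i) + T i * X * h i * d =
      e i * X * h i + T i * (d * X - X * d) * h i + T i * X - T i * X * ε i := fun i => by
    have h2 : h i * d = 1 - ε i - d * h i := eq_sub_of_add_eq' (hhd i)
    rw [mul_assoc (T i * X), h2, hdT]
    noncomm_ring
  simp only [sandwich, Finset.mul_sum, Finset.sum_mul]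
  rw [← Finset.sum_add_distrib, Finset.sum_congr rfl fun i _ => h1 i, Finset.sum_sub_distrib,
    Finset.sum_add_distrib, Finset.sum_add_distrib, ← Finset.sum_mul Finset.univ T, hT, one_mul]

theorem sandwich_neg (a h : ι → R) (X : R) : sandwich a h (-X) = -sandwich a h X := by
  simp [sandwich]

/-- An evaluation term appears at the first step only. From then on `h i * ε j = 0` kills new ones,
and the old one is carried along by the sandwiches. -/
theorem commute_iterHomotopy (hhd : ∀ i, d * h i + h i * d = 1 - ε i)
    (hde : ∀ i, d * e i = -(e i * d)) (he0 : ∑ i, e i = 0) (hhε : ∀ i j, h i * ε j = 0) (n : ℕ) :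
    d * iterHomotopy e h (n + 1) - iterHomotopy e h (n + 1) * d = -iterEval e h ε n := by
  induction n with
  | zero =>
    have h1 := commute_sandwich hhd hde he0 1
    simp only [iterHomotopy, iterEval]
    rw [mul_neg, neg_mul, ← neg_sub', h1]
    simp [sandwich]
  | succ n ih =>
    have h1 := commute_sandwich hhd hde he0 (iterHomotopy e h (n + 1))
    rw [ih, sandwich_neg] at h1
    simp only [mul_assoc, iterHomotopy_succ_mul hhε, mul_zero, Finset.sum_const_zero, add_zero,
      neg_neg] at h1
    rw [iterHomotopy, mul_neg, neg_mul, ← neg_sub', h1, iterEval]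

theorem anticommute_sum (hhd : ∀ i, d * h i + h i * d = 1 - ε i)
    (hdT : ∀ i, e i = d * T i - T i * d) (hT : ∑ i, T i = 1)
    (hde : ∀ i, d * e i = -(e i * d)) (he0 : ∑ i, e i = 0) (hhε : ∀ i j, h i * ε j = 0) (N : ℕ) :
    d * (∑ n ∈ Finset.range N, sandwich T h (iterHomotopy e h n)) +
        (∑ n ∈ Finset.range N, sandwich T h (iterHomotopy e h n)) * d =
      1 - iterHomotopy e h N - ∑ n ∈ Finset.range N, projTerm T e h ε n := by
  induction N with
  | zero => simp [iterHomotopy]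
  | succ N ih =>
    have h1 : d * sandwich T h (iterHomotopy e h N) + sandwich T h (iterHomotopy e h N) * d =
        iterHomotopy e h N - iterHomotopy e h (N + 1) - projTerm T e h ε N := by
      rw [anticommute_sandwich hhd hdT hT]
      -- At `N = 0` the projection term is the evaluation term. Afterwards the evaluation term
      -- vanishes, and the projection term comes from the failure of `X_N` to commute with `d`.
      rcases N with _ | N
      · simp [iterHomotopy, projTerm, sandwich]
        abel
      · rw [commute_iterHomotopy hhd hde he0 hhε, sandwich_neg, projTerm,
          iterHomotopy.eq_2 e h (N + 1)]
        simp only [mul_assoc, iterHomotopy_succ_mul hhε, mul_zero, Finset.sum_const_zero]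
        abel
    rw [Finset.sum_range_succ, Finset.sum_range_succ, mul_add, add_mul]
    calc _ = (d * (∑ n ∈ Finset.range N, sandwich T h (iterHomotopy e h n)) +
        (∑ n ∈ Finset.range N, sandwich T h (iterHomotopy e h n)) * d) +
        (d * sandwich T h (iterHomotopy e h N) + sandwich T h (iterHomotopy e h N) * d) := by abel
      _ = _ := by rw [ih, h1]; abel

end Algebra

/-! ### Vanishing above the dimension -/

theorem finrank_tangent_le (m : ℕ) : Module.finrank ℝ (Tangent m) ≤ m := by
  let L : Tangent m →ₗ[ℝ] (Fin m → ℝ) :=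
    { toFun := fun v i => coord v i.succ
      map_add' := fun v w => rfl
      map_smul' := fun c v => rfl }
  have hL : Function.Injective L := by
    intro v w h
    have hs : ∀ i : Fin m, coord v i.succ = coord w i.succ := fun i => congrFun h i
    refine tangent_ext fun i => Fin.cases ?_ hs i
    have hv := sum_coord v
    have hw := sum_coord w
    rw [Fin.sum_univ_succ] at hv hw
    simp only [hs] at hv
    linarith
  simpa using LinearMap.finrank_le_finrank_of_injective hL

theorem alternating_eq_zero {m k : ℕ} (hk : m < k) (α : Tangent m [⋀^Fin k]→L[ℝ] ℝ) : α = 0 := by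
  ext v
  refine α.toAlternatingMap.map_linearDependent v fun h => ?_
  have := h.fintype_card_le_finrank
  rw [Fintype.card_fin] at this
  exact absurd (this.trans (finrank_tangent_le m)) (not_le.2 hk)

/-! ### Periods -/

section Periods

variable {m : ℕ}

/-- The functional `ω ↦ (h_{f (k-1)} ⋯ h_{f 0} ω) (v_{f k})`, where `h_i` is the `i`-th cone
operator. It is the integral of `ω` over the affine simplex with vertices `f 0, …, f k`. -/
def period : ∀ k : ℕ, (Fin (k + 1) → Fin (m + 1)) → SmoothForms m →ₗ[ℝ] ℝ
  | 0, f =>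
    { toFun := fun ω => ω.1 0 (vertex (f 0)) fun i => i.elim0
      map_add' := fun _ _ => rfl
      map_smul' := fun _ _ => rfl }
  | k + 1, f => period k (fun i => f i.succ) ∘ₗ coneOp (f 0)

theorem period_zero (f : Fin 1 → Fin (m + 1)) (ω : SmoothForms m) :
    period 0 f ω = ω.1 0 (vertex (f 0)) fun i => i.elim0 := rfl

theorem period_succ (k : ℕ) (f : Fin (k + 2) → Fin (m + 1)) (ω : SmoothForms m) :
    period (k + 1) f ω = period k (fun i => f i.succ) (coneOp (f 0) ω) := rfl

theorem period_pullOp {l : ℕ} (g : Fin (l + 1) → Fin (m + 1)) (k : ℕ) :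
    ∀ (f : Fin (k + 1) → Fin (l + 1)) (ω : SmoothForms m),
      period k f (pullOp g ω) = period k (fun i => g (f i)) ω := by
  induction k with
  | zero =>
    intro f ω
    rw [period_zero, period_zero, pullOp_val _ _ _ (vertex_mem _), vertexMap_vertex,
      ContinuousAlternatingMap.compContinuousLinearMap_apply]
    congr 1
    exact funext fun i => i.elim0
  | succ k ih =>
    intro f ω
    rw [period_succ, period_succ, ← pullOp_coneOp, ih]

theorem coneOp_congr (i : Fin (m + 1)) (k : ℕ) {ω η : SmoothForms m}
    (h : ∀ x ∈ simplexSet m, ω.1 (k + 1) x = η.1 (k + 1) x) {x : Tangent m}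
    (hx : x ∈ simplexSet m) : (coneOp i ω).1 k x = (coneOp i η).1 k x := by
  rw [coneOp_val _ _ _ hx, coneOp_val _ _ _ hx, rayIntegral_congr i k h hx]

theorem period_congr (k : ℕ) : ∀ (f : Fin (k + 1) → Fin (m + 1)) {ω η : SmoothForms m},
    (∀ x ∈ simplexSet m, ω.1 k x = η.1 k x) → period k f ω = period k f η := by
  induction k with
  | zero =>
    intro f ω η h
    rw [period_zero, period_zero, h _ (vertex_mem _)]
  | succ k ih =>
    intro f ω η h
    rw [period_succ, period_succ]
    exact ih _ fun x hx => coneOp_congr _ k h hx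

theorem period_eq_zero (k : ℕ) (f : Fin (k + 1) → Fin (m + 1)) {ω : SmoothForms m}
    (h : ∀ x ∈ simplexSet m, ω.1 k x = 0) : period k f ω = 0 := by
  rw [period_congr k f (η := 0) h, map_zero]

theorem coneOp_dOp (i : Fin (m + 1)) (ω : SmoothForms m) :
    coneOp i (dOp m ω) = ω - evalOp i ω - dOp m (coneOp i ω) := by
  have h : (dOp m * coneOp i + coneOp i * dOp m) ω = (1 - evalOp i) ω := by rw [dOp_coneOp_add]
  exact eq_sub_of_add_eq' h

/-- The Stokes formula for periods. -/
theorem period_dOp (k : ℕ) : ∀ (f : Fin (k + 2) → Fin (m + 1)) (ω : SmoothForms m),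
    period (k + 1) f (dOp m ω) =
      ∑ j : Fin (k + 2), (-1) ^ (j : ℕ) * period k (fun i => f (j.succAbove i)) ω := by
  induction k with
  | zero =>
    intro f ω
    rw [period_succ, coneOp_dOp, map_sub, map_sub, Fin.sum_univ_two]
    have h1 : period 0 (fun i => f i.succ) (dOp m (coneOp (f 0) ω)) = 0 :=
      period_eq_zero _ _ fun x _ => rfl
    have h2 : period 0 (fun i => f i.succ) (evalOp (f 0) ω) = period 0 (fun _ => f 0) ω := by
      rw [period_zero, period_zero, evalOp_zero_val _ _ (vertex_mem _)]
    have h3 : (fun i : Fin 1 => f ((1 : Fin 2).succAbove i)) = fun _ => f 0 := by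
      funext i
      rw [Subsingleton.elim i 0]
      rfl
    rw [h1, h2]
    simp only [h3, Fin.zero_succAbove]
    simp
    ring
  | succ k ih =>
    intro f ω
    -- In `h d = 1 - ε - d h` the `1` yields the face opposite `f 0`. The induction hypothesis for
    -- `h ω` yields the other faces, with indices shifted by one and hence the opposite sign.
    rw [period_succ, coneOp_dOp, map_sub, map_sub, ih, Fin.sum_univ_succ (n := k + 2)]
    have h2 : period (k + 1) (fun i => f i.succ) (evalOp (f 0) ω) = 0 :=
      period_eq_zero _ _ fun x _ => rfl
    rw [h2, sub_zero, sub_eq_add_neg, ← Finset.sum_neg_distrib]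
    congr 1
    · simp
    · refine Finset.sum_congr rfl fun j _ => ?_
      rw [period_succ, Fin.val_succ, pow_succ, mul_neg_one, neg_mul]
      simp only [Fin.succ_succAbove_zero, Fin.succ_succAbove_succ]

/-- Pulling back along `f` reduces to the tuples enumerating the vertices of the standard simplex of
dimension equal to the degree. There the form is exact in top degree, Stokes passes to the facets,
and `perm_succAbove` matches the signs. The induction is over all `m`, as facets are viewed inside
the larger simplex. -/
theorem period_perm (k : ℕ) : ∀ {m : ℕ} (f : Fin (k + 1) → Fin (m + 1))
    (π : Equiv.Perm (Fin (k + 1))) (ω : SmoothForms m),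
    period k (fun i => f (π i)) ω = ((Equiv.Perm.sign π : ℤ) : ℝ) * period k f ω := by
  induction k with
  | zero =>
    intro m f π ω
    have h : π = 1 := Equiv.ext fun x => Subsingleton.elim (α := Fin 1) _ _
    rw [h]
    simp
  | succ k ih =>
    intro m f π ω
    have key : ∀ (π : Equiv.Perm (Fin (k + 2))) (ω : SmoothForms (k + 1)),
        period (k + 1) π ω = ((Equiv.Perm.sign π : ℤ) : ℝ) * period (k + 1) id ω := by
      intro π ω
      -- Nothing lives above top degree, so the cone formula provides the primitive `coneOp 0 ω`.
      have hd : ∀ g : Fin (k + 2) → Fin (k + 2),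
          period (k + 1) g ω = period (k + 1) g (dOp (k + 1) (coneOp 0 ω)) := by
        intro g
        refine period_congr _ _ fun x hx => ?_
        have h1 : dOp (k + 1) (coneOp 0 ω) = ω - evalOp 0 ω - coneOp 0 (dOp (k + 1) ω) := by
          rw [coneOp_dOp, sub_sub_cancel]
        have h2 : (coneOp 0 (dOp (k + 1) ω)).1 (k + 1) x = 0 := by
          rw [coneOp_congr (η := 0) 0 (k + 1)
            (fun y _ => (alternating_eq_zero (Nat.lt_succ_self _) _).trans rfl) hx, map_zero]
          rfl
        rw [h1, SmoothForms.sub_val, SmoothForms.sub_val, h2, evalOp_succ_val, sub_zero, sub_zero]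
      rw [hd, hd, period_dOp, period_dOp,
        ← Equiv.sum_comp π (fun i => (-1) ^ (i : ℕ) * period k (fun j => id (i.succAbove j)) _),
        Finset.mul_sum]
      refine Finset.sum_congr rfl fun i _ => ?_
      obtain ⟨e, he, hs⟩ := perm_succAbove π i
      simp only [he, id]
      have h1 : ((-1 : ℝ) ^ (i : ℕ)) * (-1) ^ (i : ℕ) = 1 := by
        rw [← mul_pow]; simp
      rw [ih (fun j => (π i).succAbove j) e, hs]
      push_cast
      linear_combination ((-1 : ℝ) ^ (π i : ℕ) * ((Equiv.Perm.sign π : ℤ) : ℝ) *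
        period k (fun j => (π i).succAbove j) (coneOp 0 ω)) * h1
    rw [← period_pullOp f, key, period_pullOp]
    rfl

/-- Swapping two equal entries fixes the tuple but changes the sign of the period. -/
theorem period_of_not_injective (k : ℕ) (f : Fin (k + 1) → Fin (m + 1))
    (hf : ¬ Function.Injective f) (ω : SmoothForms m) : period k f ω = 0 := by
  simp only [Function.Injective, not_forall] at hf
  obtain ⟨a, b, hab, hne⟩ := hf
  have h := period_perm k f (Equiv.swap a b) ω
  have hfs : (fun i => f (Equiv.swap a b i)) = f := by
    funext i
    by_cases hia : i = a
    · rw [hia, Equiv.swap_apply_left, hab]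
    · by_cases hib : i = b
      · rw [hib, Equiv.swap_apply_right, hab]
      · rw [Equiv.swap_apply_of_ne_of_ne hia hib]
  rw [hfs, Equiv.Perm.sign_swap hne] at h
  push_cast at h
  linarith

end Periods

/-! ### Elementary forms -/

section Elementary

variable {m : ℕ}

/-- The degree `k` part of the constant function `1`. -/
def constFun (m : ℕ) : ∀ k : ℕ, Tangent m → Tangent m [⋀^Fin k]→L[ℝ] ℝ
  | 0 => (simplexSet m).indicator fun _ =>
      ContinuousAlternatingMap.constOfIsEmpty ℝ (Tangent m) (Fin 0) 1
  | _ + 1 => 0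

/-- The constant function `1`. -/
def constOne (m : ℕ) : SmoothForms m :=
  .mk (constFun m) fun k => match k with
    | 0 => .indicator contDiffOn_const
    | _ + 1 => .zero

theorem constOne_zero_val {x : Tangent m} (hx : x ∈ simplexSet m) :
    (constOne m).1 0 x = ContinuousAlternatingMap.constOfIsEmpty ℝ (Tangent m) (Fin 0) 1 := by
  rw [constOne, SmoothForms.mk_val, constFun, Set.indicator_of_mem hx]

theorem constOne_succ_val (k : ℕ) (x : Tangent m) : (constOne m).1 (k + 1) x = 0 := rfl

theorem pullOp_constOne {l : ℕ} (g : Fin (l + 1) → Fin (m + 1)) :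
    pullOp g (constOne m) = constOne l := by
  refine SmoothForms.ext_on fun k x hx => ?_
  rw [pullOp_val _ _ _ hx]
  rcases k with _ | k
  · rw [constOne_zero_val hx, constOne_zero_val (mapsTo_vertexMap g hx)]
    rfl
  · rw [constOne_succ_val, constOne_succ_val]
    rfl

theorem evalOp_eq_smul (i : Fin (m + 1)) (ω : SmoothForms m) :
    evalOp i ω = period 0 (fun _ => i) ω • constOne m := by
  refine SmoothForms.ext_on fun k x hx => ?_
  rw [SmoothForms.smul_val]
  rcases k with _ | k
  · rw [constOne_zero_val hx, evalOp_zero_val _ _ hx, period_zero]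
    ext v
    rw [ContinuousAlternatingMap.smul_apply, Subsingleton.elim v fun i => i.elim0]
    simp
  · rw [evalOp_succ_val, constOne_succ_val, smul_zero]

/-- The form `∑ c f • dt_{f 0} ∧ ⋯ ∧ dt_{f (k-1)}`. -/
def wedgeSum (m : ℕ) : ∀ k : ℕ, ((Fin k → Fin (m + 1)) → ℝ) →ₗ[ℝ] SmoothForms m
  | 0 => (LinearMap.proj (φ := fun _ : Fin 0 → Fin (m + 1) => ℝ) fun i => i.elim0).smulRight (constOne m)
  | k + 1 => ∑ i, wedgeOp i ∘ₗ wedgeSum m k ∘ₗ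
      LinearMap.funLeft ℝ ℝ fun f => (Fin.cons i f : Fin (k + 1) → Fin (m + 1))

/-- The form `∑ c f • t_{f 0} dt_{f 1} ∧ ⋯ ∧ dt_{f k}`. -/
def whitney (m k : ℕ) : ((Fin (k + 1) → Fin (m + 1)) → ℝ) →ₗ[ℝ] SmoothForms m :=
  ∑ i, mulOp i ∘ₗ wedgeSum m k ∘ₗ
    LinearMap.funLeft ℝ ℝ fun f => (Fin.cons i f : Fin (k + 1) → Fin (m + 1))

theorem wedgeSum_zero (c : (Fin 0 → Fin (m + 1)) → ℝ) :
    wedgeSum m 0 c = c (fun i => i.elim0) • constOne m := rfl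

theorem wedgeSum_succ (k : ℕ) (c : (Fin (k + 1) → Fin (m + 1)) → ℝ) :
    wedgeSum m (k + 1) c = ∑ i, wedgeOp i (wedgeSum m k fun f => c (Fin.cons i f)) := by
  rw [wedgeSum, LinearMap.sum_apply]
  rfl

theorem whitney_apply (k : ℕ) (c : (Fin (k + 1) → Fin (m + 1)) → ℝ) :
    whitney m k c = ∑ i, mulOp i (wedgeSum m k fun f => c (Fin.cons i f)) := by
  rw [whitney, LinearMap.sum_apply]
  rfl

theorem comp_cons {l k : ℕ} (g : Fin (l + 1) → Fin (m + 1)) (i : Fin (l + 1))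
    (f : Fin k → Fin (l + 1)) :
    (fun j => g ((Fin.cons i f : Fin (k + 1) → Fin (l + 1)) j)) =
      Fin.cons (g i) fun j => g (f j) := by
  funext j
  refine Fin.cases ?_ (fun j => ?_) j <;> simp

theorem pullOp_wedgeSum {l : ℕ} (g : Fin (l + 1) → Fin (m + 1)) (k : ℕ) :
    ∀ c : (Fin k → Fin (m + 1)) → ℝ,
      pullOp g (wedgeSum m k c) = wedgeSum l k fun f => c fun i => g (f i) := by
  induction k with
  | zero =>
    intro c
    rw [wedgeSum_zero, wedgeSum_zero, map_smul, pullOp_constOne]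
    congr 2
    exact funext fun i => i.elim0
  | succ k ih =>
    intro c
    rw [wedgeSum_succ, wedgeSum_succ, pullOp_sum_wedgeOp]
    simp only [ih, comp_cons]

theorem pullOp_whitney {l : ℕ} (g : Fin (l + 1) → Fin (m + 1)) (k : ℕ)
    (c : (Fin (k + 1) → Fin (m + 1)) → ℝ) :
    pullOp g (whitney m k c) = whitney l k fun f => c fun i => g (f i) := by
  rw [whitney_apply, whitney_apply, pullOp_sum_mulOp]
  simp only [pullOp_wedgeSum, comp_cons]

/-- The hypothesis is phrased through `k + 1 = j` so that `j = 0`, where nothing is required, needs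
no separate statement. -/
theorem wedgeOp_val_eq_zero (i : Fin (m + 1)) {ω : SmoothForms m} {j : ℕ}
    (h : ∀ k, k + 1 = j → ∀ x, ω.1 k x = 0) {x : Tangent m} (hx : x ∈ simplexSet m) :
    (wedgeOp i ω).1 j x = 0 := by
  rcases j with _ | j
  · exact wedgeOp_zero_val i ω x
  · rw [wedgeOp_succ_val _ _ _ hx, h j rfl x]
    have h0 : (coordCLM i).smulRight (0 : Tangent m [⋀^Fin j]→L[ℝ] ℝ) = 0 := by
      ext; simp
    rw [h0]
    exact map_zero (ContinuousAlternatingMap.alternatizeUncurryFinCLM ℝ (Tangent m) ℝ)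

theorem wedgeSum_val_eq_zero (k : ℕ) : ∀ (c : (Fin k → Fin (m + 1)) → ℝ) {j : ℕ}, j ≠ k →
    ∀ x, (wedgeSum m k c).1 j x = 0 := by
  induction k with
  | zero =>
    intro c j hj x
    obtain ⟨j, rfl⟩ := Nat.exists_eq_succ_of_ne_zero hj
    rw [wedgeSum_zero, SmoothForms.smul_val, Nat.succ_eq_add_one, constOne_succ_val, smul_zero]
  | succ k ih =>
    intro c j hj x
    by_cases hx : x ∈ simplexSet m
    · rw [wedgeSum_succ, SmoothForms.sum_val]
      refine Finset.sum_eq_zero fun i _ => wedgeOp_val_eq_zero i (fun l hl y => ih _ ?_ y) hx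
      rintro rfl
      exact hj hl.symm
    · exact ((wedgeSum m (k + 1) c).2 j).zero_outside x hx

theorem whitney_val_eq_zero (k : ℕ) (c : (Fin (k + 1) → Fin (m + 1)) → ℝ) {j : ℕ} (hj : j ≠ k)
    (x : Tangent m) : (whitney m k c).1 j x = 0 := by
  rw [whitney_apply, SmoothForms.sum_val]
  exact Finset.sum_eq_zero fun i _ => by
    rw [mulOp_val, wedgeSum_val_eq_zero k _ hj, smul_zero]

end Elementary

/-! ### The homotopy operator -/

section Homotopy

variable {m : ℕ}

theorem sandwich_apply (a h : Fin (m + 1) → Module.End ℝ (SmoothForms m))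
    (X : Module.End ℝ (SmoothForms m)) (ω : SmoothForms m) :
    sandwich a h X ω = ∑ i, a i (X (h i ω)) := by
  rw [sandwich, LinearMap.sum_apply]
  rfl

/-- Unwinding the sandwiches, the differentials accumulate on the left into `wedgeSum`, and the cone
operators on the right, ending in an evaluation, into a period. -/
theorem iterEval_apply (n : ℕ) : ∀ ω : SmoothForms m,
    iterEval wedgeOp coneOp evalOp n ω = wedgeSum m (n + 1) fun f => period n f ω := by
  induction n with
  | zero =>
    intro ω
    rw [iterEval, LinearMap.sum_apply, wedgeSum_succ]
    refine Finset.sum_congr rfl fun i _ => ?_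
    rw [Module.End.mul_apply, evalOp_eq_smul, wedgeSum_zero, period_zero, period_zero]
    rfl
  | succ n ih =>
    intro ω
    rw [iterEval, sandwich_apply, wedgeSum_succ]
    refine Finset.sum_congr rfl fun i _ => ?_
    rw [ih]
    rfl

theorem projTerm_apply (n : ℕ) (ω : SmoothForms m) :
    projTerm mulOp wedgeOp coneOp evalOp n ω = whitney m n fun f => period n f ω := by
  rw [whitney_apply]
  rcases n with _ | n
  · rw [projTerm, LinearMap.sum_apply]
    refine Finset.sum_congr rfl fun i _ => ?_
    rw [Module.End.mul_apply, evalOp_eq_smul, wedgeSum_zero, period_zero, period_zero]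
    rfl
  · rw [projTerm, sandwich_apply]
    refine Finset.sum_congr rfl fun i _ => ?_
    rw [iterEval_apply]
    rfl

/-- The homotopy operator between the identity and the projection onto elementary forms. -/
def homotopyOp (m N : ℕ) : Module.End ℝ (SmoothForms m) :=
  ∑ n ∈ Finset.range N, sandwich mulOp coneOp (iterHomotopy wedgeOp coneOp n)

theorem iterHomotopy_val_eq_zero (n : ℕ) : ∀ (ω : SmoothForms m) {j : ℕ}, j < n → ∀ x,
    (iterHomotopy wedgeOp coneOp n ω).1 j x = 0 := by
  induction n with
  | zero => exact fun ω j hj => absurd hj (Nat.not_lt_zero j)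
  | succ n ih =>
    intro ω j hj x
    by_cases hx : x ∈ simplexSet m
    · change (-(sandwich wedgeOp coneOp (iterHomotopy wedgeOp coneOp n) ω)).1 j x = 0
      rw [SmoothForms.neg_val, sandwich_apply, SmoothForms.sum_val, neg_eq_zero]
      exact Finset.sum_eq_zero fun i _ =>
        wedgeOp_val_eq_zero i (fun l hl y => ih _ (by omega) y) hx
    · exact ((iterHomotopy wedgeOp coneOp (n + 1) ω).2 j).zero_outside x hx

/-- Degrees below `N` are empty because `N` differentials have been wedged on; the remaining degrees
exceed the dimension. -/
theorem iterHomotopy_eq_zero {N : ℕ} (hN : m < N) :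
    iterHomotopy wedgeOp coneOp N = (0 : Module.End ℝ (SmoothForms m)) := by
  refine LinearMap.ext fun ω => SmoothForms.ext_on fun j x _ => ?_
  rcases lt_or_ge j N with hj | hj
  · exact iterHomotopy_val_eq_zero N ω hj x
  · exact (alternating_eq_zero (hN.trans_le hj) _).trans rfl

/-- The homotopy formula on a standard simplex. -/
theorem dOp_homotopyOp_add {N : ℕ} (hN : m < N) (ω : SmoothForms m) :
    dOp m (homotopyOp m N ω) + homotopyOp m N (dOp m ω) =
      ω - ∑ n ∈ Finset.range N, whitney m n fun f => period n f ω := by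
  have h := anticommute_sum (d := dOp m) (T := mulOp) (e := wedgeOp) (h := coneOp) (ε := evalOp)
    dOp_coneOp_add (fun _ => rfl) (sum_mulOp m) dOp_mul_wedgeOp (sum_wedgeOp m)
    coneOp_mul_evalOp N
  rw [iterHomotopy_eq_zero hN, sub_zero] at h
  have h2 := LinearMap.congr_fun h ω
  refine Eq.trans (by rfl) (h2.trans ?_)
  rw [LinearMap.sub_apply, LinearMap.sum_apply]
  simp only [projTerm_apply]
  rfl

theorem pullOp_sandwich {l : ℕ} (g : Fin (l + 1) → Fin (m + 1))
    {X : Module.End ℝ (SmoothForms m)} {Y : Module.End ℝ (SmoothForms l)}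
    (h : ∀ ω, pullOp g (X ω) = Y (pullOp g ω)) (ω : SmoothForms m) :
    pullOp g (sandwich wedgeOp coneOp X ω) = sandwich wedgeOp coneOp Y (pullOp g ω) ∧
      pullOp g (sandwich mulOp coneOp X ω) = sandwich mulOp coneOp Y (pullOp g ω) := by
  simp only [sandwich_apply, pullOp_sum_wedgeOp, pullOp_sum_mulOp, h, pullOp_coneOp, and_self]

theorem pullOp_iterHomotopy {l : ℕ} (g : Fin (l + 1) → Fin (m + 1)) (n : ℕ) :
    ∀ ω : SmoothForms m, pullOp g (iterHomotopy wedgeOp coneOp n ω) =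
      iterHomotopy wedgeOp coneOp n (pullOp g ω) := by
  induction n with
  | zero => exact fun ω => rfl
  | succ n ih =>
    intro ω
    change pullOp g (-(sandwich wedgeOp coneOp (iterHomotopy wedgeOp coneOp n) ω)) =
      -(sandwich wedgeOp coneOp (iterHomotopy wedgeOp coneOp n) (pullOp g ω))
    rw [map_neg, (pullOp_sandwich g ih ω).1]

theorem pullOp_homotopyOp {l : ℕ} (g : Fin (l + 1) → Fin (m + 1)) (N : ℕ) (ω : SmoothForms m) :
    pullOp g (homotopyOp m N ω) = homotopyOp l N (pullOp g ω) := by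
  rw [homotopyOp, homotopyOp, LinearMap.sum_apply, LinearMap.sum_apply, map_sum]
  exact Finset.sum_congr rfl fun n _ => (pullOp_sandwich g (pullOp_iterHomotopy g n) ω).2

end Homotopy

/-! ### Integration over the standard simplex in conical coordinates -/

theorem isCompact_cornerSimplex (k : ℕ) : IsCompact (cornerSimplex k) := by
  have hsub : cornerSimplex k ⊆ Set.Icc 0 1 := fun y hy =>
    ⟨fun i => hy.1 i, fun i =>
      (Finset.single_le_sum (fun j _ => hy.1 j) (Finset.mem_univ i)).trans hy.2⟩
  refine IsCompact.of_isClosed_subset isCompact_Icc ?_ hsub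
  have h1 : IsClosed {y : Fin k → ℝ | ∀ i, 0 ≤ y i} := by
    simp only [Set.ofPred_forall]
    exact isClosed_iInter fun i => isClosed_le continuous_const (continuous_apply i)
  exact h1.inter (isClosed_le (f := fun y : Fin k → ℝ => ∑ i, y i) (by fun_prop) continuous_const)

theorem measurableSet_cornerSimplex (k : ℕ) : MeasurableSet (cornerSimplex k) :=
  (isCompact_cornerSimplex k).measurableSet

/-- The point of the `(k+1)`-simplex at height `t` over the point `y` of the opposite face. -/
def conePoint {k : ℕ} (t : ℝ) (y : Fin k → ℝ) : Fin (k + 1) → ℝ :=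
  Fin.cons (t * (1 - ∑ i, y i)) (t • y)

theorem continuous_conePoint (k : ℕ) :
    Continuous fun p : ℝ × (Fin k → ℝ) => conePoint p.1 p.2 := by
  refine continuous_pi fun i => Fin.cases ?_ (fun i => ?_) i
  · simp only [conePoint, Fin.cons_zero]; fun_prop
  · simp only [conePoint, Fin.cons_succ, Pi.smul_apply]; fun_prop

theorem sum_conePoint {k : ℕ} (t : ℝ) (y : Fin k → ℝ) : ∑ i, conePoint t y i = t := by
  simp only [conePoint, Fin.sum_univ_succ, Fin.cons_zero, Fin.cons_succ, Pi.smul_apply,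
    smul_eq_mul, ← Finset.mul_sum]
  ring

theorem conePoint_mem {k : ℕ} {t : ℝ} (ht : t ∈ Set.Icc (0 : ℝ) 1) {y : Fin k → ℝ}
    (hy : y ∈ cornerSimplex k) : conePoint t y ∈ cornerSimplex (k + 1) := by
  refine ⟨fun i => Fin.cases ?_ (fun i => ?_) i, (sum_conePoint t y).trans_le ht.2⟩
  · exact mul_nonneg ht.1 (sub_nonneg.2 hy.2)
  · exact mul_nonneg ht.1 (hy.1 i)

theorem conePoint_mem_iff {k : ℕ} {t : ℝ} (ht : t ∈ Set.Ioc (0 : ℝ) 1) {y : Fin k → ℝ} :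
    conePoint t y ∈ cornerSimplex (k + 1) ↔ y ∈ cornerSimplex k := by
  refine ⟨fun h => ⟨fun i => ?_, ?_⟩, conePoint_mem ⟨ht.1.le, ht.2⟩⟩
  · exact nonneg_of_mul_nonneg_right (h.1 i.succ) ht.1
  · exact sub_nonneg.1 (nonneg_of_mul_nonneg_right (h.1 0) ht.1)

open MeasureTheory in
-- Conical coordinates, the height `t` being the sum of all coordinates. The change of variables is
-- split into Fubini, a translation of the first coordinate by `∑ y i`, an exchange of integrals,
-- the scaling of `y` by `t` with Jacobian `t ^ k`, and a second exchange.
theorem integral_cornerSimplex_succ {k : ℕ} {g : (Fin (k + 1) → ℝ) → ℝ}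
    (hg : ContinuousOn g (cornerSimplex (k + 1))) :
    ∫ z in cornerSimplex (k + 1), g z =
      ∫ y in cornerSimplex k, ∫ t in (0 : ℝ)..1, t ^ k * g (conePoint t y) := by
  set G : (Fin (k + 1) → ℝ) → ℝ := (cornerSimplex (k + 1)).indicator g with hG
  have hGint : Integrable G := by
    rw [hG, integrable_indicator_iff (measurableSet_cornerSimplex _)]
    exact hg.integrableOn_compact (isCompact_cornerSimplex _)
  have hmp := (volume_preserving_piFinSuccAbove (fun _ : Fin (k + 1) => ℝ) 0).symm
  have hcons : ∀ p : ℝ × (Fin k → ℝ), (MeasurableEquiv.piFinSuccAbove (fun _ : Fin (k + 1) => ℝ)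
      0).symm p = Fin.cons p.1 p.2 := fun p => by
    rw [MeasurableEquiv.piFinSuccAbove_symm_apply]
    simp [Fin.insertNthEquiv]
  have hGint' : Integrable (fun p : ℝ × (Fin k → ℝ) => G (Fin.cons p.1 p.2))
      (volume.prod volume) := by
    have h := hmp.integrable_comp_of_integrable hGint
    simp only [Function.comp_def, hcons] at h
    exact h
  have h1 : ∫ z in cornerSimplex (k + 1), g z =
      ∫ y : Fin k → ℝ, ∫ s : ℝ, G (Fin.cons s y) := by
    rw [← integral_indicator (measurableSet_cornerSimplex _), ← hmp.integral_comp']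
    simp only [hcons]
    exact integral_prod_symm _ hGint'
  -- The sheared simplex is a continuous image of the simplex. Its compactness gives the
  -- integrability needed for the first exchange.
  have hcompact : IsCompact {p : (Fin k → ℝ) × ℝ |
      (Fin.cons (p.2 - ∑ i, p.1 i) p.1 : Fin (k + 1) → ℝ) ∈ cornerSimplex (k + 1)} := by
    have himg : {p : (Fin k → ℝ) × ℝ |
        (Fin.cons (p.2 - ∑ i, p.1 i) p.1 : Fin (k + 1) → ℝ) ∈ cornerSimplex (k + 1)} =
        (fun z : Fin (k + 1) → ℝ => ((fun i => z i.succ, ∑ i, z i) : (Fin k → ℝ) × ℝ)) ''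
          cornerSimplex (k + 1) := by
      ext p
      constructor
      · intro hp
        refine ⟨_, hp, Prod.ext ?_ ?_⟩
        · simp
        · simp [Fin.sum_univ_succ]
      · rintro ⟨z, hz, rfl⟩
        have : (Fin.cons (∑ i, z i - ∑ i : Fin k, z i.succ) fun i => z i.succ :
            Fin (k + 1) → ℝ) = z := by
          funext i
          refine Fin.cases ?_ (fun i => ?_) i <;> simp [Fin.sum_univ_succ]
        simpa only [Set.mem_ofPred_eq, this] using hz
    rw [himg]
    exact (isCompact_cornerSimplex _).image (by fun_prop)
  have hcont : Continuous fun p : (Fin k → ℝ) × ℝ =>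
      (Fin.cons (p.2 - ∑ i, p.1 i) p.1 : Fin (k + 1) → ℝ) := by
    refine continuous_pi fun i => Fin.cases ?_ (fun i => ?_) i
    · simp only [Fin.cons_zero]; fun_prop
    · simp only [Fin.cons_succ]; fun_prop
  have hHint : Integrable (Function.uncurry fun (y : Fin k → ℝ) (t : ℝ) =>
      G (Fin.cons (t - ∑ i, y i) y)) (volume.prod volume) := by
    have h := (hg.comp hcont.continuousOn (fun p hp => hp)).integrableOn_compact
      (μ := volume.prod volume) hcompact
    rw [← integrable_indicator_iff hcompact.measurableSet] at h
    exact h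
  have h2 : ∀ y : Fin k → ℝ, ∫ s : ℝ, G (Fin.cons s y) =
      ∫ t : ℝ, G (Fin.cons (t - ∑ i, y i) y) := fun y =>
    (integral_sub_right_eq_self (fun s => G (Fin.cons s y)) _).symm
  rw [h1, integral_congr_ae (Filter.Eventually.of_forall h2), integral_integral_swap hHint]
  have h3 : ∀ t ∈ Set.Ioc (0 : ℝ) 1, ∫ y : Fin k → ℝ, G (Fin.cons (t - ∑ i, y i) y) =
      ∫ y in cornerSimplex k, t ^ k * g (conePoint t y) := by
    intro t ht
    have h4 := Measure.integral_comp_smul volume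
      (fun y : Fin k → ℝ => G (Fin.cons (t - ∑ i, y i) y)) t
    have htk : 0 < t ^ k := pow_pos ht.1 k
    rw [Module.finrank_fin_fun, abs_of_pos (inv_pos.2 htk), smul_eq_mul] at h4
    have h5 : ∀ y : Fin k → ℝ, G (Fin.cons (t - ∑ i, (t • y) i) (t • y)) =
        (cornerSimplex k).indicator (fun y => g (conePoint t y)) y := by
      intro y
      have h6 : (Fin.cons (t - ∑ i, (t • y) i) (t • y) : Fin (k + 1) → ℝ) = conePoint t y := by
        simp only [conePoint, Pi.smul_apply, smul_eq_mul, ← Finset.mul_sum, mul_sub, mul_one]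
      rw [h6, hG]
      by_cases hy : y ∈ cornerSimplex k
      · rw [Set.indicator_of_mem hy, Set.indicator_of_mem ((conePoint_mem_iff ht).2 hy)]
      · rw [Set.indicator_of_notMem hy,
          Set.indicator_of_notMem fun h => hy ((conePoint_mem_iff ht).1 h)]
    rw [integral_congr_ae (Filter.Eventually.of_forall h5),
      integral_indicator (measurableSet_cornerSimplex k)] at h4
    rw [integral_const_mul, h4, mul_inv_cancel_left₀ htk.ne']
  have h7 : ∀ t ∉ Set.Icc (0 : ℝ) 1, ∫ y : Fin k → ℝ, G (Fin.cons (t - ∑ i, y i) y) = 0 := by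
    intro t ht
    have h8 : ∀ y : Fin k → ℝ, G (Fin.cons (t - ∑ i, y i) y) = 0 := by
      intro y
      refine Set.indicator_of_notMem (fun h => ht ?_) _
      have hs : ∑ i, (Fin.cons (t - ∑ i, y i) y : Fin (k + 1) → ℝ) i = t := by
        simp [Fin.sum_univ_succ]
      exact ⟨hs ▸ Finset.sum_nonneg fun i _ => h.1 i, hs ▸ h.2⟩
    simp [h8]
  rw [← setIntegral_eq_integral_of_forall_compl_eq_zero h7, integral_Icc_eq_integral_Ioc,
    setIntegral_congr_fun measurableSet_Ioc h3]
  simp only [intervalIntegral.integral_of_le zero_le_one]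
  refine integral_integral_swap ?_
  rw [Measure.prod_restrict]
  have hc : ContinuousOn (Function.uncurry fun (t : ℝ) (y : Fin k → ℝ) =>
      t ^ k * g (conePoint t y)) (Set.Icc (0 : ℝ) 1 ×ˢ cornerSimplex k) := by
    refine ContinuousOn.mul (by fun_prop) ?_
    exact hg.comp (continuous_conePoint k).continuousOn fun p hp => conePoint_mem hp.1 hp.2
  exact (hc.integrableOn_compact (isCompact_Icc.prod (isCompact_cornerSimplex k))).mono_set
    (Set.prod_mono Set.Ioc_subset_Icc_self le_rfl)

/-! ### The integral as a period -/

theorem baryCoord_cornerMap_zero {k : ℕ} (y : Fin k → ℝ) :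
    baryCoord (cornerMap y) 0 = 1 - ∑ i, y i := by
  rw [cornerMap, baryCoord_ofBary, Fin.cons_zero]

theorem baryCoord_cornerMap_succ {k : ℕ} (y : Fin k → ℝ) (i : Fin k) :
    baryCoord (cornerMap y) i.succ = y i := by
  rw [cornerMap, baryCoord_ofBary, Fin.cons_succ]

theorem cornerMap_mem {k : ℕ} {y : Fin k → ℝ} (hy : y ∈ cornerSimplex k) :
    cornerMap y ∈ simplexSet k := by
  refine mem_simplexSet.2 fun i => Fin.cases ?_ (fun i => ?_) i
  · rw [baryCoord_cornerMap_zero]; exact sub_nonneg.2 hy.2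
  · rw [baryCoord_cornerMap_succ]; exact hy.1 i

theorem continuous_cornerMap (k : ℕ) : Continuous (cornerMap : (Fin k → ℝ) → Tangent k) := by
  refine Continuous.subtype_mk (p := fun v => v ∈ sumZero k) ?_ _
  refine (PiLp.continuous_toLp 2 _).comp (continuous_pi fun i => ?_)
  refine Continuous.sub ?_ continuous_const
  refine Fin.cases ?_ (fun i => ?_) i
  · simp only [Fin.cons_zero]; fun_prop
  · simp only [Fin.cons_succ]; fun_prop

theorem coord_edgeVector {k : ℕ} (i : Fin k) (j : Fin (k + 1)) :
    coord (edgeVector i) j = (if j = i.succ then 1 else 0) - if j = 0 then 1 else 0 := by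
  rw [edgeVector, coord_ofCoord, Pi.sub_apply, Pi.single_apply, Pi.single_apply]

theorem vertexLin_succ_edgeVector {k : ℕ} (i : Fin k) :
    vertexLin (Fin.succ : Fin (k + 1) → Fin (k + 2)) (edgeVector i) =
      edgeVector i.succ - edgeVector 0 := by
  refine tangent_ext fun j => ?_
  have h : coord (edgeVector i.succ - edgeVector (0 : Fin (k + 1))) j =
      coord (edgeVector i.succ) j - coord (edgeVector (0 : Fin (k + 1))) j := rfl
  rw [h, coord_vertexLin]
  simp only [coord_edgeVector]
  refine Fin.cases ?_ (fun j => ?_) j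
  · have h0 : ∀ l : Fin (k + 1), l.succ ≠ 0 := Fin.succ_ne_zero
    simp [h0, (h0 _).symm]
  · simp only [Fin.succ_inj, Fin.succ_ne_zero, Finset.sum_ite_eq', Finset.mem_univ, if_true,
      if_false, sub_zero]

theorem coord_sum {m : ℕ} {ι : Type*} (s : Finset ι) (v : ι → Tangent m) (j : Fin (m + 1)) :
    coord (∑ i ∈ s, v i) j = ∑ i ∈ s, coord (v i) j :=
  map_sum (coordCLM j) v s

/-- The radial vector is one edge plus a combination of edges of the opposite face, which is the
shape required by `alternating_shear`. -/
theorem vertexMap_succ_cornerMap_sub {k : ℕ} (y : Fin k → ℝ) :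
    vertexMap (Fin.succ : Fin (k + 1) → Fin (k + 2)) (cornerMap y) - vertex 0 =
      edgeVector 0 + ∑ i, y i • (edgeVector i.succ - edgeVector 0) := by
  refine tangent_ext fun j => ?_
  have h : ∀ i : Fin k, coord (edgeVector i.succ - edgeVector (0 : Fin (k + 1))) j =
      coord (edgeVector i.succ) j - coord (edgeVector (0 : Fin (k + 1))) j := fun i => rfl
  rw [coord_sub, coord_add, coord_sum, baryCoord_vertexMap, baryCoord_vertex]
  simp only [coord_smul, h, coord_edgeVector]
  refine Fin.cases ?_ (fun j => ?_) j
  · have h0 : ∀ l : Fin (k + 1), l.succ ≠ 0 := Fin.succ_ne_zero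
    simp [h0, (h0 _).symm]
  · simp only [Fin.succ_inj, Fin.succ_ne_zero, Finset.sum_ite_eq', Finset.mem_univ, if_true,
      if_false, sub_zero]
    refine Fin.cases ?_ (fun j => ?_) j
    · simp [baryCoord_cornerMap_zero, (Fin.succ_ne_zero _).symm, sub_eq_add_neg]
    · simp [baryCoord_cornerMap_succ, Fin.succ_inj, Fin.succ_ne_zero]

theorem vertex_ray_cornerMap {k : ℕ} (t : ℝ) (y : Fin k → ℝ) :
    vertex 0 + t • (vertexMap (Fin.succ : Fin (k + 1) → Fin (k + 2)) (cornerMap y) - vertex 0) =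
      cornerMap (conePoint t y) := by
  refine bary_ext fun j => ?_
  have h : baryCoord (vertex 0 + t • (vertexMap (Fin.succ : Fin (k + 1) → Fin (k + 2))
      (cornerMap y) - vertex 0)) j = baryCoord (vertex 0) j +
        t * (baryCoord (vertexMap Fin.succ (cornerMap y)) j - baryCoord (vertex 0) j) := by
    rw [← coord_sub, baryCoord, baryCoord, coord_add, coord_smul]
    ring
  rw [h, baryCoord_vertexMap, baryCoord_vertex]
  refine Fin.cases ?_ (fun j => ?_) j
  · rw [baryCoord_cornerMap_zero, sum_conePoint]
    simp [Fin.succ_ne_zero, sub_eq_add_neg]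
  · rw [baryCoord_cornerMap_succ]
    simp only [Fin.succ_inj, Fin.succ_ne_zero, Finset.sum_ite_eq', Finset.mem_univ, if_true,
      if_false, sub_zero, zero_add]
    refine Fin.cases ?_ (fun j => ?_) j
    · rw [baryCoord_cornerMap_zero, conePoint, Fin.cons_zero]
    · rw [baryCoord_cornerMap_succ, conePoint, Fin.cons_succ]
      rfl

/-- Adding multiples of one argument to the other ones does not change the value of an
alternating map. -/
theorem alternating_shear {m k : ℕ} (β : Tangent m [⋀^Fin (k + 1)]→L[ℝ] ℝ)
    (a : Fin (k + 1) → Tangent m) (y : Fin k → ℝ) :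
    β (Matrix.vecCons (a 0 + ∑ i, y i • (a i.succ - a 0)) fun i => a i.succ - a 0) = β a := by
  have h1 : β (Matrix.vecCons (a 0 + ∑ i, y i • (a i.succ - a 0)) fun i => a i.succ - a 0) =
      β (Matrix.vecCons (a 0) fun i => a i.succ - a 0) := by
    rw [← ContinuousAlternatingMap.curryLeft_apply_apply, map_add, map_sum]
    rw [ContinuousAlternatingMap.add_apply, ContinuousAlternatingMap.sum_apply,
      Finset.sum_eq_zero, add_zero, ContinuousAlternatingMap.curryLeft_apply_apply]
    intro i _
    rw [map_smul, ContinuousAlternatingMap.smul_apply,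
      ContinuousAlternatingMap.curryLeft_apply_apply,
      β.map_eq_zero_of_eq _ (i := 0) (j := i.succ) (by simp) (Fin.succ_ne_zero i).symm, smul_zero]
  rw [h1, ← ContinuousAlternatingMap.curryLeft_apply_apply]
  have h2 : (fun i : Fin k => a i.succ - a 0) = (fun i => a i.succ) + fun _ => -a 0 := by
    funext i
    exact sub_eq_add_neg _ _
  -- In the multilinear expansion every summand that uses some `-a 0` repeats the first argument and
  -- vanishes.
  rw [h2, ContinuousAlternatingMap.map_add_univ, Finset.sum_eq_single Finset.univ]
  · rw [Finset.piecewise_univ, ContinuousAlternatingMap.curryLeft_apply_apply]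
    congr 1
    exact Matrix.cons_head_tail a
  · intro s _ hs
    obtain ⟨i, hi⟩ : ∃ i, i ∉ s := by
      by_contra! h
      exact hs (Finset.eq_univ_iff_forall.2 h)
    have h3 : (s.piecewise (fun i : Fin k => a i.succ) fun _ => -a 0) =
        Function.update (s.piecewise (fun i : Fin k => a i.succ) fun _ => -a 0) i
          ((-1 : ℝ) • a 0) := by
      rw [neg_one_smul]
      exact (Function.update_eq_self_iff.2 (Finset.piecewise_eq_of_notMem s _ _ hi).symm).symm
    rw [h3, ContinuousAlternatingMap.map_update_smul,
      ContinuousAlternatingMap.curryLeft_apply_apply,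
      β.map_eq_zero_of_eq _ (i := 0) (j := i.succ) (by simp) (Fin.succ_ne_zero i).symm, smul_zero]
  · exact fun h => absurd (Finset.mem_univ _) h

/-- The inner integral in conical coordinates is the ray integral from vertex `0`: the Jacobian `t ^
k` is exactly the weight in the cone operator, and shearing replaces the edge vectors by the radial
vector and the edges of the opposite face. -/
theorem integral_succ {k : ℕ} (ω : SmoothForms (k + 1)) :
    integral (ω.1 (k + 1)) = integral ((pullOp Fin.succ (coneOp 0 ω)).1 k) := by
  have hg : ContinuousOn (fun z => ω.1 (k + 1) (cornerMap z) edgeVector)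
      (cornerSimplex (k + 1)) := by
    have h := (ω.2 (k + 1)).smooth.continuousOn.comp (continuous_cornerMap (k + 1)).continuousOn
      fun z hz => cornerMap_mem hz
    exact (ContinuousAlternatingMap.apply ℝ (Tangent (k + 1)) ℝ
      edgeVector).continuous.comp_continuousOn h
  rw [integral, integral_cornerSimplex_succ hg, integral]
  refine MeasureTheory.setIntegral_congr_fun (measurableSet_cornerSimplex k) fun y hy => ?_
  have hy' := cornerMap_mem hy
  have hX := mapsTo_vertexMap (Fin.succ : Fin (k + 1) → Fin (k + 2)) hy'
  rw [pullOp_val _ _ _ hy', coneOp_val _ _ _ hX,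
    ContinuousAlternatingMap.compContinuousLinearMap_apply,
    ContinuousAlternatingMap.curryLeft_apply_apply, vertexMap_succ_cornerMap_sub]
  have h1 : (⇑(vertexLin (Fin.succ : Fin (k + 1) → Fin (k + 2))) ∘ edgeVector) =
      fun i => edgeVector i.succ - edgeVector 0 := funext vertexLin_succ_edgeVector
  rw [h1, alternating_shear]
  have h2 := ContinuousLinearMap.intervalIntegral_comp_comm (𝕜 := ℝ)
    (E := Tangent (k + 1) [⋀^Fin (k + 1)]→L[ℝ] ℝ) (F := ℝ)
    (ContinuousAlternatingMap.apply ℝ (Tangent (k + 1)) ℝ edgeVector)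
    (intervalIntegrable_ray_form 0 k (ω.2 (k + 1)) hX)
  refine Eq.trans ?_ h2
  refine intervalIntegral.integral_congr fun t _ => ?_
  simp only [map_smul, smul_eq_mul, vertex_ray_cornerMap]
  rfl

theorem integral_eq_period (k : ℕ) : ∀ ω : SmoothForms k, integral (ω.1 k) = period k id ω := by
  induction k with
  | zero =>
    intro ω
    have h1 : cornerSimplex 0 = Set.univ := Set.eq_univ_of_forall fun y => ⟨fun i => i.elim0, by simp⟩
    have h2 : ∀ y : Fin 0 → ℝ, ω.1 0 (cornerMap y) edgeVector = period 0 id ω := fun y => by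
      rw [period_zero]
      have h3 : (cornerMap y : Tangent 0) = vertex 0 := bary_ext fun i => by
        rw [Subsingleton.elim (α := Fin 1) i 0, baryCoord_cornerMap_zero, baryCoord_vertex]
        simp
      rw [h3]
      congr 1
      exact funext fun i => i.elim0
    rw [integral, h1, MeasureTheory.Measure.restrict_univ]
    simp only [h2]
    -- The parameter domain is one point, and Lebesgue measure on `Fin 0 → ℝ` gives it mass `1`.
    rw [MeasureTheory.integral_const, MeasureTheory.Measure.real,
      MeasureTheory.Measure.volume_pi_eq_dirac (x := fun i : Fin 0 => i.elim0)]
    simp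
  | succ k ih =>
    intro ω
    rw [integral_succ, ih, period_pullOp, period_succ]
    rfl

/-! ### Bounded operators -/

section Bounds

variable {m : ℕ}

/-- The components of `ω` in degrees at most `k` are bounded by `M`. -/
def SmoothForms.BoundedBy (ω : SmoothForms m) (k : ℕ) (M : ℝ) : Prop :=
  ∀ j ≤ k, ∀ x ∈ simplexSet m, ‖ω.1 j x‖ ≤ M

namespace SmoothForms.BoundedBy

variable {ω η : SmoothForms m} {k l : ℕ} {M M' : ℝ}

theorem nonneg (h : ω.BoundedBy k M) : 0 ≤ M :=
  (norm_nonneg _).trans (h 0 (Nat.zero_le k) _ (vertex_mem 0))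

theorem mono (h : ω.BoundedBy k M) (hl : l ≤ k) (hM : M ≤ M') : ω.BoundedBy l M' :=
  fun j hj x hx => (h j (hj.trans hl) x hx).trans hM

theorem add (hω : ω.BoundedBy k M) (hη : η.BoundedBy k M') : (ω + η).BoundedBy k (M + M') :=
  fun j hj x hx => (norm_add_le _ _).trans (add_le_add (hω j hj x hx) (hη j hj x hx))

theorem neg (hω : ω.BoundedBy k M) : (-ω).BoundedBy k M :=
  fun j hj x hx => (norm_neg (ω.1 j x)).trans_le (hω j hj x hx)

theorem sub (hω : ω.BoundedBy k M) (hη : η.BoundedBy k M') : (ω - η).BoundedBy k (M + M') := by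
  rw [sub_eq_add_neg]
  exact hω.add hη.neg

theorem smul (c : ℝ) (hω : ω.BoundedBy k M) : (c • ω).BoundedBy k (|c| * M) :=
  fun j hj x hx => (norm_smul c (ω.1 j x)).trans_le
    (mul_le_mul_of_nonneg_left (hω j hj x hx) (abs_nonneg c))

theorem zero : (0 : SmoothForms m).BoundedBy k 0 := fun j _ x _ => by
  rw [SmoothForms.zero_val, norm_zero]

theorem sum {ι : Type*} (s : Finset ι) {ω : ι → SmoothForms m} {M : ι → ℝ}
    (h : ∀ i ∈ s, (ω i).BoundedBy k (M i)) : (∑ i ∈ s, ω i).BoundedBy k (∑ i ∈ s, M i) := by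
  classical
  induction s using Finset.induction_on with
  | empty => exact zero
  | insert a s ha ih =>
    rw [Finset.sum_insert ha, Finset.sum_insert ha]
    exact (h a (Finset.mem_insert_self a s)).add
      (ih fun i hi => h i (Finset.mem_insert_of_mem hi))

end SmoothForms.BoundedBy

theorem SmoothForms.exists_boundedBy (ω : SmoothForms m) (k : ℕ) : ∃ M, ω.BoundedBy k M := by
  have h : ∀ j, ∃ M, 0 ≤ M ∧ ∀ x ∈ simplexSet m, ‖ω.1 j x‖ ≤ M := fun j => by
    obtain ⟨M, hM⟩ := (isCompact_simplexSet m).exists_bound_of_continuousOn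
      (ω.2 j).smooth.continuousOn
    exact ⟨M, (norm_nonneg _).trans (hM _ (vertex_mem 0)), hM⟩
  choose M hM0 hM using h
  exact ⟨∑ j ∈ Finset.range (k + 1), M j, fun j hj x hx => (hM j x hx).trans
    (Finset.single_le_sum (fun i _ => hM0 i) (Finset.mem_range_succ_iff.2 hj))⟩

/-- Operators that are bounded for the supremum norms of the components. -/
def IsBoundedOp (X : Module.End ℝ (SmoothForms m)) : Prop :=
  ∀ k, ∃ (l : ℕ) (C : ℝ), 0 ≤ C ∧ ∀ (ω : SmoothForms m) (M : ℝ),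
    ω.BoundedBy l M → (X ω).BoundedBy k (C * M)

namespace IsBoundedOp

variable {X Y : Module.End ℝ (SmoothForms m)}

theorem one : IsBoundedOp (1 : Module.End ℝ (SmoothForms m)) := fun k =>
  ⟨k, 1, zero_le_one, fun ω M h => by rw [one_mul]; exact h⟩

theorem zero : IsBoundedOp (0 : Module.End ℝ (SmoothForms m)) := fun k =>
  ⟨k, 0, le_rfl, fun ω M _ => by rw [zero_mul]; exact .zero⟩

theorem mul (hX : IsBoundedOp X) (hY : IsBoundedOp Y) : IsBoundedOp (X * Y) := fun k => by
  obtain ⟨l, C, hC, h⟩ := hX k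
  obtain ⟨l', C', hC', h'⟩ := hY l
  refine ⟨l', C * C', mul_nonneg hC hC', fun ω M hω => ?_⟩
  rw [mul_assoc]
  exact h _ _ (h' _ _ hω)

theorem add (hX : IsBoundedOp X) (hY : IsBoundedOp Y) : IsBoundedOp (X + Y) := fun k => by
  obtain ⟨l, C, hC, h⟩ := hX k
  obtain ⟨l', C', hC', h'⟩ := hY k
  refine ⟨max l l', C + C', add_nonneg hC hC', fun ω M hω => ?_⟩
  rw [add_mul]
  exact (h _ _ (hω.mono (le_max_left _ _) le_rfl)).add
    (h' _ _ (hω.mono (le_max_right _ _) le_rfl))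

theorem neg (hX : IsBoundedOp X) : IsBoundedOp (-X) := fun k => by
  obtain ⟨l, C, hC, h⟩ := hX k
  exact ⟨l, C, hC, fun ω M hω => (h ω M hω).neg⟩

theorem sum {ι : Type*} (s : Finset ι) {X : ι → Module.End ℝ (SmoothForms m)}
    (h : ∀ i ∈ s, IsBoundedOp (X i)) : IsBoundedOp (∑ i ∈ s, X i) := by
  classical
  induction s using Finset.induction_on with
  | empty => exact zero
  | insert a s ha ih =>
    rw [Finset.sum_insert ha]
    exact (h a (Finset.mem_insert_self a s)).add
      (ih fun i hi => h i (Finset.mem_insert_of_mem hi))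

theorem mulOp (i : Fin (m + 1)) : IsBoundedOp (mulOp i) := fun k =>
  ⟨k, 1, zero_le_one, fun ω M hω j hj x hx => by
    have h0 := mem_simplexSet.1 hx
    have h1 : baryCoord x i ≤ 1 :=
      (Finset.single_le_sum (fun j _ => h0 j) (Finset.mem_univ i)).trans (sum_baryCoord x).le
    rw [mulOp_val, norm_smul, Real.norm_of_nonneg (h0 i)]
    exact mul_le_mul h1 (hω j hj x hx) (norm_nonneg _) zero_le_one⟩

theorem wedgeOp (i : Fin (m + 1)) : IsBoundedOp (wedgeOp i) := fun k =>
  ⟨k, (k + 1) * ‖coordCLM i‖, by positivity, fun ω M hω j hj x hx => by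
    rcases j with _ | j
    · rw [wedgeOp_zero_val, norm_zero]
      have := hω.nonneg
      positivity
    · rw [wedgeOp_succ_val _ _ _ hx]
      refine (ContinuousAlternatingMap.norm_alternatizeUncurryFin_le _).trans ?_
      have h1 : ‖(coordCLM i).smulRight (ω.1 j x)‖ ≤ ‖coordCLM i‖ * M := by
        refine ContinuousLinearMap.opNorm_le_bound _ (mul_nonneg (norm_nonneg _) hω.nonneg)
          fun v => ?_
        rw [ContinuousLinearMap.smulRight_apply, norm_smul]
        calc ‖coordCLM i v‖ * ‖ω.1 j x‖ ≤ (‖coordCLM i‖ * ‖v‖) * M :=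
              mul_le_mul ((coordCLM i).le_opNorm v) (hω j (by omega) x hx) (norm_nonneg _)
                (by positivity)
          _ = _ := by ring
      have h2 : (j : ℝ) + 1 ≤ k + 1 := by
        have : (j : ℝ) ≤ k := by exact_mod_cast (Nat.le_succ j).trans hj
        linarith
      rw [mul_assoc]
      exact mul_le_mul h2 h1 (by positivity) (by positivity)⟩

/-- The constant bounds the distance to the vertex. Since the operator lowers degrees, output up to
degree `k` needs input up to `k + 1`; hence the auxiliary degree in `IsBoundedOp`. -/
theorem coneOp (i : Fin (m + 1)) : IsBoundedOp (coneOp i) := fun k => by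
  obtain ⟨R, hR⟩ := (isCompact_simplexSet m).exists_bound_of_continuousOn
    (f := fun x => x - vertex i) (by fun_prop)
  have hR0 : 0 ≤ R := (norm_nonneg _).trans (hR _ (vertex_mem 0))
  refine ⟨k + 1, R, hR0, fun ω M hω j hj x hx => ?_⟩
  rw [coneOp_val _ _ _ hx]
  have h1 := norm_rayIntegral_le (convex_simplexSet m) (vertex_mem i) hx j
    (hω (j + 1) (Nat.succ_le_succ hj))
  refine (ContinuousLinearMap.le_opNorm _ _).trans ?_
  rw [ContinuousAlternatingMap.norm_curryLeft, mul_comm]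
  exact mul_le_mul (hR x hx) h1 (norm_nonneg _) hR0

theorem sandwich {a h : Fin (m + 1) → Module.End ℝ (SmoothForms m)} (ha : ∀ i, IsBoundedOp (a i))
    (hh : ∀ i, IsBoundedOp (h i)) (hX : IsBoundedOp X) : IsBoundedOp (sandwich a h X) :=
  sum _ fun i _ => ((ha i).mul hX).mul (hh i)

theorem iterHomotopy (n : ℕ) : IsBoundedOp (m := m)
    (iterHomotopy LpDeRham.wedgeOp LpDeRham.coneOp n) := by
  induction n with
  | zero => exact one
  | succ n ih => exact (sandwich wedgeOp coneOp ih).neg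

theorem homotopyOp (N : ℕ) : IsBoundedOp (homotopyOp m N) :=
  sum _ fun n _ => sandwich mulOp coneOp (iterHomotopy n)

end IsBoundedOp

/-! ### Bounds for periods, elementary forms and the homotopy. -/

theorem exists_period_bound (k : ℕ) : ∀ f : Fin (k + 1) → Fin (m + 1), ∃ (l : ℕ) (C : ℝ), 0 ≤ C ∧
    ∀ (ω : SmoothForms m) (M : ℝ), ω.BoundedBy l M → |period k f ω| ≤ C * M := by
  induction k with
  | zero =>
    refine fun f => ⟨0, 1, zero_le_one, fun ω M hω => ?_⟩
    rw [period_zero, ← Real.norm_eq_abs, one_mul]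
    refine ((ω.1 0 (vertex (f 0))).le_opNorm _).trans ?_
    simpa using hω 0 le_rfl _ (vertex_mem (f 0))
  | succ k ih =>
    intro f
    obtain ⟨l, C, hC, h⟩ := ih fun i => f i.succ
    obtain ⟨l', C', hC', h'⟩ := IsBoundedOp.coneOp (f 0) l
    refine ⟨l', C * C', mul_nonneg hC hC', fun ω M hω => ?_⟩
    rw [period_succ, mul_assoc]
    exact h _ _ (h' _ _ hω)

/-- The source is finite-dimensional, so it suffices to bound the images of the basis vectors, which
are continuous on a compact simplex. -/
theorem exists_bound_of_linearMap {ι : Type*} [Fintype ι] (L : (ι → ℝ) →ₗ[ℝ] SmoothForms m)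
    (k : ℕ) : ∃ C, 0 ≤ C ∧ ∀ c, (L c).BoundedBy k (C * ∑ i, |c i|) := by
  classical
  have h : ∀ i : ι, ∃ M, (L (Pi.single i 1)).BoundedBy k M := fun i =>
    SmoothForms.exists_boundedBy _ k
  choose M hM using h
  refine ⟨∑ i, M i, Finset.sum_nonneg fun i _ => (hM i).nonneg, fun c => ?_⟩
  rw [LinearMap.pi_apply_eq_sum_univ L c]
  have h1 : ∀ i : ι, (fun j : ι => if i = j then (1 : ℝ) else 0) = Pi.single i 1 := fun i => by
    funext j
    rw [Pi.single_apply]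
    simp only [eq_comm]
  simp only [h1]
  refine (SmoothForms.BoundedBy.sum _ fun i _ => (hM i).smul (c i)).mono le_rfl ?_
  rw [Finset.mul_sum]
  refine Finset.sum_le_sum fun i _ => ?_
  rw [mul_comm]
  exact mul_le_mul_of_nonneg_right
    (Finset.single_le_sum (fun j _ => (hM j).nonneg) (Finset.mem_univ i)) (abs_nonneg _)

theorem exists_whitney_bound (k : ℕ) : ∃ C, 0 ≤ C ∧ ∀ c : (Fin (k + 1) → Fin (m + 1)) → ℝ,
    (whitney m k c).BoundedBy k (C * ∑ f, |c f|) ∧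
      (dOp m (whitney m k c)).BoundedBy (k + 1) (C * ∑ f, |c f|) := by
  obtain ⟨C, hC, h⟩ := exists_bound_of_linearMap (whitney m k) k
  obtain ⟨C', hC', h'⟩ := exists_bound_of_linearMap (dOp m ∘ₗ whitney m k) (k + 1)
  have h0 : ∀ c : (Fin (k + 1) → Fin (m + 1)) → ℝ, 0 ≤ ∑ f, |c f| := fun c =>
    Finset.sum_nonneg fun f _ => abs_nonneg _
  exact ⟨C + C', add_nonneg hC hC', fun c =>
    ⟨(h c).mono le_rfl (mul_le_mul_of_nonneg_right (le_add_of_nonneg_right hC') (h0 c)),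
      (h' c).mono le_rfl (mul_le_mul_of_nonneg_right (le_add_of_nonneg_left hC) (h0 c))⟩⟩

/-- The derivative of `s ω` is never estimated directly: `d s ω = ω - P ω - s d ω`, and the
right-hand side is controlled by the suprema of `ω` and `d ω`. This is where the graph norm is used.
-/
theorem exists_homotopy_bound {N : ℕ} (hN : m < N) (k : ℕ) : ∃ C, 0 ≤ C ∧
    ∀ (ω : SmoothForms m) (M : ℝ), (∀ j, ω.BoundedBy j M) → (∀ j, (dOp m ω).BoundedBy j M) →
      (homotopyOp m N ω).BoundedBy k (C * M) ∧ (dOp m (homotopyOp m N ω)).BoundedBy k (C * M) := by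
  obtain ⟨l, C, hC, h⟩ := IsBoundedOp.homotopyOp (m := m) N k
  have hp : ∀ n, ∃ B, 0 ≤ B ∧ ∀ (ω : SmoothForms m) (M : ℝ), (∀ j, ω.BoundedBy j M) →
      (whitney m n fun f => period n f ω).BoundedBy k (B * M) := by
    intro n
    choose l C hC h using exists_period_bound (m := m) n
    obtain ⟨A, hA, hA'⟩ := exists_bound_of_linearMap (whitney m n) k
    refine ⟨A * ∑ f, C f, mul_nonneg hA (Finset.sum_nonneg fun f _ => hC f), fun ω M hω => ?_⟩
    refine (hA' _).mono le_rfl ?_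
    rw [mul_assoc, Finset.sum_mul]
    exact mul_le_mul_of_nonneg_left (Finset.sum_le_sum fun f _ => h f ω M (hω _)) hA
  choose B hB hB' using hp
  have hB0 : 0 ≤ ∑ n ∈ Finset.range N, B n := Finset.sum_nonneg fun n _ => hB n
  refine ⟨C + (1 + ∑ n ∈ Finset.range N, B n), by positivity, fun ω M hω hdω => ?_⟩
  have hM := (hω 0).nonneg
  refine ⟨(h ω M (hω l)).mono le_rfl ?_, ?_⟩
  · exact mul_le_mul_of_nonneg_right (le_add_of_nonneg_right (by positivity)) hM
  · have h1 := eq_sub_of_add_eq (dOp_homotopyOp_add hN ω)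
    rw [h1]
    refine (((hω k).sub (SmoothForms.BoundedBy.sum _ fun n _ => hB' n ω M hω)).sub
      (h _ M (hdω l))).mono le_rfl (le_of_eq ?_)
    rw [← Finset.sum_mul]
    ring

end Bounds

/-! ### Forms of a single degree -/

section OfForm

variable {m k : ℕ}

/-- A `k`-form, as an element of the space of forms of all degrees. -/
def ofForm (α : Tangent m → Tangent m [⋀^Fin k]→L[ℝ] ℝ) (hα : IsSmoothForm α) : SmoothForms m :=
  .mk (Pi.single k α) fun j => by
    by_cases h : j = k
    · subst h
      rwa [Pi.single_eq_same]
    · rw [Pi.single_eq_of_ne h]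
      exact .zero

theorem ofForm_val_same {α : Tangent m → Tangent m [⋀^Fin k]→L[ℝ] ℝ} (hα : IsSmoothForm α)
    (x : Tangent m) : (ofForm α hα).1 k x = α x := by
  rw [ofForm, SmoothForms.mk_val, Pi.single_eq_same]

theorem ofForm_val_of_ne {α : Tangent m → Tangent m [⋀^Fin k]→L[ℝ] ℝ} (hα : IsSmoothForm α)
    {j : ℕ} (hj : j ≠ k) (x : Tangent m) : (ofForm α hα).1 j x = 0 := by
  rw [ofForm, SmoothForms.mk_val, Pi.single_eq_of_ne hj]
  rfl

theorem dOp_val_eq_zero {ω : SmoothForms m} {j : ℕ} (h : ∀ i, i + 1 = j → ∀ x, ω.1 i x = 0)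
    {x : Tangent m} (hx : x ∈ simplexSet m) : (dOp m ω).1 j x = 0 := by
  rcases j with _ | j
  · rfl
  · have h0 : ω.1 j = fun _ => 0 := funext (h j rfl)
    rw [dOp_succ_val _ _ hx, h0, extDerivWithin, fderivWithin_fun_const]
    exact map_zero (ContinuousAlternatingMap.alternatizeUncurryFinCLM ℝ (Tangent m) ℝ)

end OfForm

/-! ### Elementary forms have the prescribed periods -/

/-- The constant volume form taking the value `1` on the edge vectors. -/
def volumeForm (k : ℕ) : Tangent k [⋀^Fin k]→L[ℝ] ℝ where
  toMultilinearMap := ((Matrix.detRowAlternating (R := ℝ) (n := Fin k)).compLinearMap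
    (LinearMap.pi fun i : Fin k => (coordCLM i.succ : Tangent k →L[ℝ] ℝ).toLinearMap)).toMultilinearMap
  cont := by
    change Continuous fun v : Fin k → Tangent k =>
      (Matrix.of fun i j : Fin k => coordCLM (m := k) j.succ (v i)).det
    refine Continuous.matrix_det (continuous_matrix fun i j => ?_)
    exact (coordCLM j.succ).continuous.comp (continuous_apply i)
  map_eq_zero_of_eq' := ((Matrix.detRowAlternating (R := ℝ) (n := Fin k)).compLinearMap
    (LinearMap.pi fun i : Fin k =>
      (coordCLM i.succ : Tangent k →L[ℝ] ℝ).toLinearMap)).map_eq_zero_of_eq'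

theorem volumeForm_edgeVector (k : ℕ) : volumeForm k edgeVector = 1 := by
  change (Matrix.of fun i j : Fin k => coord (edgeVector i) j.succ).det = 1
  have h : (Matrix.of fun i j : Fin k => coord (edgeVector i) j.succ) = 1 := by
    ext i j
    rw [Matrix.of_apply, coord_edgeVector, Matrix.one_apply]
    simp [Fin.succ_inj, eq_comm]
  rw [h, Matrix.det_one]

theorem volume_cornerSimplex_ne_zero (k : ℕ) :
    MeasureTheory.volume.real (cornerSimplex k) ≠ 0 := by
  have hopen : IsOpen {y : Fin k → ℝ | (∀ i, 0 < y i) ∧ ∑ i, y i < 1} := by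
    have h1 : IsOpen {y : Fin k → ℝ | ∀ i, 0 < y i} := by
      simp only [Set.ofPred_forall]
      exact isOpen_iInter_of_finite fun i => isOpen_lt continuous_const (continuous_apply i)
    exact h1.inter (isOpen_lt (f := fun y : Fin k → ℝ => ∑ i, y i) (by fun_prop) continuous_const)
  have hne : {y : Fin k → ℝ | (∀ i, 0 < y i) ∧ ∑ i, y i < 1}.Nonempty := by
    refine ⟨fun _ => 1 / ((k : ℝ) + 1), fun i => by positivity, ?_⟩
    have hk : (0 : ℝ) < (k : ℝ) + 1 := by positivity
    simp only [Finset.sum_const, Finset.card_univ, Fintype.card_fin, nsmul_eq_mul]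
    rw [mul_one_div, div_lt_one hk]
    linarith
  have hpos := (hopen.measure_pos MeasureTheory.volume hne).trans_le
    (MeasureTheory.measure_mono (t := cornerSimplex k) fun y hy => ⟨fun i => (hy.1 i).le, hy.2.le⟩)
  exact (ENNReal.toReal_pos hpos.ne' (isCompact_cornerSimplex k).measure_lt_top.ne).ne'

/-- A constant multiple of the volume form; the factor is divided by the volume of the parameter
domain. -/
theorem exists_period_eq (k : ℕ) (c : ℝ) : ∃ ω : SmoothForms k,
    (∀ j, j ≠ k → ∀ x, ω.1 j x = 0) ∧ period k id ω = c := by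
  set V := MeasureTheory.volume.real (cornerSimplex k)
  have hα : IsSmoothForm ((simplexSet k).indicator fun _ => (c / V) • volumeForm k) :=
    .indicator contDiffOn_const
  refine ⟨ofForm _ hα, fun j hj x => ofForm_val_of_ne hα hj x, ?_⟩
  rw [← integral_eq_period, integral]
  have h : Set.EqOn (fun y => (ofForm _ hα).1 k (cornerMap y) edgeVector) (fun _ => c / V)
      (cornerSimplex k) := fun y hy => by
    simp only [ofForm_val_same, Set.indicator_of_mem (cornerMap_mem hy),
      ContinuousAlternatingMap.smul_apply, volumeForm_edgeVector, smul_eq_mul, mul_one]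
  rw [MeasureTheory.setIntegral_congr_fun (measurableSet_cornerSimplex k) h,
    MeasureTheory.setIntegral_const, smul_eq_mul]
  exact mul_div_cancel₀ c (volume_cornerSimplex_ne_zero k)

/-- Elementary forms are homogeneous, so degree `k` sees a single summand; if `k ≥ N > m`, both
sides vanish for dimension reasons. -/
theorem sum_whitney_val {m N k : ℕ} (hN : m < N) (ω : SmoothForms m) (x : Tangent m) :
    (∑ n ∈ Finset.range N, whitney m n fun f => period n f ω).1 k x =
      (whitney m k fun f => period k f ω).1 k x := by
  rw [SmoothForms.sum_val]
  by_cases hk : k < N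
  · exact Finset.sum_eq_single k (fun n _ hn => whitney_val_eq_zero n _ hn.symm x)
      fun h => absurd (Finset.mem_range.2 hk) h
  · rw [alternating_eq_zero (hN.trans_le (not_lt.1 hk)) ((whitney m k _).1 k x)]
    exact Finset.sum_eq_zero fun n _ =>
      alternating_eq_zero (hN.trans_le (not_lt.1 hk)) _

/-- A form of top degree is closed, so `ω - P ω = d s ω`. By Stokes its period is a sum of periods
of `s ω` over the facets; `s` commutes with restriction, and `ω` restricts to zero on every facet.
-/
theorem period_whitney_of_pure {k : ℕ} {ω : SmoothForms k} (hω : ∀ j, j ≠ k → ∀ x, ω.1 j x = 0) :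
    period k id (whitney k k fun f => period k f ω) = period k id ω := by
  have hN : k < k + 1 := Nat.lt_succ_self k
  have hd : dOp k ω = 0 := SmoothForms.ext_on fun j x hx => by
    by_cases hj : k < j
    · exact (alternating_eq_zero hj _).trans rfl
    · exact (dOp_val_eq_zero (fun i hi y => hω i (by omega) y) hx).trans rfl
  have h := dOp_homotopyOp_add hN ω
  rw [hd, map_zero, add_zero] at h
  rw [period_congr k id (fun x _ => (sum_whitney_val hN ω x).symm),
    ← sub_sub_cancel ω (∑ n ∈ Finset.range (k + 1), whitney k n fun f => period n f ω), ← h,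
    map_sub, sub_eq_self]
  rcases k with _ | k
  · exact period_eq_zero _ _ fun x _ => rfl
  · rw [period_dOp]
    refine Finset.sum_eq_zero fun j _ => ?_
    have h0 : pullOp j.succAbove ω = 0 := SmoothForms.ext_on fun i x hx => by
      by_cases hi : k < i
      · exact (alternating_eq_zero hi _).trans rfl
      · rw [pullOp_val _ _ _ hx, hω i (by omega)]
        rfl
    have h1 := period_pullOp j.succAbove k id (homotopyOp (k + 1) (k + 2) ω)
    rw [pullOp_homotopyOp, h0, map_zero, map_zero] at h1
    exact (congrArg ((-1 : ℝ) ^ (j : ℕ) * ·) h1.symm).trans (mul_zero _)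

section Complexes

variable {V : Type u} {K : AbstractSimplicialComplex V} {p : ℝ≥0∞}

/-! ### Consequences of bounded geometry -/

theorem Simplex.adj {m : ℕ} (ρ : Simplex K m) {i j : Fin (m + 1)} (h : i ≠ j) :
    (skeletonGraph K).Adj (ρ.1 i) (ρ.1 j) :=
  ⟨fun h' => h (ρ.1.injective h'), _, ρ.2, by simp, by simp⟩

/-- The remaining vertices of a simplex are distinct neighbours of its first one. -/
theorem BoundedGeometry.exists_dim_bound (hK : BoundedGeometry K) :
    ∃ N : ℕ, ∀ m, Simplex K m → m < N := by
  obtain ⟨C, hC⟩ := hK.starBounded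
  refine ⟨C + 1, fun m ρ => Nat.lt_succ_of_le ?_⟩
  have hinj : Function.Injective fun j : Fin m => ρ.1 j.succ := fun i j h =>
    Fin.succ_injective _ (ρ.1.injective h)
  have h := (hinj.encard_range.trans (Set.encard_le_encard ?_)).trans (hC (ρ.1 0))
  · simpa using h
  · rintro _ ⟨j, rfl⟩
    exact ρ.adj (Fin.succ_ne_zero j).symm

/-- Every vertex of a simplex over `τ` is the first vertex of `τ` or one of its neighbours, so there
are at most `C + 1` choices for each of the `m + 1` vertices. -/
theorem BoundedGeometry.exists_face_fiber_bound (hK : BoundedGeometry K) {k m : ℕ}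
    (f : Fin (k + 1) ↪ Fin (m + 1)) :
    ∃ C : ℕ, ∀ τ, ((fun ρ : Simplex K m => ρ.face f) ⁻¹' {τ}).encard ≤ C := by
  classical
  obtain ⟨C, hC⟩ := hK.starBounded
  refine ⟨(C + 1) ^ (m + 1), fun τ => ?_⟩
  have hS : (insert (τ.1 0) ((skeletonGraph K).neighborSet (τ.1 0))).encard ≤ (C + 1 : ℕ) :=
    (Set.encard_insert_le _ _).trans (by push_cast; exact add_le_add_left (hC _) 1)
  have hfin := Set.finite_of_encard_le_coe hS
  set S := hfin.toFinset
  have hcard : S.card ≤ C + 1 := by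
    have h : (S : Set V).encard ≤ (C + 1 : ℕ) := by rwa [hfin.coe_toFinset]
    rw [Set.encard_coe_eq_coe_finsetCard] at h
    exact_mod_cast h
  have h1 : ((fun ρ : Simplex K m => ρ.face f) ⁻¹' {τ}).encard ≤
      (Fintype.piFinset fun _ : Fin (m + 1) => S : Set (Fin (m + 1) → V)).encard := by
    refine Set.encard_le_encard_of_injOn (f := fun ρ : Simplex K m => (ρ.1 : Fin (m + 1) → V)) ?_ ?_
    · intro ρ hρ
      have h0 : ρ.1 (f 0) = τ.1 0 := by
        rw [← Set.mem_singleton_iff.1 hρ]; rfl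
      refine Finset.mem_coe.2 (Fintype.mem_piFinset.2 fun j => hfin.mem_toFinset.2 ?_)
      rw [← h0]
      by_cases hj : j = f 0
      · exact Or.inl (congrArg ρ.1 hj)
      · exact Or.inr (ρ.adj (Ne.symm hj))
    · exact fun ρ _ ρ' _ h => Subtype.ext (DFunLike.coe_injective h)
  refine h1.trans ?_
  rw [Set.encard_coe_eq_coe_finsetCard, Fintype.card_piFinset_const]
  exact_mod_cast Nat.pow_le_pow_left hcard _

theorem memℓp_comp_face (hK : BoundedGeometry K) {k m : ℕ} {c : Simplex K k → ℝ} (hc : Memℓp c p)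
    (f : Fin (k + 1) ↪ Fin (m + 1)) : Memℓp (fun ρ : Simplex K m => c (ρ.face f)) p := by
  obtain ⟨C, hC⟩ := hK.exists_face_fiber_bound f
  exact memℓp_comp_of_fibers hc _ C hC

theorem memℓp_comp_mk {b : (Σ m, Simplex K m) → ℝ} (hb : Memℓp b p) (m : ℕ) :
    Memℓp (fun ρ : Simplex K m => b ⟨m, ρ⟩) p := by
  refine memℓp_comp_of_fibers hb (Sigma.mk m) 1 fun s => ?_
  rw [Nat.cast_one, Set.encard_le_one_iff]
  exact fun ρ ρ' h h' => sigma_mk_injective (h.trans h'.symm)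

/-- Only finitely many dimensions occur, so no uniformity in `m` is needed. This allows every later
constant to depend on `m`. -/
theorem memℓp_sigma (hp : 1 ≤ p) {N : ℕ} (hN : ∀ m, Simplex K m → m < N)
    {b : (Σ m, Simplex K m) → ℝ} (hb : ∀ m, Memℓp (fun ρ : Simplex K m => b ⟨m, ρ⟩) p) :
    Memℓp b p := by
  obtain (rfl | rfl | hp0) := p.trichotomy
  · simp at hp
  · choose M hM using fun m => memℓp_infty_iff.1 (hb m)
    rw [memℓp_infty_iff]
    refine ⟨∑ m ∈ Finset.range N, |M m|, ?_⟩
    rintro _ ⟨⟨m, ρ⟩, rfl⟩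
    exact ((hM m ⟨ρ, rfl⟩).trans (le_abs_self _)).trans
      (Finset.single_le_sum (f := fun m => |M m|) (fun i _ => abs_nonneg _)
        (Finset.mem_range.2 (hN m ρ)))
  · rw [memℓp_gen_iff hp0, summable_sigma_of_nonneg fun s => by positivity]
    refine ⟨fun m => (memℓp_gen_iff hp0).1 (hb m), ?_⟩
    refine summable_of_ne_finset_zero (s := Finset.range N) fun m hm => ?_
    have : IsEmpty (Simplex K m) := ⟨fun ρ => hm (Finset.mem_range.2 (hN m ρ))⟩
    exact tsum_empty

/-! ### Compatible families of forms -/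

/-- A family of smooth forms of all degrees on the simplices of `K` which is compatible with
restriction to faces. -/
def IsCompatible (η : ∀ m, Simplex K m → SmoothForms m) : Prop :=
  ∀ (l m : ℕ) (ρ : Simplex K m) (f : Fin (l + 1) ↪ Fin (m + 1)),
    η l (ρ.face f) = pullOp f (η m ρ)

namespace IsCompatible

variable {η : ∀ m, Simplex K m → SmoothForms m}

theorem isPiecewiseSmooth (hη : IsCompatible η) (k : ℕ) :
    IsPiecewiseSmooth fun m ρ => (η m ρ).1 k where
  smooth m ρ := ((η m ρ).2 k).smooth
  zero_outside m ρ := ((η m ρ).2 k).zero_outside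
  restrict l m ρ f x hx := by
    rw [hη l m ρ f, pullOp_val _ _ _ hx, vertexMap_embedding, vertexLin_embedding]

theorem mem_formSpace (hη : IsCompatible η) {k : ℕ} {b : (Σ m, Simplex K m) → ℝ}
    (hb : Memℓp b p) (h : ∀ m ρ, (η m ρ).BoundedBy k (b ⟨m, ρ⟩) ∧
      (dOp m (η m ρ)).BoundedBy (k + 1) (b ⟨m, ρ⟩)) :
    (fun m ρ => (η m ρ).1 k) ∈ formSpace K p k := by
  refine ⟨hη.isPiecewiseSmooth k, hb.mono ?_⟩
  rintro ⟨m, ρ⟩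
  rw [Real.norm_of_nonneg (graphNorm_nonneg _ _)]
  obtain ⟨h1, h2⟩ := h m ρ
  refine max_le (Real.iSup_le (fun x => h1 k le_rfl x x.2) h1.nonneg)
    (Real.iSup_le (fun x => ?_) h1.nonneg)
  have h3 := h2 (k + 1) le_rfl x x.2
  rw [dOp_succ_val _ _ x.2] at h3
  change ‖(simplexSet m).indicator _ _‖ ≤ _
  rwa [Set.indicator_of_mem x.2]

end IsCompatible

/-- The restriction of a piecewise smooth form to a simplex. -/
def germ {k : ℕ} (m : ℕ) (ρ : Simplex K m) : formSpace K p k →ₗ[ℝ] SmoothForms m where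
  toFun ω := ofForm (ω.1 m ρ) ⟨ω.2.1.smooth m ρ, ω.2.1.zero_outside m ρ⟩
  map_add' ω η := SmoothForms.ext_on fun j x _ => by
    rw [SmoothForms.add_val]
    rcases eq_or_ne j k with rfl | hj
    · simp only [ofForm_val_same]
      rfl
    · simp only [ofForm_val_of_ne _ hj, add_zero]
  map_smul' c ω := SmoothForms.ext_on fun j x _ => by
    rw [RingHom.id_apply, SmoothForms.smul_val]
    rcases eq_or_ne j k with rfl | hj
    · simp only [ofForm_val_same]
      rfl
    · simp only [ofForm_val_of_ne _ hj, smul_zero]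

section Germ

variable {k m : ℕ} (ρ : Simplex K m) (ω : formSpace K p k)

theorem germ_val_same (x : Tangent m) : (germ m ρ ω).1 k x = ω.1 m ρ x :=
  ofForm_val_same ⟨ω.2.1.smooth m ρ, ω.2.1.zero_outside m ρ⟩ x

theorem germ_val_of_ne {j : ℕ} (hj : j ≠ k) (x : Tangent m) : (germ m ρ ω).1 j x = 0 :=
  ofForm_val_of_ne ⟨ω.2.1.smooth m ρ, ω.2.1.zero_outside m ρ⟩ hj x

theorem isCompatible_germ : IsCompatible fun m ρ => germ m ρ ω := fun l m ρ f =>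
  SmoothForms.ext_on fun j x hx => by
    rw [pullOp_val _ _ _ hx]
    rcases eq_or_ne j k with rfl | hj
    · rw [germ_val_same, germ_val_same, ω.2.1.restrict l m ρ f x hx, vertexMap_embedding,
        vertexLin_embedding]
    · rw [germ_val_of_ne _ _ hj, germ_val_of_ne _ _ hj]
      rfl

theorem germ_formD : germ m ρ (formD K p k ω) = dOp m (germ m ρ ω) :=
  SmoothForms.ext_on fun j x hx => by
    rcases eq_or_ne j (k + 1) with rfl | hj
    · rw [germ_val_same, dOp_succ_val _ _ hx]
      change (simplexSet m).indicator _ x = _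
      rw [Set.indicator_of_mem hx]
      exact extDerivWithin_congr' (fun y _ => (germ_val_same ρ ω y).symm) hx
    · rw [germ_val_of_ne _ _ hj]
      exact (dOp_val_eq_zero (fun i hi y => germ_val_of_ne ρ ω (by omega) y) hx).symm

theorem germ_boundedBy (j : ℕ) : (germ m ρ ω).BoundedBy j (graphNorm ω.1 ⟨m, ρ⟩) :=
  fun i _ x hx => by
    rcases eq_or_ne i k with rfl | hi
    · rw [germ_val_same]
      exact (le_ciSup (ω.2.1.bddAbove ρ) ⟨x, hx⟩).trans (le_max_left _ _)
    · rw [germ_val_of_ne _ _ hi, norm_zero]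
      exact graphNorm_nonneg _ _

theorem dOp_germ_boundedBy (j : ℕ) : (dOp m (germ m ρ ω)).BoundedBy j (graphNorm ω.1 ⟨m, ρ⟩) := by
  rw [← germ_formD]
  exact (germ_boundedBy ρ _ j).mono le_rfl (ω.2.1.graphNorm_extD_le _)

end Germ

/-! ### The homotopy operator on `L_p` forms -/

theorem isCompatible_homotopyOp {k : ℕ} (N : ℕ) (ω : formSpace K p k) :
    IsCompatible fun m ρ => homotopyOp m N (germ m ρ ω) := fun l m ρ f => by
  simp only [isCompatible_germ ω l m ρ f, pullOp_homotopyOp]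

theorem homotopyOp_mem_formSpace (hp : 1 ≤ p) {N : ℕ} (hN : ∀ m, Simplex K m → m < N) {k : ℕ}
    (ω : formSpace K p (k + 1)) :
    (fun m ρ => (homotopyOp m N (germ m ρ ω)).1 k) ∈ formSpace K p k := by
  have h : ∀ m, ∃ C, m < N → ∀ (ω : SmoothForms m) (M : ℝ), (∀ j, ω.BoundedBy j M) →
      (∀ j, (dOp m ω).BoundedBy j M) → (homotopyOp m N ω).BoundedBy (k + 1) (C * M) ∧
        (dOp m (homotopyOp m N ω)).BoundedBy (k + 1) (C * M) := fun m => by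
    by_cases hm : m < N
    · obtain ⟨C, -, hC⟩ := exists_homotopy_bound hm (k + 1)
      exact ⟨C, fun _ => hC⟩
    -- Simplices of dimension at least `N` do not exist, so the constant is arbitrary there.
    · exact ⟨0, fun h => absurd h hm⟩
  choose C hC using h
  refine (isCompatible_homotopyOp N ω).mem_formSpace (b := fun s => C s.1 * graphNorm ω.1 s)
    (memℓp_sigma hp hN fun m => (memℓp_comp_mk ω.2.2 m).const_mul (C m)) fun m ρ => ?_
  obtain ⟨h1, h2⟩ := hC m (hN m ρ) _ _ (germ_boundedBy ρ ω) (dOp_germ_boundedBy ρ ω)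
  exact ⟨h1.mono (Nat.le_succ k) le_rfl, h2⟩

/-- The chain homotopy between the identity and the projection to elementary forms. -/
def formHomotopy (hp : 1 ≤ p) {N : ℕ} (hN : ∀ m, Simplex K m → m < N) (k : ℕ) :
    formSpace K p (k + 1) →ₗ[ℝ] formSpace K p k where
  toFun ω := ⟨_, homotopyOp_mem_formSpace hp hN ω⟩
  map_add' ω η := Subtype.ext <| funext fun m => funext fun ρ => funext fun x => by
    simp only [map_add, SmoothForms.add_val]
    rfl
  map_smul' c ω := Subtype.ext <| funext fun m => funext fun ρ => funext fun x => by
    simp only [map_smul, SmoothForms.smul_val]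
    rfl

/-! ### Elementary forms of `L_p` cochains -/

/-- The values of a cochain on the tuples of vertices of a simplex, extended by zero to degenerate
tuples. -/
def cochainValues {k m : ℕ} (ρ : Simplex K m) :
    (Simplex K k → ℝ) →ₗ[ℝ] ((Fin (k + 1) → Fin (m + 1)) → ℝ) := by
  classical exact
  { toFun c f := if h : Function.Injective f then c (ρ.face ⟨f, h⟩) else 0
    map_add' c c' := funext fun f => by
      by_cases h : Function.Injective f <;> simp [h]
    map_smul' a c := funext fun f => by
      by_cases h : Function.Injective f <;> simp [h] }

theorem cochainValues_of_injective {k m : ℕ} (ρ : Simplex K m) (c : Simplex K k → ℝ)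
    {f : Fin (k + 1) → Fin (m + 1)} (h : Function.Injective f) :
    cochainValues ρ c f = c (ρ.face ⟨f, h⟩) := dif_pos h

theorem cochainValues_of_not_injective {k m : ℕ} (ρ : Simplex K m) (c : Simplex K k → ℝ)
    {f : Fin (k + 1) → Fin (m + 1)} (h : ¬Function.Injective f) :
    cochainValues ρ c f = 0 := dif_neg h

theorem cochainValues_face {k l m : ℕ} (ρ : Simplex K m) (g : Fin (l + 1) ↪ Fin (m + 1))
    (c : Simplex K k → ℝ) :
    cochainValues (ρ.face g) c = fun f => cochainValues ρ c fun i => g (f i) := by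
  funext f
  by_cases h : Function.Injective f
  · exact (cochainValues_of_injective _ _ h).trans
      (cochainValues_of_injective ρ c (g.injective.comp h)).symm
  · exact (cochainValues_of_not_injective _ _ h).trans
      (cochainValues_of_not_injective ρ c fun h' => h (Function.Injective.of_comp h')).symm

theorem memℓp_cochainValues (hK : BoundedGeometry K) {k : ℕ} {c : Simplex K k → ℝ} (hc : Memℓp c p)
    (m : ℕ) (f : Fin (k + 1) → Fin (m + 1)) :
    Memℓp (fun ρ : Simplex K m => |cochainValues ρ c f|) p := by
  by_cases h : Function.Injective f
  · simp only [cochainValues_of_injective _ _ h, ← Real.norm_eq_abs]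
    exact (memℓp_comp_face hK hc ⟨f, h⟩).norm
  · simp only [cochainValues_of_not_injective _ _ h, abs_zero]
    exact zero_memℓp

theorem isCompatible_whitney {k : ℕ} (c : Simplex K k → ℝ) :
    IsCompatible fun m ρ => whitney m k (cochainValues ρ c) := fun l m ρ g => by
  simp only [cochainValues_face, pullOp_whitney]

/-- On a simplex the form is bounded by the sum of the values of `c` on finitely many faces, and
star-boundedness makes each of these an `ℓ_p` family over the simplices of a given dimension. -/
theorem whitney_mem_formSpace (hK : BoundedGeometry K) (hp : 1 ≤ p) {k : ℕ}
    {c : Simplex K k → ℝ} (hc : Memℓp c p) :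
    (fun m ρ => (whitney m k (cochainValues ρ c)).1 k) ∈ formSpace K p k := by
  obtain ⟨N, hN⟩ := hK.exists_dim_bound
  choose C _ hC using fun m => exists_whitney_bound (m := m) k
  have hb : ∀ m, Memℓp (fun ρ : Simplex K m => C m * ∑ f, |cochainValues ρ c f|) p := fun m =>
    (Memℓp.finsetSum Finset.univ fun f _ => memℓp_cochainValues hK hc m f).const_mul (C m)
  exact (isCompatible_whitney c).mem_formSpace
    (b := fun s => C s.1 * ∑ f, |cochainValues s.2 c f|)
    (memℓp_sigma hp hN hb) fun m ρ => hC m (cochainValues ρ c)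

/-- The elementary form of an `L_p` cochain. -/
def elementaryForm (hK : BoundedGeometry K) (hp : 1 ≤ p) (k : ℕ) :
    cochainSpace K p k →ₗ[ℝ] formSpace K p k where
  toFun c := ⟨_, whitney_mem_formSpace hK hp c.2.2⟩
  map_add' c c' := Subtype.ext <| funext fun m => funext fun ρ => funext fun x => by
    simp only [Submodule.coe_add, map_add, SmoothForms.add_val]
    rfl
  map_smul' a c := Subtype.ext <| funext fun m => funext fun ρ => funext fun x => by
    simp only [Submodule.coe_smul, map_smul, SmoothForms.smul_val]
    rfl

/-! ### Integration of `L_p` forms -/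

theorem period_germ_face {k l m : ℕ} (ω : formSpace K p k) (ρ : Simplex K m)
    (g : Fin (l + 1) ↪ Fin (m + 1)) (f : Fin (k + 1) → Fin (l + 1)) :
    period k f (germ l (ρ.face g) ω) = period k (fun i => g (f i)) (germ m ρ ω) := by
  exact (congrArg (period k f) (isCompatible_germ ω l m ρ g)).trans (period_pullOp g k f _)

theorem integral_eq_period_germ {k : ℕ} (ω : formSpace K p k) (ρ : Simplex K k) :
    integral (ω.1 k ρ) = period k id (germ k ρ ω) := by
  rw [← integral_eq_period]
  congr 1
  exact funext fun x => (germ_val_same ρ ω x).symm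

theorem integral_mem_cochainSpace {k : ℕ} (ω : formSpace K p k) :
    (fun ρ => period k id (germ k ρ ω)) ∈ cochainSpace K p k := by
  obtain ⟨l, C, hC, h⟩ := exists_period_bound (m := k) k id
  refine ⟨fun ρ π => ?_, ((memℓp_comp_mk ω.2.2 k).const_mul C).mono fun ρ => ?_⟩
  · exact (period_germ_face ω ρ π.toEmbedding id).trans (period_perm k id π _)
  · exact h _ _ (germ_boundedBy ρ ω l)

/-- The cochain of integrals of an `L_p` form. -/
def integralCochain (K : AbstractSimplicialComplex V) (p : ℝ≥0∞) (k : ℕ) :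
    formSpace K p k →ₗ[ℝ] cochainSpace K p k where
  toFun ω := ⟨_, integral_mem_cochainSpace ω⟩
  map_add' ω η := Subtype.ext <| funext fun ρ => by
    simp only [map_add]
    rfl
  map_smul' c ω := Subtype.ext <| funext fun ρ => by
    simp only [map_smul]
    rfl

theorem integralCochain_formD (hK : BoundedGeometry K) {k : ℕ} (ω : formSpace K p k) :
    integralCochain K p (k + 1) (formD K p k ω) = cochainD K hK p k (integralCochain K p k ω) := by
  refine Subtype.ext (funext fun ρ => ?_)
  change period (k + 1) id (germ (k + 1) ρ (formD K p k ω)) =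
    ∑ j : Fin (k + 2), (-1) ^ (j : ℕ) * period k id (germ k (ρ.face (Fin.succAboveEmb j)) ω)
  rw [germ_formD, period_dOp]
  refine Finset.sum_congr rfl fun j _ => ?_
  rw [period_germ_face]
  rfl

/-- Both sides vanish on degenerate tuples. Thus the local projection in the homotopy formula is the
elementary form of the cochain of integrals. -/
theorem cochainValues_integralCochain {k m : ℕ} (ω : formSpace K p k) (ρ : Simplex K m) :
    cochainValues ρ (integralCochain K p k ω).1 = fun f => period k f (germ m ρ ω) := by
  funext f
  by_cases h : Function.Injective f
  · rw [cochainValues_of_injective _ _ h]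
    exact period_germ_face ω ρ ⟨f, h⟩ id
  · rw [cochainValues_of_not_injective _ _ h, period_of_not_injective k f h]

/-- The term `d s ω` is written with `dOp` on the simplex because in degree `0` it has no expression
through `formHomotopy`; there it is zero. -/
theorem homotopy_formula_val (hK : BoundedGeometry K) (hp : 1 ≤ p) {N : ℕ}
    (hN : ∀ m, Simplex K m → m < N) {k : ℕ} (ω : formSpace K p k) {m : ℕ} (ρ : Simplex K m)
    (x : Tangent m) :
    (dOp m (homotopyOp m N (germ m ρ ω))).1 k x +
        (formHomotopy hp hN k (formD K p k ω)).1 m ρ x =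
      ω.1 m ρ x - (elementaryForm hK hp k (integralCochain K p k ω)).1 m ρ x := by
  change _ + (homotopyOp m N (germ m ρ (formD K p k ω))).1 k x =
    _ - (whitney m k (cochainValues ρ (integralCochain K p k ω).1)).1 k x
  rw [germ_formD, ← SmoothForms.add_val, dOp_homotopyOp_add (hN m ρ), SmoothForms.sub_val,
    sum_whitney_val (hN m ρ), germ_val_same, cochainValues_integralCochain]

theorem homotopy_formula_zero (hK : BoundedGeometry K) (hp : 1 ≤ p) {N : ℕ}
    (hN : ∀ m, Simplex K m → m < N) (ω : formSpace K p 0) :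
    formHomotopy hp hN 0 (formD K p 0 ω) =
      ω - elementaryForm hK hp 0 (integralCochain K p 0 ω) := by
  refine Subtype.ext (funext fun m => funext fun ρ => funext fun x => ?_)
  have h := homotopy_formula_val hK hp hN ω ρ x
  rw [dOp_zero_val] at h
  exact (zero_add _).symm.trans h

theorem homotopy_formula_succ (hK : BoundedGeometry K) (hp : 1 ≤ p) {N : ℕ}
    (hN : ∀ m, Simplex K m → m < N) {k : ℕ} (ω : formSpace K p (k + 1)) :
    formD K p k (formHomotopy hp hN k ω) + formHomotopy hp hN (k + 1) (formD K p (k + 1) ω) =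
      ω - elementaryForm hK hp (k + 1) (integralCochain K p (k + 1) ω) := by
  refine Subtype.ext (funext fun m => funext fun ρ => funext fun x => ?_)
  rw [Submodule.coe_add, Pi.add_apply, Pi.add_apply, Pi.add_apply]
  refine Eq.trans (congrArg (· + _) ?_) (homotopy_formula_val hK hp hN ω ρ x)
  change (simplexSet m).indicator _ x = _
  by_cases hx : x ∈ simplexSet m
  · rw [Set.indicator_of_mem hx, dOp_succ_val _ _ hx]
    rfl
  · rw [Set.indicator_of_notMem hx, ((dOp m _).2 (k + 1)).zero_outside x hx]

/-- The claim concerns one `k`-simplex at a time. There a multiple of the volume form has the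
prescribed period, and since `c` and periods both alternate, its periods agree with `c` on all
tuples of vertices. -/
theorem integralCochain_elementaryForm (hK : BoundedGeometry K) (hp : 1 ≤ p) {k : ℕ}
    (c : cochainSpace K p k) : integralCochain K p k (elementaryForm hK hp k c) = c := by
  refine Subtype.ext (funext fun ρ => ?_)
  obtain ⟨ω, hω, hωc⟩ := exists_period_eq k (c.1 ρ)
  have h1 : cochainValues ρ c.1 = fun f => period k f ω := by
    funext f
    by_cases h : Function.Injective f
    · rw [cochainValues_of_injective _ _ h]
      let π : Equiv.Perm (Fin (k + 1)) := Equiv.ofBijective f (Finite.injective_iff_bijective.1 h)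
      have h2 := period_perm k id π ω
      rw [hωc, ← c.2.1 ρ π] at h2
      exact h2.symm
    · rw [cochainValues_of_not_injective _ _ h, period_of_not_injective k f h]
  refine (period_congr k id (η := whitney k k (cochainValues ρ c.1)) fun x _ => ?_).trans ?_
  · exact germ_val_same ρ _ x
  · rw [h1, period_whitney_of_pure hω, hωc]

/-- No computation with Whitney forms is needed. Apply the homotopy formula to `d E c`: since `I d =
δ I` and `I E = 1`, it reads `d s d E c = d E c - E δ c`, so it suffices that the left-hand side
vanish. -/
theorem formD_elementaryForm (hK : BoundedGeometry K) (hp : 1 ≤ p) {k : ℕ}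
    (c : cochainSpace K p k) :
    formD K p k (elementaryForm hK hp k c) = elementaryForm hK hp (k + 1) (cochainD K hK p k c) := by
  obtain ⟨N, hN⟩ := hK.exists_dim_bound
  have hdd : ∀ {j} (ω : formSpace K p j), formD K p (j + 1) (formD K p j ω) = 0 := fun ω =>
    Subtype.ext ω.2.1.extD_extD
  have hss : ∀ {j} (ω : formSpace K p j), ω - ω = 0 := fun ω => sub_self ω
  set ω := elementaryForm hK hp k c with hω
  have h1 := homotopy_formula_succ hK hp hN (formD K p k ω)
  rw [hdd, map_zero, add_zero, integralCochain_formD hK, hω,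
    integralCochain_elementaryForm, ← hω] at h1
  -- The formula for `ω = E c` has right-hand side `ω - E I ω = 0`. Hence `s d ω` is `-d s ω`, or
  -- zero in degree `0`, and `d` kills it.
  have h2 : formD K p k (formHomotopy hp hN k (formD K p k ω)) = 0 := by
    rcases k with _ | k
    · rw [homotopy_formula_zero hK hp hN, hω, integralCochain_elementaryForm, hss, map_zero]
    · have h := homotopy_formula_succ hK hp hN ω
      rw [hω, integralCochain_elementaryForm, hss, ← hω] at h
      have h' := congrArg (formD K p (k + 1)) h
      rwa [map_add, hdd, zero_add, map_zero] at h'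
  rw [h2] at h1
  exact sub_eq_zero.1 h1.symm

/-! ### The homotopy equivalence of complexes -/

open CategoryTheory

theorem formComplex_d (k : ℕ) :
    (formComplex K p).d k (k + 1) = ModuleCat.ofHom (formD K p k) :=
  CochainComplex.of_d (fun k => ModuleCat.of ℝ (formSpace K p k))
    (fun k => ModuleCat.ofHom (formD K p k)) k

theorem cochainComplex_d (hK : BoundedGeometry K) (k : ℕ) :
    (cochainComplex K hK p).d k (k + 1) = ModuleCat.ofHom (cochainD K hK p k) :=
  CochainComplex.of_d (fun k => ModuleCat.of ℝ (cochainSpace K p k))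
    (fun k => ModuleCat.ofHom (cochainD K hK p k)) k

/-- Integration as a morphism of complexes. -/
def integralHom (hK : BoundedGeometry K) : formComplex K p ⟶ cochainComplex K hK p :=
  CochainComplex.ofHom (fun k => ModuleCat.ofHom (integralCochain K p k)) fun k => by
    rw [formComplex_d, cochainComplex_d]
    exact ModuleCat.hom_ext (LinearMap.ext fun ω => (integralCochain_formD hK ω).symm)

/-- Elementary forms as a morphism of complexes. -/
def elementaryHom (hK : BoundedGeometry K) (hp : 1 ≤ p) :
    cochainComplex K hK p ⟶ formComplex K p :=
  CochainComplex.ofHom (fun k => ModuleCat.ofHom (elementaryForm hK hp k)) fun k => by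
    rw [formComplex_d, cochainComplex_d]
    exact ModuleCat.hom_ext (LinearMap.ext fun c => formD_elementaryForm hK hp c)

theorem elementaryHom_comp_integralHom (hK : BoundedGeometry K) (hp : 1 ≤ p) :
    elementaryHom hK hp ≫ integralHom hK = 𝟙 (cochainComplex K hK p) := by
  ext k : 1
  exact ModuleCat.hom_ext (LinearMap.ext fun c => integralCochain_elementaryForm hK hp c)

/-- The homotopy between the identity and the projection to elementary forms. -/
def homotopyIntegralElementary (hK : BoundedGeometry K) (hp : 1 ≤ p) :
    Homotopy (𝟙 (formComplex K p)) (integralHom hK ≫ elementaryHom hK hp) := by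
  have hN := hK.exists_dim_bound.choose_spec
  let S : ∀ j, (formComplex K p).X (j + 1) ⟶ (formComplex K p).X j := fun j =>
    ModuleCat.ofHom (formHomotopy hp hN j)
  let D : ∀ j, (formComplex K p).X j ⟶ (formComplex K p).X (j + 1) := fun j =>
    ModuleCat.ofHom (formD K p j)
  have hd : ∀ j, (formComplex K p).d j (j + 1) = D j := formComplex_d
  -- The relation says `j + 1 = i` only propositionally, so the components of the homotopy are
  -- transported along this equality.
  let h : ∀ i j, (ComplexShape.up ℕ).Rel j i → ((formComplex K p).X i ⟶ (formComplex K p).X j) :=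
    fun i j hij => eqToHom (congrArg (formComplex K p).X hij.symm) ≫ S j
  have hh : ∀ j, h (j + 1) j rfl = S j := fun j => Category.id_comp _
  have hs : 𝟙 (formComplex K p) - integralHom hK ≫ elementaryHom hK hp =
      Homotopy.nullHomotopicMap' h := by
    ext k : 1
    rcases k with _ | k
    · rw [Homotopy.nullHomotopicMap'_f_of_not_rel_right (k₁ := 0) (k₀ := 1) rfl (by simp), hh,
        hd]
      exact ModuleCat.hom_ext (LinearMap.ext fun ω => (homotopy_formula_zero hK hp hN ω).symm)
    · rw [Homotopy.nullHomotopicMap'_f (k₂ := k) (k₁ := k + 1) (k₀ := k + 1 + 1) rfl rfl, hh, hh,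
        hd, hd, add_comm (D (k + 1) ≫ S (k + 1))]
      exact ModuleCat.hom_ext (LinearMap.ext fun ω => (homotopy_formula_succ hK hp hN ω).symm)
  exact Homotopy.equivSubZero.symm ((Homotopy.ofEq hs).trans (Homotopy.nullHomotopy' h))

/-- Integration is a homotopy equivalence, with elementary forms as inverse. -/
def integralHomotopyEquiv (hK : BoundedGeometry K) (hp : 1 ≤ p) :
    HomotopyEquiv (cochainComplex K hK p) (formComplex K p) where
  hom := elementaryHom hK hp
  inv := integralHom hK
  homotopyHomInvId := Homotopy.ofEq (elementaryHom_comp_integralHom hK hp)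
  homotopyInvHomId := (homotopyIntegralElementary hK hp).symm

end Complexes

end LpDeRham

end

/-! ### The isomorphism in cohomology. -/

theorem theorem6 {V : Type u} (K : AbstractSimplicialComplex V)
    (hK : LpDeRham.BoundedGeometry K) (p : ENNReal) (hp : 1 ≤ p) :
    ∃ I : LpDeRham.formComplex K p ⟶ LpDeRham.cochainComplex K hK p,
      (∀ (k : ℕ) (ω : LpDeRham.formSpace K p k) (σ : LpDeRham.Simplex K k),
        ((I.f k).hom ω : LpDeRham.cochainSpace K p k).1 σ = LpDeRham.integral (ω.1 k σ)) ∧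
      ∀ k : ℕ, ∃ e : (LpDeRham.cochainComplex K hK p).homology k ≅
          (LpDeRham.formComplex K p).homology k,
        e.inv = HomologicalComplex.homologyMap I k :=
  ⟨LpDeRham.integralHom hK,
    fun _ ω σ => (LpDeRham.integral_eq_period_germ ω σ).symm,
    -- The equivalence goes from cochains to forms by elementary forms, so the inverse isomorphism
    -- is the map induced by integration.
    fun k => ⟨(LpDeRham.integralHomotopyEquiv hK hp).toHomologyIso k, rfl⟩⟩
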